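/- Theorem. Let $R$ be a commutative ring, $\delta\in R$, and let $n\ge m\ge 0$ be integers. For $k\ge 0$ let $\mathrm{Br}_k=\mathrm{Br}_k(R,\delta)$ be the Brauer algebra: the $R$-algebra that is free as an $R$-module on the perfect matchings (diagrams) of $k$ nodes on the left and $k$ nodes on the right, with multiplication given by pasting diagrams side by side and replacing each closed loop by a factor $\delta$. Let $\iota\colon R\mathfrak S_k\to\mathrm{Br}_k$ be the algebra homomorphism that sends a permutation to its permutation diagram (every left node joined to a right node), and let $\pi\colon\mathrm{Br}_k\to R\mathfrak S_k$ be the algebra homomorphism that sends each permutation diagram to its permutation and every other diagram to $0$. Let $\mathbb 1$ denote the trivial (left or right) module: a copy of $R$ on which permutations, respectively permutation diagrams, act as $1$ and all other diagrams act as $0$. Regard $\mathrm{Br}_m$ as a subalgebra of $\mathrm{Br}_n$ by adding horizontal arcs joining the final $n-m$ nodes on the left to the final $n-m$ nodes on the right, and $R\mathfrak S_m$ as the corresponding subalgebra of $R\mathfrak S_n$. The homomorphisms $\iota$ and $\pi$ are compatible with these inclusions and with the actions on $\mathbb 1$, and so induce maps \[ \mathrm{Tor}_*^{R\mathfrak S_n}(\mathbb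 1,R\mathfrak S_n\otimes_{R\mathfrak S_m}\mathbb 1)\xrightarrow{\ \iota_*\ }\mathrm{Tor}_*^{\mathrm{Br}_n}(\mathbb 1,\mathrm{Br}_n\otimes_{\mathrm{Br}_m}\mathbb 1)\xrightarrow{\ \pi_*\ }\mathrm{Tor}_*^{R\mathfrak S_n}(\mathbb 1,R\mathfrak S_n\otimes_{R\mathfrak S_m}\mathbb 1). \] Suppose that $\delta$ is invertible in $R$ or that $m<n$. Then, in every degree, $\iota_*$ and $\pi_*$ are mutually inverse isomorphisms. -/

import Mathlib

namespace Brauer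

/-- Two involutions without common fixed points on a finite set: a point fixed by one of them is
joined to exactly one other such point. -/
theorem exists_unique_end {V : Type*} [Finite V] (f g : Equiv.Perm V) (hf : ∀ v, f (f v) = v)
    (hg : ∀ v, g (g v) = v) (hfg : ∀ v, f v = v → g v ≠ v) (r : V → V → Prop)
    (hr : ∀ v w, r v w ↔ w = f v ∨ w = g v) (x : V) (hx : f x = x) :
    ∃! y, y ≠ x ∧ (f y = y ∨ g y = y) ∧ Quot.mk r x = Quot.mk r y := by
  set ρ : Equiv.Perm V := g * f with hρ
  have hff : f⁻¹ = f := by ext v; rw [Equiv.Perm.inv_eq_iff_eq, hf]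
  have hgg : g⁻¹ = g := by ext v; rw [Equiv.Perm.inv_eq_iff_eq, hg]
  have hconj : f * ρ * f⁻¹ = ρ⁻¹ := by
    rw [hρ, mul_inv_rev, hff, hgg]
    ext v; simp [hf]
  have hfz : ∀ k : ℤ, f ((ρ ^ k) x) = (ρ ^ (-k)) x := by
    intro k
    have h1 : f * ρ ^ k * f⁻¹ = ρ ^ (-k) := by rw [← conj_zpow, hconj, inv_zpow, zpow_neg]
    rw [← h1]; simp [hff, hx]
  have hgz : ∀ k : ℤ, g ((ρ ^ k) x) = (ρ ^ (1 - k)) x := by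
    intro k
    have h1 : g = ρ * f := by rw [hρ, mul_assoc]; ext v; simp [hf]
    conv_lhs => rw [h1]
    rw [Equiv.Perm.mul_apply, hfz, ← Equiv.Perm.mul_apply, ← zpow_one_add, sub_eq_add_neg]
  have hcomp : ∀ y, Quot.mk r x = Quot.mk r y ↔ ∃ k : ℤ, y = (ρ ^ k) x := by
    intro y
    constructor
    · intro h
      rw [Quot.eq] at h
      have key : ∀ a b, Relation.EqvGen r a b →
          ((∃ k : ℤ, a = (ρ ^ k) x) ↔ ∃ k : ℤ, b = (ρ ^ k) x) := by
        intro a b hab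
        induction hab with
        | rel a b hab =>
          have hF : ∀ c, (∃ k : ℤ, c = (ρ ^ k) x) → ∃ k : ℤ, f c = (ρ ^ k) x := by
            rintro c ⟨k, rfl⟩; exact ⟨-k, hfz k⟩
          have hG : ∀ c, (∃ k : ℤ, c = (ρ ^ k) x) → ∃ k : ℤ, g c = (ρ ^ k) x := by
            rintro c ⟨k, rfl⟩; exact ⟨1 - k, hgz k⟩
          rcases (hr a b).1 hab with rfl | rfl
          · exact ⟨hF a, fun h => by simpa [hf] using hF _ h⟩
          · exact ⟨hG a, fun h => by simpa [hg] using hG _ h⟩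
        | refl => exact Iff.rfl
        | symm _ _ _ ih => exact ih.symm
        | trans _ _ _ _ _ ih1 ih2 => exact ih1.trans ih2
      exact (key x y h).1 ⟨0, by simp⟩
    · rintro ⟨k, rfl⟩
      have hF : ∀ c, Quot.mk r c = Quot.mk r (f c) := fun c => Quot.sound ((hr _ _).2 (Or.inl rfl))
      have hG : ∀ c, Quot.mk r c = Quot.mk r (g c) := fun c => Quot.sound ((hr _ _).2 (Or.inr rfl))
      induction k using Int.induction_on with
      | zero => simp
      | succ i ih =>
        rw [ih, hF, hG, hfz, hgz]; congr 3; ring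
      | pred i ih =>
        rw [ih, hG, hF, hgz, hfz]; congr 3; ring
  set N : ℕ := MulAction.period ρ x with hN
  have hNpos : 0 < N := by
    have : IsOfFinOrder ρ := isOfFinOrder_of_finite ρ
    exact MulAction.period_pos_of_orderOf_pos (orderOf_pos_iff.2 this) x
  have hdvd : ∀ k l : ℤ, (ρ ^ k) x = (ρ ^ l) x ↔ (N : ℤ) ∣ k - l := by
    intro k l
    rw [hN, ← MulAction.zpow_smul_eq_iff_period_dvd, Equiv.Perm.smul_def, sub_eq_neg_add, zpow_add,
      Equiv.Perm.mul_apply, zpow_neg, Equiv.Perm.inv_eq_iff_eq]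
  have hdx : ∀ k : ℤ, (ρ ^ k) x = x ↔ (N : ℤ) ∣ k := by
    intro k
    have := hdvd k 0
    simpa using this
  have hends : ∀ k : ℤ, (f ((ρ ^ k) x) = (ρ ^ k) x ∨ g ((ρ ^ k) x) = (ρ ^ k) x) ↔
      ((N : ℤ) ∣ 2 * k ∨ (N : ℤ) ∣ 2 * k - 1) := by
    intro k
    rw [hfz, hgz, hdvd, hdvd, ← dvd_neg, ← dvd_neg (b := 1 - k - k)]
    ring_nf
  have hN1 : N ≠ 1 := by
    intro h1
    have h2 := hdvd 1 0
    rw [h1] at h2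
    have h3 : (ρ ^ (1 : ℤ)) x = (ρ ^ (0 : ℤ)) x := h2.2 (by simp)
    have h4 : g x = x := by simpa [hρ, hx] using h3
    exact hfg x hx h4
  rcases Nat.even_or_odd' N with ⟨M, hM | hM⟩
  · refine ⟨(ρ ^ (M : ℤ)) x, ⟨?_, ?_, (hcomp _).2 ⟨_, rfl⟩⟩, ?_⟩
    · rw [Ne, hdx, hM]
      intro h
      have := Int.le_of_dvd (by omega) h
      push_cast at this
      omega
    · rw [hends, hM]; left; simp
    · rintro y ⟨hy1, hy2, hy3⟩
      obtain ⟨k, rfl⟩ := (hcomp y).1 hy3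
      rw [hends, hM] at hy2
      rw [Ne, hdx, hM] at hy1
      rw [hdvd, hM]
      push_cast at *
      rcases hy2 with ⟨c, hc⟩ | ⟨c, hc⟩
      · rcases Int.even_or_odd' c with ⟨b, hb | hb⟩
        · exact absurd ⟨b, by subst hb; linarith⟩ hy1
        · exact ⟨b, by subst hb; linarith⟩
      · exfalso
        have : 2 * (k - M * c) = 1 := by linarith
        omega
  · refine ⟨(ρ ^ ((M : ℤ) + 1)) x, ⟨?_, ?_, (hcomp _).2 ⟨_, rfl⟩⟩, ?_⟩
    · rw [Ne, hdx, hM]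
      intro h
      have := Int.le_of_dvd (by omega) h
      push_cast at this
      omega
    · rw [hends, hM]; right; exact ⟨1, by push_cast; ring⟩
    · rintro y ⟨hy1, hy2, hy3⟩
      obtain ⟨k, rfl⟩ := (hcomp y).1 hy3
      rw [hends, hM] at hy2
      rw [Ne, hdx, hM] at hy1
      rw [hdvd, hM]
      push_cast at *
      rcases hy2 with ⟨c, hc⟩ | ⟨c, hc⟩
      · exact absurd ⟨k - c * M, by linear_combination (-(M : ℤ)) * hc⟩ hy1
      · exact ⟨-k + c + c * M + 1 - 1, by linear_combination ((M : ℤ) + 1) * hc⟩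
/-- A perfect matching of the nodes `α ⊕ β` (`α` drawn on the left, `β` on the right), encoded by
the fixed-point free involution that sends each node to its partner. -/
@[ext]
structure Diagram (α β : Type*) where
  partner : α ⊕ β → α ⊕ β
  partner_partner : ∀ x, partner (partner x) = x
  partner_ne : ∀ x, partner x ≠ x

namespace Diagram

variable {α β γ κ : Type*}

/-- Pasting `d` and `e` side by side: the arcs of `d` and of `e`, on the nodes `α`, `β`, `γ`. -/
def Glue (d : Diagram α β) (e : Diagram β γ) (v w : α ⊕ (β ⊕ γ)) : Prop :=
  (∃ x : α ⊕ β, v = Sum.map id Sum.inl x ∧ w = Sum.map id Sum.inl (d.partner x)) ∨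
  (∃ y : β ⊕ γ, v = Sum.inr y ∧ w = Sum.inr (e.partner y))

/-- The connected components (arcs and loops) of the pasted diagram. -/
abbrev Component (d : Diagram α β) (e : Diagram β γ) : Type _ := Quot (Glue d e)

/-- The connected component of a node of the pasted diagram. -/
abbrev component (d : Diagram α β) (e : Diagram β γ) (v : α ⊕ (β ⊕ γ)) : Component d e :=
  Quot.mk _ v

/-- The outer nodes of the pasted diagram. -/
abbrev outer : α ⊕ γ → α ⊕ (β ⊕ γ) := Sum.map id Sum.inr

/-- The number of closed loops of the pasted diagram: components without outer nodes. -/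
noncomputable def loops (d : Diagram α β) (e : Diagram β γ) : ℕ :=
  Nat.card {c : Component d e // ∀ x, component d e (outer x) ≠ c}

theorem exists_partner_aux [Finite α] [Finite β] [Finite γ] (d : Diagram α β) (e : Diagram β γ)
    (x : α ⊕ γ) :
    ∃! y, y ≠ x ∧ component d e (outer x) = component d e (outer y) := by
  -- `f` follows the arcs of `d`, and `g` those of `e`
  let f0 : α ⊕ (β ⊕ γ) → α ⊕ (β ⊕ γ) := fun v => match v with
    | Sum.inl a => Sum.map id Sum.inl (d.partner (Sum.inl a))
    | Sum.inr (Sum.inl b) => Sum.map id Sum.inl (d.partner (Sum.inr b))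
    | Sum.inr (Sum.inr c) => Sum.inr (Sum.inr c)
  have hf0 : ∀ x : α ⊕ β, f0 (Sum.map id Sum.inl x) = Sum.map id Sum.inl (d.partner x) := by
    rintro (a | b) <;> rfl
  have hfi : Function.Involutive f0 := by
    rintro (a | b | c)
    · exact (hf0 _).trans (by rw [d.partner_partner]; rfl)
    · exact (hf0 _).trans (by rw [d.partner_partner]; rfl)
    · rfl
  let g0 : α ⊕ (β ⊕ γ) → α ⊕ (β ⊕ γ) := Sum.map id e.partner
  have hgi : Function.Involutive g0 := by
    rintro (a | b)
    · rfl
    · simp [g0, e.partner_partner]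
  have hinj : Function.Injective (Sum.map id Sum.inl : α ⊕ β → α ⊕ (β ⊕ γ)) :=
    Function.injective_id.sumMap Sum.inl_injective
  have hfix : ∀ v, f0 v = v ↔ ∃ c, v = Sum.inr (Sum.inr c) := by
    rintro (a | b | c)
    · have : f0 (Sum.inl a) ≠ Sum.inl a := fun h => d.partner_ne (Sum.inl a) (hinj h)
      simp [this]
    · have : f0 (Sum.inr (Sum.inl b)) ≠ Sum.inr (Sum.inl b) :=
        fun h => d.partner_ne (Sum.inr b) (hinj h)
      simp [this]
    · simp [f0]
  have hgfix : ∀ v, g0 v = v ↔ ∃ a, v = Sum.inl a := by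
    rintro (a | b)
    · simp [g0]
    · simp [g0, e.partner_ne]
  have hglue : ∀ v w, (w = f0 v ∨ w = g0 v) → component d e v = component d e w := by
    rintro (a | b | c) w (rfl | rfl)
    · exact Quot.sound (Or.inl ⟨Sum.inl a, rfl, rfl⟩)
    · rfl
    · exact Quot.sound (Or.inl ⟨Sum.inr b, rfl, rfl⟩)
    · exact Quot.sound (Or.inr ⟨Sum.inl b, rfl, rfl⟩)
    · rfl
    · exact Quot.sound (Or.inr ⟨Sum.inr c, rfl, rfl⟩)
  have hglue' : ∀ v w, Glue d e v w → w = f0 v ∨ w = g0 v := by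
    rintro v w (⟨x, rfl, rfl⟩ | ⟨y, rfl, rfl⟩)
    · exact Or.inl (hf0 x).symm
    · exact Or.inr rfl
  let r : α ⊕ (β ⊕ γ) → α ⊕ (β ⊕ γ) → Prop := fun v w => w = f0 v ∨ w = g0 v
  have hquot : ∀ v w, component d e v = component d e w ↔ Quot.mk r v = Quot.mk r w := by
    intro v w
    constructor
    · intro h
      exact congrArg (Quot.lift (Quot.mk r) fun a b hab => Quot.sound (hglue' a b hab)) h
    · intro h
      exact congrArg (Quot.lift (component d e) fun a b hab => hglue a b hab) h
  have hends : ∀ v, (f0 v = v ∨ g0 v = v) ↔ ∃ y : α ⊕ γ, v = outer y := by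
    intro v
    rw [hfix, hgfix]
    constructor
    · rintro (⟨c, rfl⟩ | ⟨a, rfl⟩)
      · exact ⟨Sum.inr c, rfl⟩
      · exact ⟨Sum.inl a, rfl⟩
    · rintro ⟨a | c, rfl⟩
      · exact Or.inr ⟨a, rfl⟩
      · exact Or.inl ⟨c, rfl⟩
  have houter : Function.Injective (outer : α ⊕ γ → α ⊕ (β ⊕ γ)) :=
    Function.injective_id.sumMap Sum.inr_injective
  have main : ∃! v, v ≠ outer x ∧ (∃ y : α ⊕ γ, v = outer y) ∧
      Quot.mk r (outer x) = Quot.mk r v := by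
    rcases (hends (outer x)).2 ⟨x, rfl⟩ with hx | hx
    · have := exists_unique_end hfi.toPerm hgi.toPerm hfi hgi (fun v h1 h2 => by
        obtain ⟨c, hc⟩ := (hfix v).1 h1
        obtain ⟨a, ha⟩ := (hgfix v).1 h2
        exact absurd (hc.symm.trans ha) (by simp)) r (fun v w => Iff.rfl) (outer x) hx
      simpa only [Function.Involutive.coe_toPerm, hends] using this
    · have := exists_unique_end hgi.toPerm hfi.toPerm hgi hfi (fun v h2 h1 => by
        obtain ⟨c, hc⟩ := (hfix v).1 h1
        obtain ⟨a, ha⟩ := (hgfix v).1 h2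
        exact absurd (hc.symm.trans ha) (by simp)) r (fun v w => or_comm) (outer x) hx
      simpa only [Function.Involutive.coe_toPerm, or_comm (a := g0 _ = _), hends] using this
  obtain ⟨v, ⟨hv1, ⟨y, rfl⟩, hv2⟩, huniq⟩ := main
  refine ⟨y, ⟨fun h => hv1 (by rw [h]), (hquot _ _).2 hv2⟩, ?_⟩
  rintro z ⟨hz1, hz2⟩
  exact houter (huniq (outer z) ⟨fun h => hz1 (houter h), ⟨z, rfl⟩, (hquot _ _).1 hz2⟩)

variable [Finite α] [Finite β] [Finite γ] [Finite κ]

/-- The product diagram: two outer nodes of the pasted diagram are matched if they are the two ends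
of the same component. -/
noncomputable def comp (d : Diagram α β) (e : Diagram β γ) : Diagram α γ where
  partner x := (exists_partner_aux d e x).choose
  partner_partner x := by
    have h1 := (exists_partner_aux d e x).choose_spec.1
    exact ((exists_partner_aux d e _).choose_spec.2 x ⟨h1.1.symm, h1.2.symm⟩).symm
  partner_ne x := (exists_partner_aux d e x).choose_spec.1.1

theorem component_outer_eq (d : Diagram α β) (e : Diagram β γ) (x y : α ⊕ γ) :
    component d e (outer x) = component d e (outer y) ↔ y = x ∨ y = (d.comp e).partner x := by
  have h := (exists_partner_aux d e x).choose_spec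
  constructor
  · intro hxy
    by_cases hyx : y = x
    · exact Or.inl hyx
    · exact Or.inr (h.2 y ⟨hyx, hxy⟩)
  · rintro (rfl | rfl)
    · rfl
    · exact h.1.2

theorem comp_eq (d : Diagram α β) (e : Diagram β γ) (k : Diagram α γ)
    (h : ∀ x, component d e (outer x) = component d e (outer (k.partner x))) : d.comp e = k := by
  ext1
  funext x
  rcases (component_outer_eq d e x (k.partner x)).1 (h x) with h1 | h1
  · exact absurd h1 (k.partner_ne x)
  · exact h1.symm

theorem loops_eq_zero {α β γ : Type*} (d : Diagram α β) (e : Diagram β γ)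
    (h : ∀ b, ∃ x, component d e (outer x) = component d e (Sum.inr (Sum.inl b))) :
    loops d e = 0 := by
  rw [loops, Nat.card_eq_zero]
  left
  refine ⟨fun ⟨c, hc⟩ => ?_⟩
  induction c using Quot.ind with
  | mk v =>
    rcases v with a | b | c
    · exact hc (Sum.inl a) rfl
    · obtain ⟨x, hx⟩ := h b
      exact hc x hx
    · exact hc (Sum.inr c) rfl

/-- Contracting part of a pasted picture does not change connectivity, and the closed components
of the contracted part are the ones that get lost. -/
theorem merge {V V' W X O : Type*} [Finite W] [Finite V']
  (rW : W → W → Prop) (r₂ S : V' → V' → Prop) (T : V → V → Prop)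
  (j₁ : W → V) (j : V' → V) (out : X → W) (x' : X → V') (p : X → X) (o : O → V')
  (hj₁ : Function.Injective j₁) (hj : Function.Injective j)
  (hsq : ∀ x, j₁ (out x) = j (x' x))
  (hcov : ∀ v, (∃ w, v = j₁ w) ∨ ∃ a, v = j a)
  (hpb : ∀ w a, j₁ w = j a → ∃ x, w = out x ∧ a = x' x)
  (hX : ∀ x y, Quot.mk rW (out x) = Quot.mk rW (out y) ↔ y = x ∨ y = p x)
  (hT : ∀ v w, T v w ↔ (∃ a b, rW a b ∧ v = j₁ a ∧ w = j₁ b) ∨ ∃ a b, r₂ a b ∧ v = j a ∧ w = j b)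
  (hS : ∀ v w, S v w ↔ (∃ x, v = x' x ∧ w = x' (p x)) ∨ r₂ v w) : (∀ a b, Quot.mk T (j a) = Quot.mk T (j b) ↔ Quot.mk S a = Quot.mk S b) ∧
    Nat.card {c : Quot T // ∀ i, Quot.mk T (j (o i)) ≠ c} =
      Nat.card {c : Quot rW // ∀ x, Quot.mk rW (out x) ≠ c} +
      Nat.card {c : Quot S // ∀ i, Quot.mk S (o i) ≠ c} := by
  let C := {c : Quot rW // ∀ x, Quot.mk rW (out x) ≠ c}
  -- the maps from contracted pictures to the big one
  let F₁ : Quot rW → Quot T := Quot.lift (fun w => Quot.mk T (j₁ w)) fun a b hab =>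
    Quot.sound ((hT _ _).2 (Or.inl ⟨a, b, hab, rfl, rfl⟩))
  let F₂ : Quot S → Quot T := Quot.lift (fun a => Quot.mk T (j a)) fun a b hab => by
    rcases (hS a b).1 hab with ⟨x, rfl, rfl⟩ | h
    · have h1 : Quot.mk rW (out x) = Quot.mk rW (out (p x)) := (hX _ _).2 (Or.inr rfl)
      have h2 := congrArg F₁ h1
      simp only [F₁, hsq] at h2
      exact h2
    · exact Quot.sound ((hT _ _).2 (Or.inr ⟨a, b, h, rfl, rfl⟩))
  -- an invariant in the other direction
  let P : V → Set (Quot S ⊕ C) := fun v => {z | match z with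
    | Sum.inl c => (∃ a, v = j a ∧ Quot.mk S a = c) ∨
        ∃ w x, v = j₁ w ∧ Quot.mk rW w = Quot.mk rW (out x) ∧ Quot.mk S (x' x) = c
    | Sum.inr c => ∃ w, v = j₁ w ∧ Quot.mk rW w = c.1}
  have hSX : ∀ x y, Quot.mk rW (out x) = Quot.mk rW (out y) → Quot.mk S (x' x) = Quot.mk S (x' y) := by
    intro x y hxy
    rcases (hX x y).1 hxy with rfl | rfl
    · rfl
    · exact Quot.sound ((hS _ _).2 (Or.inl ⟨x, rfl, rfl⟩))
  have hPj : ∀ a, P (j a) = {Sum.inl (Quot.mk S a)} := by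
    intro a
    ext z
    rcases z with c | c
    · simp only [P, Set.mem_ofPred_eq, Set.mem_singleton_iff, Sum.inl.injEq]
      constructor
      · rintro (⟨b, hb, rfl⟩ | ⟨w, x, hw, hwx, rfl⟩)
        · rw [hj hb]
        · obtain ⟨y, rfl, rfl⟩ := hpb w a hw.symm
          exact hSX _ _ hwx.symm
      · rintro rfl
        exact Or.inl ⟨a, rfl, rfl⟩
    · simp only [P, Set.mem_ofPred_eq, Set.mem_singleton_iff, reduceCtorEq, iff_false]
      rintro ⟨w, hw, hc⟩
      obtain ⟨y, rfl, rfl⟩ := hpb w a hw.symm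
      exact c.2 y hc
  have hPw : ∀ w, P (j₁ w) = {z | match z with
      | Sum.inl c => ∃ x, Quot.mk rW w = Quot.mk rW (out x) ∧ Quot.mk S (x' x) = c
      | Sum.inr c => Quot.mk rW w = c.1} := by
    intro w
    ext z
    rcases z with c | c
    · simp only [P, Set.mem_ofPred_eq]
      constructor
      · rintro (⟨b, hb, rfl⟩ | ⟨w', x, hw, hwx, rfl⟩)
        · obtain ⟨y, rfl, rfl⟩ := hpb w b hb
          exact ⟨y, rfl, rfl⟩
        · exact ⟨x, by rw [hj₁ hw, hwx], rfl⟩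
      · rintro ⟨x, hx, rfl⟩
        exact Or.inr ⟨w, x, rfl, hx, rfl⟩
    · simp only [P, Set.mem_ofPred_eq]
      constructor
      · rintro ⟨w', hw, hc⟩
        rw [hj₁ hw, hc]
      · intro h
        exact ⟨w, rfl, h⟩
  have hPT : ∀ v w, T v w → P v = P w := by
    intro v w hvw
    rcases (hT v w).1 hvw with ⟨a, b, hab, rfl, rfl⟩ | ⟨a, b, hab, rfl, rfl⟩
    · rw [hPw, hPw, Quot.sound hab]
    · rw [hPj, hPj, Quot.sound ((hS a b).2 (Or.inr hab))]
  let P' : Quot T → Set (Quot S ⊕ C) := Quot.lift P hPT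
  have hP'2 : ∀ c, P' (F₂ c) = {Sum.inl c} := by
    intro c
    induction c using Quot.ind with
    | mk a => exact hPj a
  have hP'1 : ∀ c : C, P' (F₁ c.1) = {Sum.inr c} := by
    rintro ⟨c, hc⟩
    induction c using Quot.ind with
    | mk w =>
      refine (hPw w).trans ?_
      ext z
      rcases z with c | c
      · simp only [Set.mem_ofPred_eq, Set.mem_singleton_iff, reduceCtorEq, iff_false]
        rintro ⟨x, hx, -⟩
        exact hc x hx.symm
      · simp only [Set.mem_ofPred_eq, Set.mem_singleton_iff, Sum.inr.injEq]
        exact ⟨fun h => Subtype.ext h.symm, fun h => (congrArg Subtype.val h).symm⟩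
  have hF₂inj : Function.Injective F₂ := by
    intro a b hab
    have := congrArg P' hab
    rw [hP'2, hP'2] at this
    exact Sum.inl_injective (Set.singleton_injective this)
  refine ⟨fun a b => ⟨fun h => hF₂inj h, fun h => congrArg F₂ h⟩, ?_⟩
  let G : C ⊕ {c : Quot S // ∀ i, Quot.mk S (o i) ≠ c} →
      {c : Quot T // ∀ i, Quot.mk T (j (o i)) ≠ c} := Sum.elim
    (fun c => ⟨F₁ c.1, fun i h => by
      have h1 : P' (F₂ (Quot.mk S (o i))) = P' (F₁ c.1) := congrArg P' h
      have h2 := (hP'2 (Quot.mk S (o i))).symm.trans (h1.trans (hP'1 c))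
      exact absurd (Set.singleton_injective h2) (by simp)⟩)
    (fun c => ⟨F₂ c.1, fun i h => c.2 i (hF₂inj h)⟩)
  have hG : Function.Bijective G := by
    constructor
    · rintro (a | a) (b | b) hab
      · have := congrArg (fun c => P' c.1) hab
        simp only [G, Sum.elim_inl, hP'1] at this
        exact congrArg Sum.inl (Sum.inr_injective (Set.singleton_injective this))
      · have := congrArg (fun c => P' c.1) hab
        simp only [G, Sum.elim_inl, Sum.elim_inr, hP'1, hP'2] at this
        exact absurd (Set.singleton_injective this) (by simp)
      · have := congrArg (fun c => P' c.1) hab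
        simp only [G, Sum.elim_inl, Sum.elim_inr, hP'1, hP'2] at this
        exact absurd (Set.singleton_injective this) (by simp)
      · have := congrArg (fun c => P' c.1) hab
        simp only [G, Sum.elim_inr, hP'2] at this
        exact congrArg Sum.inr (Subtype.ext (Sum.inl_injective (Set.singleton_injective this)))
    · rintro ⟨c, hc⟩
      have hS' : ∀ c' : Quot S, F₂ c' = c → ∃ a, G a = ⟨c, hc⟩ := by
        rintro c' rfl
        exact ⟨Sum.inr ⟨c', fun i h => hc i (congrArg F₂ h)⟩, rfl⟩
      induction c using Quot.ind with
      | mk v =>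
        rcases hcov v with ⟨w, rfl⟩ | ⟨a, rfl⟩
        · by_cases hw : ∃ x, Quot.mk rW (out x) = Quot.mk rW w
          · obtain ⟨x, hx⟩ := hw
            refine hS' (Quot.mk S (x' x)) ?_
            have := congrArg F₁ hx
            simp only [F₁, hsq] at this
            exact this
          · exact ⟨Sum.inl ⟨Quot.mk rW w, fun x hx => hw ⟨x, hx⟩⟩, rfl⟩
        · exact hS' (Quot.mk S a) rfl
  rw [← Nat.card_sum]
  exact (Nat.card_congr (Equiv.ofBijective G hG)).symm


/-- All arcs of three pasted diagrams. -/
def Glue₃ (d : Diagram α β) (e : Diagram β γ) (f : Diagram γ κ) (v w : α ⊕ (β ⊕ (γ ⊕ κ))) : Prop :=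
  (∃ x : α ⊕ β, v = Sum.map id Sum.inl x ∧ w = Sum.map id Sum.inl (d.partner x)) ∨
  (∃ y : β ⊕ γ, v = Sum.inr (Sum.map id Sum.inl y) ∧
    w = Sum.inr (Sum.map id Sum.inl (e.partner y))) ∨
  (∃ z : γ ⊕ κ, v = Sum.inr (Sum.inr z) ∧ w = Sum.inr (Sum.inr (f.partner z)))

theorem merge_left (d : Diagram α β) (e : Diagram β γ) (f : Diagram γ κ) :
    (∀ x y : α ⊕ κ, Quot.mk (Glue₃ d e f) (Sum.map id (Sum.inr ∘ Sum.inr) x) =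
        Quot.mk (Glue₃ d e f) (Sum.map id (Sum.inr ∘ Sum.inr) y) ↔
      component (d.comp e) f (outer x) = component (d.comp e) f (outer y)) ∧
    Nat.card {c : Quot (Glue₃ d e f) //
      ∀ x : α ⊕ κ, Quot.mk (Glue₃ d e f) (Sum.map id (Sum.inr ∘ Sum.inr) x) ≠ c} =
      loops d e + loops (d.comp e) f := by
  have h := merge (W := α ⊕ (β ⊕ γ)) (V' := α ⊕ (γ ⊕ κ)) (X := α ⊕ γ) (O := α ⊕ κ)
    (Glue d e) (fun v w => ∃ y, v = Sum.inr y ∧ w = Sum.inr (f.partner y))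
    (Glue (d.comp e) f) (Glue₃ d e f)
    (Sum.map id (Sum.map id Sum.inl)) (Sum.map id Sum.inr) outer (Sum.map id Sum.inl)
    (d.comp e).partner outer
    (Function.injective_id.sumMap (Function.injective_id.sumMap Sum.inl_injective))
    (Function.injective_id.sumMap Sum.inr_injective)
    (by rintro (a | c) <;> rfl)
    (by
      rintro (a | b | c | k)
      · exact Or.inl ⟨Sum.inl a, rfl⟩
      · exact Or.inl ⟨Sum.inr (Sum.inl b), rfl⟩
      · exact Or.inl ⟨Sum.inr (Sum.inr c), rfl⟩
      · exact Or.inr ⟨Sum.inr (Sum.inr k), rfl⟩)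
    (by
      rintro (a | b | c) (a' | c' | k') h
      all_goals simp at h
      · subst h; exact ⟨Sum.inl a, rfl, rfl⟩
      · subst h; exact ⟨Sum.inr c, rfl, rfl⟩)
    (component_outer_eq d e)
    (by
      intro v w
      constructor
      · rintro (⟨x, rfl, rfl⟩ | ⟨y, rfl, rfl⟩ | ⟨z, rfl, rfl⟩)
        · exact Or.inl ⟨_, _, Or.inl ⟨x, rfl, rfl⟩, by simp; rfl, by simp; rfl⟩
        · exact Or.inl ⟨_, _, Or.inr ⟨y, rfl, rfl⟩, rfl, rfl⟩
        · exact Or.inr ⟨_, _, ⟨z, rfl, rfl⟩, rfl, rfl⟩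
      · rintro (⟨_, _, ⟨x, rfl, rfl⟩ | ⟨y, rfl, rfl⟩, rfl, rfl⟩ | ⟨_, _, ⟨z, rfl, rfl⟩, rfl, rfl⟩)
        · exact Or.inl ⟨x, by simp; rfl, by simp; rfl⟩
        · exact Or.inr (Or.inl ⟨y, rfl, rfl⟩)
        · exact Or.inr (Or.inr ⟨z, rfl, rfl⟩))
    (fun v w => Iff.rfl)
  have ho : ∀ x : α ⊕ κ, (Sum.map id Sum.inr (outer x : α ⊕ (γ ⊕ κ)) : α ⊕ (β ⊕ (γ ⊕ κ))) =
      Sum.map id (Sum.inr ∘ Sum.inr) x := by rintro (a | k) <;> rfl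
  simp only [ho] at h
  refine ⟨fun x y => ?_, h.2⟩
  rw [← ho, ← ho]
  exact h.1 _ _

theorem merge_right (d : Diagram α β) (e : Diagram β γ) (f : Diagram γ κ) :
    (∀ x y : α ⊕ κ, Quot.mk (Glue₃ d e f) (Sum.map id (Sum.inr ∘ Sum.inr) x) =
        Quot.mk (Glue₃ d e f) (Sum.map id (Sum.inr ∘ Sum.inr) y) ↔
      component d (e.comp f) (outer x) = component d (e.comp f) (outer y)) ∧
    Nat.card {c : Quot (Glue₃ d e f) //
      ∀ x : α ⊕ κ, Quot.mk (Glue₃ d e f) (Sum.map id (Sum.inr ∘ Sum.inr) x) ≠ c} =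
      loops e f + loops d (e.comp f) := by
  have h := merge (W := β ⊕ (γ ⊕ κ)) (V' := α ⊕ (β ⊕ κ)) (X := β ⊕ κ) (O := α ⊕ κ)
    (Glue e f) (fun v w => ∃ x, v = Sum.map id Sum.inl x ∧ w = Sum.map id Sum.inl (d.partner x))
    (Glue d (e.comp f)) (Glue₃ d e f)
    Sum.inr (Sum.map id (Sum.map id Sum.inr)) outer Sum.inr
    (e.comp f).partner outer
    Sum.inr_injective
    (Function.injective_id.sumMap (Function.injective_id.sumMap Sum.inr_injective))
    (by rintro (a | c) <;> rfl)
    (by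
      rintro (a | b)
      · exact Or.inr ⟨Sum.inl a, rfl⟩
      · exact Or.inl ⟨b, rfl⟩)
    (by
      rintro (b | c | k) (a' | b' | k') h
      all_goals simp at h
      · subst h; exact ⟨Sum.inl b, rfl, rfl⟩
      · subst h; exact ⟨Sum.inr k, rfl, rfl⟩)
    (component_outer_eq e f)
    (by
      intro v w
      have hx : ∀ x : α ⊕ β, (Sum.map id (Sum.map id Sum.inr)
          (Sum.map id Sum.inl x : α ⊕ (β ⊕ κ)) : α ⊕ (β ⊕ (γ ⊕ κ))) = Sum.map id Sum.inl x := by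
        rintro (a | b) <;> rfl
      constructor
      · rintro (⟨x, rfl, rfl⟩ | ⟨y, rfl, rfl⟩ | ⟨z, rfl, rfl⟩)
        · exact Or.inr ⟨_, _, ⟨x, rfl, rfl⟩, (hx _).symm, (hx _).symm⟩
        · exact Or.inl ⟨_, _, Or.inl ⟨y, rfl, rfl⟩, rfl, rfl⟩
        · exact Or.inl ⟨_, _, Or.inr ⟨z, rfl, rfl⟩, rfl, rfl⟩
      · rintro (⟨_, _, ⟨y, rfl, rfl⟩ | ⟨z, rfl, rfl⟩, rfl, rfl⟩ | ⟨_, _, ⟨x, rfl, rfl⟩, rfl, rfl⟩)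
        · exact Or.inr (Or.inl ⟨y, rfl, rfl⟩)
        · exact Or.inr (Or.inr ⟨z, rfl, rfl⟩)
        · exact Or.inl ⟨x, hx _, hx _⟩)
    (fun v w => or_comm)
  have ho : ∀ x : α ⊕ κ, (Sum.map id (Sum.map id Sum.inr) (outer x : α ⊕ (β ⊕ κ)) :
      α ⊕ (β ⊕ (γ ⊕ κ))) = Sum.map id (Sum.inr ∘ Sum.inr) x := by rintro (a | k) <;> rfl
  simp only [ho] at h
  refine ⟨fun x y => ?_, h.2⟩
  rw [← ho, ← ho]
  exact h.1 _ _

theorem comp_assoc (d : Diagram α β) (e : Diagram β γ) (f : Diagram γ κ) :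
    (d.comp e).comp f = d.comp (e.comp f) := by
  refine comp_eq _ _ _ fun x => ?_
  rw [← (merge_left d e f).1, (merge_right d e f).1, component_outer_eq]
  exact Or.inr rfl

theorem loops_assoc (d : Diagram α β) (e : Diagram β γ) (f : Diagram γ κ) :
    loops d e + loops (d.comp e) f = loops e f + loops d (e.comp f) := by
  rw [← (merge_left d e f).2, (merge_right d e f).2]

end Diagram

namespace Diagram

variable {α β γ : Type*}

theorem component_left (d : Diagram α β) (e : Diagram β γ) (x : α ⊕ β) :
    component d e (Sum.map id Sum.inl x) = component d e (Sum.map id Sum.inl (d.partner x)) :=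
  Quot.sound (Or.inl ⟨x, rfl, rfl⟩)

theorem component_right (d : Diagram α β) (e : Diagram β γ) (y : β ⊕ γ) :
    component d e (Sum.inr y) = component d e (Sum.inr (e.partner y)) :=
  Quot.sound (Or.inr ⟨y, rfl, rfl⟩)

/-- The permutation diagram of `σ`, in which the node `j` on the right is joined to the node `σ j`
on the left. -/
def ofPerm (σ : Equiv.Perm α) : Diagram α α where
  partner := Sum.elim (fun i => Sum.inr (σ⁻¹ i)) (fun j => Sum.inl (σ j))
  partner_partner := by rintro (i | j) <;> simp
  partner_ne := by rintro (i | j) <;> simp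

@[simp] theorem ofPerm_inl (σ : Equiv.Perm α) (i : α) :
    (ofPerm σ).partner (Sum.inl i) = Sum.inr (σ⁻¹ i) := rfl

@[simp] theorem ofPerm_inr (σ : Equiv.Perm α) (j : α) :
    (ofPerm σ).partner (Sum.inr j) = Sum.inl (σ j) := rfl

theorem ofPerm_injective : Function.Injective (ofPerm : Equiv.Perm α → Diagram α α) := by
  intro σ τ h
  ext j
  have := congrArg (fun d => d.partner (Sum.inr j)) h
  simpa using this

theorem component_ofPerm_left (σ : Equiv.Perm α) (e : Diagram α γ) (j : α) :
    component (ofPerm σ) e (Sum.inl (σ j)) = component (ofPerm σ) e (Sum.inr (Sum.inl j)) :=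
  (component_left (ofPerm σ) e (Sum.inr j)).symm

theorem component_ofPerm_right (d : Diagram α β) (σ : Equiv.Perm β) (j : β) :
    component d (ofPerm σ) (Sum.inr (Sum.inr j)) = component d (ofPerm σ) (Sum.inr (Sum.inl (σ j))) :=
  component_right d (ofPerm σ) (Sum.inr j)

theorem loops_ofPerm_left (σ : Equiv.Perm α) (e : Diagram α γ) : loops (ofPerm σ) e = 0 :=
  loops_eq_zero _ _ fun j => ⟨Sum.inl (σ j), component_ofPerm_left σ e j⟩

theorem loops_ofPerm_right (d : Diagram α β) (σ : Equiv.Perm β) : loops d (ofPerm σ) = 0 :=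
  loops_eq_zero _ _ fun j => ⟨Sum.inr (σ⁻¹ j), by
    have := component_ofPerm_right d σ (σ⁻¹ j)
    simpa using this⟩

theorem ofPerm_comp [Finite α] (σ τ : Equiv.Perm α) :
    (ofPerm σ).comp (ofPerm τ) = ofPerm (σ * τ) := by
  have key : ∀ j : α, component (ofPerm σ) (ofPerm τ) (outer (Sum.inr j)) =
      component (ofPerm σ) (ofPerm τ) (outer (Sum.inl (σ (τ j)))) := fun j =>
    (component_ofPerm_right (ofPerm σ) τ j).trans (component_ofPerm_left σ (ofPerm τ) (τ j)).symm
  refine comp_eq _ _ _ ?_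
  rintro (i | j)
  · have := key (τ⁻¹ (σ⁻¹ i))
    rw [show σ (τ (τ⁻¹ (σ⁻¹ i))) = i by simp] at this
    exact this.symm
  · exact key j

theorem one_comp [Finite α] [Finite γ] (e : Diagram α γ) : (ofPerm 1).comp e = e := by
  have key : ∀ y : α ⊕ γ, component (ofPerm 1) e (outer y) = component (ofPerm 1) e (Sum.inr y) := by
    rintro (i | k)
    · exact component_ofPerm_left 1 e i
    · rfl
  refine comp_eq _ _ _ fun x => ?_
  rw [key, key]
  exact component_right _ e x

theorem comp_one [Finite α] [Finite β] (d : Diagram α β) : d.comp (ofPerm 1) = d := by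
  have key : ∀ y : α ⊕ β, component d (ofPerm 1) (outer y) =
      component d (ofPerm 1) (Sum.map id Sum.inl y) := by
    rintro (i | k)
    · rfl
    · exact component_ofPerm_right d 1 k
  refine comp_eq _ _ _ fun x => ?_
  rw [key, key]
  exact component_left d _ x

theorem exists_ofPerm_of_left [Finite α] (d : Diagram α α)
    (h : ∀ i, ∃ j, d.partner (Sum.inl i) = Sum.inr j) : ∃ σ, d = ofPerm σ := by
  choose f hf using h
  have hinj : Function.Injective f := by
    intro i i' hii
    have h1 : d.partner (Sum.inl i) = d.partner (Sum.inl i') := by rw [hf, hf, hii]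
    have h2 := congrArg d.partner h1
    rw [d.partner_partner, d.partner_partner] at h2
    exact Sum.inl_injective h2
  let σ : Equiv.Perm α := Equiv.ofBijective f (Finite.injective_iff_bijective.1 hinj)
  refine ⟨σ⁻¹, ?_⟩
  ext1
  funext x
  rcases x with i | j
  · rw [hf]; rfl
  · obtain ⟨i, rfl⟩ := σ.surjective j
    have h1 : d.partner (Sum.inl i) = Sum.inr (σ i) := hf i
    rw [← h1, d.partner_partner, h1]
    simp

theorem exists_ofPerm_of_right [Finite α] (d : Diagram α α)
    (h : ∀ j, ∃ i, d.partner (Sum.inr j) = Sum.inl i) : ∃ σ, d = ofPerm σ := by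
  choose f hf using h
  have hinj : Function.Injective f := by
    intro i i' hii
    have h1 : d.partner (Sum.inr i) = d.partner (Sum.inr i') := by rw [hf, hf, hii]
    have h2 := congrArg d.partner h1
    rw [d.partner_partner, d.partner_partner] at h2
    exact Sum.inr_injective h2
  let σ : Equiv.Perm α := Equiv.ofBijective f (Finite.injective_iff_bijective.1 hinj)
  refine ⟨σ, ?_⟩
  ext1
  funext x
  rcases x with j | i
  · obtain ⟨i, rfl⟩ := σ.surjective j
    have h1 : d.partner (Sum.inr i) = Sum.inl (σ i) := hf i
    rw [← h1, d.partner_partner, h1]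
    simp
  · rw [hf]; rfl

theorem ofPerm_of_comp_left [Finite α] (d e : Diagram α α) (h : ∃ σ, d.comp e = ofPerm σ) :
    ∃ σ, d = ofPerm σ := by
  obtain ⟨σ, hσ⟩ := h
  refine exists_ofPerm_of_left d fun i => ?_
  rcases hd : d.partner (Sum.inl i) with i' | j
  · exfalso
    have h1 : component d e (outer (Sum.inl i)) = component d e (outer (Sum.inl i')) := by
      have := component_left d e (Sum.inl i)
      rw [hd] at this
      exact this
    rcases (component_outer_eq d e _ _).1 h1 with h2 | h2
    · exact d.partner_ne (Sum.inl i) (by rw [hd, h2])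
    · rw [hσ] at h2; simp at h2
  · exact ⟨j, rfl⟩

theorem ofPerm_of_comp_right [Finite α] (d e : Diagram α α) (h : ∃ σ, d.comp e = ofPerm σ) :
    ∃ σ, e = ofPerm σ := by
  obtain ⟨σ, hσ⟩ := h
  refine exists_ofPerm_of_right e fun j => ?_
  rcases he : e.partner (Sum.inr j) with i | j'
  · exact ⟨i, rfl⟩
  · exfalso
    have h1 : component d e (outer (Sum.inr j)) = component d e (outer (Sum.inr j')) := by
      have := component_right d e (Sum.inr j)
      rw [he] at this
      exact this
    rcases (component_outer_eq d e _ _).1 h1 with h2 | h2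
    · exact e.partner_ne (Sum.inr j) (by rw [he, h2])
    · rw [hσ] at h2; simp at h2

section Extend

variable {m n : ℕ} (h : m ≤ n)

/-- Add `n - m` horizontal arcs to a diagram on `m` nodes, joining the final nodes on the left to
the final nodes on the right. -/
def extend (d : Diagram (Fin m) (Fin m)) : Diagram (Fin n) (Fin n) where
  partner := Sum.elim
    (fun i => if hi : i.1 < m then
      Sum.map (Fin.castLE h) (Fin.castLE h) (d.partner (Sum.inl ⟨i, hi⟩)) else Sum.inr i)
    (fun j => if hj : j.1 < m then
      Sum.map (Fin.castLE h) (Fin.castLE h) (d.partner (Sum.inr ⟨j, hj⟩)) else Sum.inl j)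
  partner_partner := by
    have key : ∀ x : Fin m ⊕ Fin m, Sum.elim
        (fun i : Fin n => if hi : i.1 < m then
          Sum.map (Fin.castLE h) (Fin.castLE h) (d.partner (Sum.inl ⟨i, hi⟩)) else Sum.inr i)
        (fun j : Fin n => if hj : j.1 < m then
          Sum.map (Fin.castLE h) (Fin.castLE h) (d.partner (Sum.inr ⟨j, hj⟩)) else Sum.inl j)
        (Sum.map (Fin.castLE h) (Fin.castLE h) x) =
        Sum.map (Fin.castLE h) (Fin.castLE h) (d.partner x) := by
      rintro (i | j) <;> simp
    rintro (i | i)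
    all_goals
      by_cases hi : i.1 < m
      · simp only [Sum.elim_inl, Sum.elim_inr, hi, dite_true]
        rw [key, d.partner_partner]
        simp
      · simp [hi]
  partner_ne := by
    have hinj : Function.Injective (Sum.map (Fin.castLE h) (Fin.castLE h)) :=
      (Fin.castLE_injective h).sumMap (Fin.castLE_injective h)
    rintro (i | i)
    all_goals
      by_cases hi : i.1 < m
      · simp only [Sum.elim_inl, Sum.elim_inr, hi, dite_true]
        intro hd
        first
          | exact d.partner_ne (Sum.inl ⟨i, hi⟩) (hinj (hd.trans (by simp)))
          | exact d.partner_ne (Sum.inr ⟨i, hi⟩) (hinj (hd.trans (by simp)))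
      · simp [hi]

theorem extend_castLE (d : Diagram (Fin m) (Fin m)) (x : Fin m ⊕ Fin m) :
    (d.extend h).partner (Sum.map (Fin.castLE h) (Fin.castLE h) x) =
      Sum.map (Fin.castLE h) (Fin.castLE h) (d.partner x) := by
  rcases x with i | j <;> simp [extend]

theorem extend_inl (d : Diagram (Fin m) (Fin m)) (i : Fin n) (hi : ¬ i.1 < m) :
    (d.extend h).partner (Sum.inl i) = Sum.inr i := by
  simp [extend, hi]

theorem extend_inr (d : Diagram (Fin m) (Fin m)) (i : Fin n) (hi : ¬ i.1 < m) :
    (d.extend h).partner (Sum.inr i) = Sum.inl i := by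
  simp [extend, hi]

theorem extend_ofPerm (σ : Equiv.Perm (Fin m)) :
    (ofPerm σ).extend h = ofPerm (σ.viaEmbedding (Fin.castLEEmb h)) := by
  have hr : ∀ i : Fin n, ¬ i.1 < m → i ∉ Set.range (Fin.castLEEmb h) := by
    rintro i hi ⟨j, rfl⟩
    exact hi (by simp)
  have hv : ∀ (τ : Equiv.Perm (Fin m)) (i : Fin m),
      τ.viaEmbedding (Fin.castLEEmb h) (Fin.castLE h i) = Fin.castLE h (τ i) := fun τ i =>
    Equiv.Perm.viaEmbedding_apply τ (Fin.castLEEmb h) i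
  have hinv : (σ.viaEmbedding (Fin.castLEEmb h))⁻¹ = σ⁻¹.viaEmbedding (Fin.castLEEmb h) := by
    rw [← Equiv.Perm.viaEmbeddingHom_apply, ← map_inv, Equiv.Perm.viaEmbeddingHom_apply]
  ext1
  funext x
  rcases x with i | i
  all_goals
    by_cases hi : i.1 < m
    · obtain ⟨j, rfl⟩ : ∃ j : Fin m, i = Fin.castLE h j := ⟨⟨i, hi⟩, rfl⟩
      first
        | refine (extend_castLE h (ofPerm σ) (Sum.inl j)).trans ?_
          rw [ofPerm_inl, ofPerm_inl, hinv, hv]; rfl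
        | refine (extend_castLE h (ofPerm σ) (Sum.inr j)).trans ?_
          rw [ofPerm_inr, ofPerm_inr, hv]; rfl
    · first
        | rw [extend_inl h _ i hi, ofPerm_inl, hinv,
            Equiv.Perm.viaEmbedding_apply_of_notMem _ _ _ (hr i hi)]
        | rw [extend_inr h _ i hi, ofPerm_inr,
            Equiv.Perm.viaEmbedding_apply_of_notMem _ _ _ (hr i hi)]

theorem ofPerm_of_extend (d : Diagram (Fin m) (Fin m)) (hd : ∃ σ, d.extend h = ofPerm σ) :
    ∃ σ, d = ofPerm σ := by
  obtain ⟨σ, hσ⟩ := hd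
  refine exists_ofPerm_of_left d fun i => ?_
  rcases hi : d.partner (Sum.inl i) with i' | j
  · have h1 := extend_castLE h d (Sum.inl i)
    rw [hσ, hi] at h1
    simp at h1
  · exact ⟨j, rfl⟩

/-- The inclusion of the nodes of a pasted diagram. -/
def castNode : Fin m ⊕ (Fin m ⊕ Fin m) → Fin n ⊕ (Fin n ⊕ Fin n) :=
  Sum.map (Fin.castLE h) (Sum.map (Fin.castLE h) (Fin.castLE h))

theorem glue_castNode (d e : Diagram (Fin m) (Fin m)) (v w : Fin m ⊕ (Fin m ⊕ Fin m))
    (hvw : Glue d e v w) : Glue (d.extend h) (e.extend h) (castNode h v) (castNode h w) := by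
  have hc : ∀ x : Fin m ⊕ Fin m, castNode h (Sum.map id Sum.inl x) =
      Sum.map id Sum.inl (Sum.map (Fin.castLE h) (Fin.castLE h) x) := by
    rintro (i | j) <;> rfl
  rcases hvw with ⟨x, rfl, rfl⟩ | ⟨y, rfl, rfl⟩
  · refine Or.inl ⟨Sum.map (Fin.castLE h) (Fin.castLE h) x, hc _, ?_⟩
    rw [extend_castLE, hc]
  · refine Or.inr ⟨Sum.map (Fin.castLE h) (Fin.castLE h) y, rfl, ?_⟩
    rw [extend_castLE]; rfl

/-- The components of a pasted diagram, in the extended pasted diagram. -/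
def castComponent (d e : Diagram (Fin m) (Fin m)) (c : Component d e) :
    Component (d.extend h) (e.extend h) :=
  Quot.lift (fun v => component (d.extend h) (e.extend h) (castNode h v))
    (fun v w hvw => Quot.sound (glue_castNode h d e v w hvw)) c

/-- The common label of a node. -/
def label : Fin n ⊕ (Fin n ⊕ Fin n) → Fin n := Sum.elim id (Sum.elim id id)

theorem castComponent_injective (d e : Diagram (Fin m) (Fin m)) :
    Function.Injective (castComponent h d e) := by
  let P : Fin n ⊕ (Fin n ⊕ Fin n) → Set (Component d e) := fun v =>
    {c | ∃ w, v = castNode h w ∧ component d e w = c}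
  have hinj : Function.Injective (castNode h) := (Fin.castLE_injective h).sumMap
    ((Fin.castLE_injective h).sumMap (Fin.castLE_injective h))
  have hP1 : ∀ w, P (castNode h w) = {component d e w} := by
    intro w
    ext c
    simp only [P, Set.mem_ofPred_eq, Set.mem_singleton_iff]
    constructor
    · rintro ⟨w', hw, rfl⟩
      rw [hinj hw]
    · rintro rfl
      exact ⟨w, rfl, rfl⟩
  have hP2 : ∀ v, ¬ (label v).1 < m → P v = ∅ := by
    intro v hv
    ext c
    simp only [P, Set.mem_ofPred_eq, Set.mem_empty_iff_false, iff_false]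
    rintro ⟨w, rfl, -⟩
    rcases w with i | i | i <;> exact hv i.2
  have hP : ∀ v w, Glue (d.extend h) (e.extend h) v w → P v = P w := by
    have hc : ∀ x : Fin m ⊕ Fin m, castNode h (Sum.map id Sum.inl x) =
        Sum.map id Sum.inl (Sum.map (Fin.castLE h) (Fin.castLE h) x) := by
      rintro (i | j) <;> rfl
    have hcase : ∀ x : Fin n ⊕ Fin n, (∃ x', x = Sum.map (Fin.castLE h) (Fin.castLE h) x') ∨
        ∃ i : Fin n, ¬ i.1 < m ∧ (x = Sum.inl i ∨ x = Sum.inr i) := by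
      rintro (i | i)
      all_goals by_cases hi : i.1 < m
      · exact Or.inl ⟨Sum.inl ⟨i, hi⟩, rfl⟩
      · exact Or.inr ⟨i, hi, Or.inl rfl⟩
      · exact Or.inl ⟨Sum.inr ⟨i, hi⟩, rfl⟩
      · exact Or.inr ⟨i, hi, Or.inr rfl⟩
    rintro v w (⟨x, rfl, rfl⟩ | ⟨y, rfl, rfl⟩)
    · rcases hcase x with ⟨x, rfl⟩ | ⟨i, hi, rfl | rfl⟩
      · rw [extend_castLE, ← hc, ← hc, hP1, hP1, component_left]
      · rw [extend_inl h _ i hi]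
        exact (hP2 (Sum.inl i) hi).trans (hP2 (Sum.inr (Sum.inl i)) hi).symm
      · rw [extend_inr h _ i hi]
        exact (hP2 (Sum.inr (Sum.inl i)) hi).trans (hP2 (Sum.inl i) hi).symm
    · rcases hcase y with ⟨y, rfl⟩ | ⟨i, hi, rfl | rfl⟩
      · rw [extend_castLE]
        refine (hP1 (Sum.inr y)).trans ?_
        rw [component_right]
        exact (hP1 (Sum.inr (e.partner y))).symm
      · rw [extend_inl h _ i hi]
        exact (hP2 (Sum.inr (Sum.inl i)) hi).trans (hP2 (Sum.inr (Sum.inr i)) hi).symm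
      · rw [extend_inr h _ i hi]
        exact (hP2 (Sum.inr (Sum.inr i)) hi).trans (hP2 (Sum.inr (Sum.inl i)) hi).symm
  intro a b hab
  induction a using Quot.ind with
  | mk v =>
    induction b using Quot.ind with
    | mk w =>
      have h1 : P (castNode h v) = P (castNode h w) := congrArg (Quot.lift P hP) hab
      rw [hP1, hP1] at h1
      exact Set.singleton_injective h1

theorem component_label (d e : Diagram (Fin m) (Fin m)) (v : Fin n ⊕ (Fin n ⊕ Fin n))
    (hv : ¬ (label v).1 < m) : component (d.extend h) (e.extend h) v =
      component (d.extend h) (e.extend h) (Sum.inl (label v)) := by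
  rcases v with i | i | i
  · rfl
  · have := component_left (d.extend h) (e.extend h) (Sum.inr i)
    rw [extend_inr h _ i hv] at this
    exact this
  · have h1 := component_left (d.extend h) (e.extend h) (Sum.inr i)
    have h2 := component_right (d.extend h) (e.extend h) (Sum.inr i)
    rw [extend_inr h _ i hv] at h1 h2
    exact h2.trans h1

theorem extend_comp (d e : Diagram (Fin m) (Fin m)) :
    (d.extend h).comp (e.extend h) = (d.comp e).extend h := by
  have ho : ∀ x : Fin m ⊕ Fin m, castNode h (outer x) =
      outer (Sum.map (Fin.castLE h) (Fin.castLE h) x) := by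
    rintro (i | j) <;> rfl
  refine comp_eq _ _ _ fun x => ?_
  have key : ∀ x : Fin m ⊕ Fin m,
      component (d.extend h) (e.extend h) (outer (Sum.map (Fin.castLE h) (Fin.castLE h) x)) =
      component (d.extend h) (e.extend h)
        (outer (Sum.map (Fin.castLE h) (Fin.castLE h) ((d.comp e).partner x))) := by
    intro x
    rw [← ho, ← ho]
    exact congrArg (castComponent h d e) ((component_outer_eq d e x _).2 (Or.inr rfl))
  rcases x with i | i
  all_goals by_cases hi : i.1 < m
  · have := key (Sum.inl ⟨i, hi⟩)
    rw [← extend_castLE] at this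
    exact this
  · rw [extend_inl h _ i hi]
    exact (component_label h d e (Sum.inr (Sum.inr i)) hi).symm
  · have := key (Sum.inr ⟨i, hi⟩)
    rw [← extend_castLE] at this
    exact this
  · rw [extend_inr h _ i hi]
    exact component_label h d e (Sum.inr (Sum.inr i)) hi

theorem loops_extend (d e : Diagram (Fin m) (Fin m)) :
    loops (d.extend h) (e.extend h) = loops d e := by
  have ho : ∀ x : Fin m ⊕ Fin m, castNode h (outer x) =
      outer (Sum.map (Fin.castLE h) (Fin.castLE h) x) := by
    rintro (i | j) <;> rfl
  have hcn : ∀ v : Fin n ⊕ (Fin n ⊕ Fin n), (label v).1 < m → ∃ w, v = castNode h w := by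
    rintro (i | i | i) hi
    · exact ⟨Sum.inl ⟨i, hi⟩, rfl⟩
    · exact ⟨Sum.inr (Sum.inl ⟨i, hi⟩), rfl⟩
    · exact ⟨Sum.inr (Sum.inr ⟨i, hi⟩), rfl⟩
  let G : {c : Component d e // ∀ x, component d e (outer x) ≠ c} →
      {c : Component (d.extend h) (e.extend h) // ∀ x,
        component (d.extend h) (e.extend h) (outer x) ≠ c} := fun c =>
    ⟨castComponent h d e c.1, by
      have key : ∀ w : Fin m ⊕ Fin m, component (d.extend h) (e.extend h)
          (outer (Sum.map (Fin.castLE h) (Fin.castLE h) w)) ≠ castComponent h d e c.1 := by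
        intro w hw
        rw [← ho] at hw
        exact c.2 w (castComponent_injective h d e hw)
      have key2 : ∀ i : Fin n, ¬ i.1 < m → component (d.extend h) (e.extend h) (Sum.inl i) ≠
          castComponent h d e c.1 := by
        obtain ⟨c, hc⟩ := c
        induction c using Quot.ind with
        | mk v =>
          intro i hi hic
          let L : Component (d.extend h) (e.extend h) → Prop := Quot.lift
            (fun v => ¬ (label v).1 < m) (by
              have hcase : ∀ (f : Diagram (Fin m) (Fin m)) (x : Fin n ⊕ Fin n),
                  (Sum.elim id id x).1 < m ↔
                    (Sum.elim id id ((f.extend h).partner x)).1 < m := by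
                intro f x
                have hlt : ∀ z : Fin m ⊕ Fin m, (Sum.elim id id
                    (Sum.map (Fin.castLE h) (Fin.castLE h) z)).1 < m := by
                  rintro (z | z) <;> exact z.2
                rcases x with i | i
                all_goals by_cases hi : i.1 < m
                · have := extend_castLE h f (Sum.inl ⟨i, hi⟩)
                  change (f.extend h).partner (Sum.inl i) = _ at this
                  rw [this]
                  exact ⟨fun _ => hlt _, fun _ => hi⟩
                · rw [extend_inl h f i hi]; rfl
                · have := extend_castLE h f (Sum.inr ⟨i, hi⟩)
                  change (f.extend h).partner (Sum.inr i) = _ at this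
                  rw [this]
                  exact ⟨fun _ => hlt _, fun _ => hi⟩
                · rw [extend_inr h f i hi]; rfl
              have hl : ∀ x : Fin n ⊕ Fin n, label (Sum.map id Sum.inl x) = Sum.elim id id x := by
                rintro (i | i) <;> rfl
              rintro v w (⟨x, rfl, rfl⟩ | ⟨y, rfl, rfl⟩)
              · rw [hl, hl, hcase d x]
              · exact congrArg Not (propext (hcase e y)))
          have h1 : L (component _ _ (Sum.inl i)) = L (castComponent h d e (Quot.mk _ v)) :=
            congrArg L hic
          have h2 : ¬ (label (castNode h v)).1 < m := cast h1 hi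
          exact h2 (by rcases v with a | a | a <;> exact a.2)
      rintro (i | i)
      all_goals by_cases hi : i.1 < m
      · exact key (Sum.inl ⟨i, hi⟩)
      · exact key2 i hi
      · exact key (Sum.inr ⟨i, hi⟩)
      · intro hic
        exact key2 i hi ((component_label h d e (Sum.inr (Sum.inr i)) hi).symm.trans hic)⟩
  have hG : Function.Bijective G := by
    constructor
    · intro a b hab
      exact Subtype.ext (castComponent_injective h d e (congrArg Subtype.val hab))
    · rintro ⟨c, hc⟩
      induction c using Quot.ind with
      | mk v =>
        by_cases hv : (label v).1 < m
        · obtain ⟨w, rfl⟩ := hcn v hv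
          refine ⟨⟨component d e w, fun x hx => ?_⟩, rfl⟩
          have := congrArg (castComponent h d e) hx
          refine hc (Sum.map (Fin.castLE h) (Fin.castLE h) x) ?_
          rw [← ho]
          exact this
        · exact absurd (component_label h d e v hv).symm (hc (Sum.inl (label v)))
  exact (Nat.card_congr (Equiv.ofBijective G hG)).symm

end Extend

end Diagram

noncomputable section Algebras

universe u

/-- The Brauer algebra: the free `R`-module on the diagrams on `n` nodes. -/
def BrauerAlgebra (R : Type u) [CommRing R] (_δ : R) (n : ℕ) : Type u :=
  Diagram (Fin n) (Fin n) →₀ R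

namespace BrauerAlgebra

variable {R : Type u} [CommRing R] {δ : R} {n : ℕ}

instance : AddCommGroup (BrauerAlgebra R δ n) :=
  inferInstanceAs (AddCommGroup (Diagram (Fin n) (Fin n) →₀ R))

instance : Module R (BrauerAlgebra R δ n) :=
  inferInstanceAs (Module R (Diagram (Fin n) (Fin n) →₀ R))

/-- The basis of diagrams. -/
def basis (R : Type u) [CommRing R] (δ : R) (n : ℕ) :
    Module.Basis (Diagram (Fin n) (Fin n)) R (BrauerAlgebra R δ n) where
  repr := LinearEquiv.refl R (Diagram (Fin n) (Fin n) →₀ R)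

theorem induction_basis {P : BrauerAlgebra R δ n → Prop} (x : BrauerAlgebra R δ n) (zero : P 0)
    (add : ∀ x y, P x → P y → P (x + y)) (smul : ∀ (r : R) d, P (r • basis R δ n d)) : P x := by
  rw [← (basis R δ n).linearCombination_repr x, Finsupp.linearCombination_apply, Finsupp.sum]
  exact Finset.sum_induction _ P add zero fun d _ => smul _ d

/-- The bilinear multiplication: the product of two diagrams is the pasted diagram, where every
closed loop is replaced by a factor `δ`. -/
def mulLin (R : Type u) [CommRing R] (δ : R) (n : ℕ) :
    BrauerAlgebra R δ n →ₗ[R] BrauerAlgebra R δ n →ₗ[R] BrauerAlgebra R δ n :=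
  (basis R δ n).constr R fun d => (basis R δ n).constr R fun e =>
    δ ^ Diagram.loops d e • basis R δ n (d.comp e)

instance : Mul (BrauerAlgebra R δ n) := ⟨fun x y => mulLin R δ n x y⟩

instance : One (BrauerAlgebra R δ n) := ⟨basis R δ n (Diagram.ofPerm 1)⟩

theorem mul_def (x y : BrauerAlgebra R δ n) : x * y = mulLin R δ n x y := rfl

theorem one_def : (1 : BrauerAlgebra R δ n) = basis R δ n (Diagram.ofPerm 1) := rfl

theorem basis_mul_basis (d e : Diagram (Fin n) (Fin n)) :
    basis R δ n d * basis R δ n e = δ ^ Diagram.loops d e • basis R δ n (d.comp e) := by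
  rw [mul_def, mulLin, Module.Basis.constr_basis, Module.Basis.constr_basis]

theorem mulLin_assoc (x y z : BrauerAlgebra R δ n) :
    mulLin R δ n (mulLin R δ n x y) z = mulLin R δ n x (mulLin R δ n y z) := by
  have hb : ∀ d e, mulLin R δ n (basis R δ n d) (basis R δ n e) =
      δ ^ Diagram.loops d e • basis R δ n (d.comp e) := basis_mul_basis
  induction x using induction_basis with
  | zero => simp
  | add x x' hx hx' => simp only [map_add, LinearMap.add_apply, hx, hx']
  | smul r d =>
    simp only [map_smul, LinearMap.smul_apply]
    congr 1
    induction y using induction_basis with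
    | zero => simp
    | add y y' hy hy' => simp only [map_add, LinearMap.add_apply, hy, hy']
    | smul r e =>
      simp only [map_smul, LinearMap.smul_apply]
      congr 1
      induction z using induction_basis with
      | zero => simp
      | add z z' hz hz' => simp only [map_add, hz, hz']
      | smul r f =>
        simp only [map_smul]
        congr 1
        rw [hb, hb]
        simp only [map_smul, LinearMap.smul_apply]
        rw [hb, hb, smul_smul, smul_smul, ← pow_add, ← pow_add, Diagram.loops_assoc,
          Diagram.comp_assoc]

instance : Ring (BrauerAlgebra R δ n) where
  __ := (inferInstance : AddCommGroup (BrauerAlgebra R δ n))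
  mul_assoc := mulLin_assoc
  one_mul x := by
    change mulLin R δ n (basis R δ n (Diagram.ofPerm 1)) x = x
    induction x using induction_basis with
    | zero => simp
    | add x y hx hy => simp only [map_add, hx, hy]
    | smul r d =>
      rw [map_smul, ← mul_def, basis_mul_basis, Diagram.loops_ofPerm_left, Diagram.one_comp,
        pow_zero, one_smul]
  mul_one x := by
    change mulLin R δ n x (basis R δ n (Diagram.ofPerm 1)) = x
    induction x using induction_basis with
    | zero => simp
    | add x y hx hy => simp only [map_add, LinearMap.add_apply, hx, hy]
    | smul r d =>
      rw [map_smul, LinearMap.smul_apply, ← mul_def, basis_mul_basis, Diagram.loops_ofPerm_right,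
        Diagram.comp_one, pow_zero, one_smul]
  left_distrib x y z := map_add (mulLin R δ n x) y z
  right_distrib x y z := LinearMap.map_add₂ (mulLin R δ n) x y z
  zero_mul x := LinearMap.map_zero₂ (mulLin R δ n) x
  mul_zero x := map_zero (mulLin R δ n x)

instance : Algebra R (BrauerAlgebra R δ n) := Algebra.ofModule
  (fun r x y => LinearMap.map_smul₂ (mulLin R δ n) r x y)
  (fun r x y => map_smul (mulLin R δ n x) r y)

/-- An algebra homomorphism out of the Brauer algebra, from its values on diagrams. -/
def liftAlgHom {A : Type*} [Ring A] [Algebra R A] (f : Diagram (Fin n) (Fin n) → A)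
    (h1 : f (Diagram.ofPerm 1) = 1)
    (hmul : ∀ d e, δ ^ Diagram.loops d e • f (d.comp e) = f d * f e) :
    BrauerAlgebra R δ n →ₐ[R] A :=
  AlgHom.ofLinearMap ((basis R δ n).constr R f)
    (by rw [one_def, Module.Basis.constr_basis, h1])
    (fun x y => by
      induction x using induction_basis with
      | zero => simp
      | add x x' hx hx' => simp only [add_mul, map_add, hx, hx']
      | smul r d =>
        induction y using induction_basis with
        | zero => simp
        | add y y' hy hy' => simp only [mul_add, map_add, hy, hy']
        | smul s e =>
          simp only [smul_mul_assoc, mul_smul_comm, map_smul, basis_mul_basis,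
            Module.Basis.constr_basis, hmul])

theorem liftAlgHom_basis {A : Type*} [Ring A] [Algebra R A] (f : Diagram (Fin n) (Fin n) → A)
    (h1 : f (Diagram.ofPerm 1) = 1)
    (hmul : ∀ d e, δ ^ Diagram.loops d e • f (d.comp e) = f d * f e) (d) :
    liftAlgHom f h1 hmul (basis R δ n d) = f d :=
  Module.Basis.constr_basis (basis R δ n) R f d

theorem algHom_ext {A : Type*} [Ring A] [Algebra R A] {f g : BrauerAlgebra R δ n →ₐ[R] A}
    (h : ∀ d, f (basis R δ n d) = g (basis R δ n d)) : f = g :=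
  AlgHom.toLinearMap_injective ((basis R δ n).ext h)

end BrauerAlgebra

/-- The group ring of the symmetric group on `n` letters. -/
abbrev SymAlgebra (R : Type u) [CommRing R] (n : ℕ) : Type u :=
  MonoidAlgebra R (Equiv.Perm (Fin n))

section Maps

variable (R : Type u) [CommRing R] (δ : R) (n : ℕ)

open BrauerAlgebra

/-- The inclusion `ι`, sending a permutation to its permutation diagram. -/
def iota : SymAlgebra R n →ₐ[R] BrauerAlgebra R δ n :=
  MonoidAlgebra.lift R (BrauerAlgebra R δ n) (Equiv.Perm (Fin n))
    { toFun := fun σ => basis R δ n (Diagram.ofPerm σ)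
      map_one' := rfl
      map_mul' := fun σ τ => by
        rw [basis_mul_basis, Diagram.loops_ofPerm_left, Diagram.ofPerm_comp, pow_zero, one_smul] }

theorem iota_of (σ : Equiv.Perm (Fin n)) :
    iota R δ n (MonoidAlgebra.of R _ σ) = basis R δ n (Diagram.ofPerm σ) := by
  simp [iota]

open Classical in
/-- The value of the projection on diagrams: a permutation diagram is sent to its permutation, and
all other diagrams are sent to zero. -/
def piDiagram (d : Diagram (Fin n) (Fin n)) : SymAlgebra R n :=
  if h : ∃ σ, d = Diagram.ofPerm σ then MonoidAlgebra.of R _ h.choose else 0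

theorem piDiagram_ofPerm (σ : Equiv.Perm (Fin n)) :
    piDiagram R n (Diagram.ofPerm σ) = MonoidAlgebra.of R _ σ := by
  have h : ∃ τ, Diagram.ofPerm σ = Diagram.ofPerm τ := ⟨σ, rfl⟩
  rw [piDiagram, dif_pos h, ← Diagram.ofPerm_injective h.choose_spec]

theorem piDiagram_of_not (d : Diagram (Fin n) (Fin n)) (h : ¬ ∃ σ, d = Diagram.ofPerm σ) :
    piDiagram R n d = 0 := by
  rw [piDiagram, dif_neg h]

/-- The projection `π`. -/
def proj : BrauerAlgebra R δ n →ₐ[R] SymAlgebra R n :=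
  liftAlgHom (piDiagram R n) (by rw [piDiagram_ofPerm, map_one]) fun d e => by
    by_cases hd : ∃ σ, d = Diagram.ofPerm σ
    · by_cases he : ∃ τ, e = Diagram.ofPerm τ
      · obtain ⟨σ, rfl⟩ := hd
        obtain ⟨τ, rfl⟩ := he
        rw [Diagram.loops_ofPerm_left, Diagram.ofPerm_comp, pow_zero, one_smul]
        simp only [piDiagram_ofPerm, map_mul]
      · rw [piDiagram_of_not R n e he, piDiagram_of_not R n (d.comp e) fun h =>
          he (Diagram.ofPerm_of_comp_right d e h), mul_zero, smul_zero]
    · rw [piDiagram_of_not R n d hd, piDiagram_of_not R n (d.comp e) fun h =>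
          hd (Diagram.ofPerm_of_comp_left d e h), zero_mul, smul_zero]

theorem proj_basis (d : Diagram (Fin n) (Fin n)) :
    proj R δ n (basis R δ n d) = piDiagram R n d :=
  liftAlgHom_basis _ _ _ d

theorem proj_comp_iota : (proj R δ n).comp (iota R δ n) = AlgHom.id R _ := by
  refine MonoidAlgebra.algHom_ext (fun σ => ?_) (AlgHom.ext fun r =>
    (AlgHom.commutes _ r).trans (AlgHom.commutes _ r).symm)
  change proj R δ n (iota R δ n (MonoidAlgebra.of R _ σ)) = MonoidAlgebra.of R _ σ
  rw [iota_of, proj_basis, piDiagram_ofPerm]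

/-- The augmentation of the group ring, sending every permutation to `1`. -/
def symAug : SymAlgebra R n →ₐ[R] R :=
  MonoidAlgebra.lift R R (Equiv.Perm (Fin n)) 1

/-- The augmentation of the Brauer algebra, sending permutation diagrams to `1` and all other
diagrams to `0`. -/
def brAug : BrauerAlgebra R δ n →ₐ[R] R := (symAug R n).comp (proj R δ n)

theorem brAug_comp_iota : (brAug R δ n).comp (iota R δ n) = symAug R n := by
  rw [brAug, AlgHom.comp_assoc, proj_comp_iota, AlgHom.comp_id]

theorem brAug_basis_ofPerm (σ : Equiv.Perm (Fin n)) :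
    brAug R δ n (basis R δ n (Diagram.ofPerm σ)) = 1 := by
  rw [brAug, AlgHom.comp_apply, proj_basis, piDiagram_ofPerm, symAug]
  simp

theorem brAug_basis_of_not (d : Diagram (Fin n) (Fin n)) (h : ¬ ∃ σ, d = Diagram.ofPerm σ) :
    brAug R δ n (basis R δ n d) = 0 := by
  rw [brAug, AlgHom.comp_apply, proj_basis, piDiagram_of_not R n d h, map_zero]

variable {m n} (h : m ≤ n)

/-- The inclusion of group rings, letting permutations of the first `m` letters act on all `n`. -/
def symIncl : SymAlgebra R m →ₐ[R] SymAlgebra R n :=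
  MonoidAlgebra.mapDomainAlgHom R R (Equiv.Perm.viaEmbeddingHom (Fin.castLEEmb h))

/-- The inclusion of Brauer algebras, adding `n - m` horizontal arcs to each diagram. -/
def brIncl : BrauerAlgebra R δ m →ₐ[R] BrauerAlgebra R δ n :=
  liftAlgHom (fun d => basis R δ n (d.extend h))
    (by
      rw [Diagram.extend_ofPerm, ← Equiv.Perm.viaEmbeddingHom_apply, map_one, one_def])
    (fun d e => by rw [basis_mul_basis, Diagram.loops_extend, Diagram.extend_comp])

theorem brIncl_basis (d : Diagram (Fin m) (Fin m)) :
    brIncl R δ h (basis R δ m d) = basis R δ n (d.extend h) :=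
  liftAlgHom_basis _ _ _ d

theorem symIncl_of (σ : Equiv.Perm (Fin m)) : symIncl R h (MonoidAlgebra.of R _ σ) =
    MonoidAlgebra.of R _ (σ.viaEmbedding (Fin.castLEEmb h)) := by
  simp [symIncl, Equiv.Perm.viaEmbeddingHom_apply]

theorem iota_comp_symIncl :
    (iota R δ n).comp (symIncl R h) = (brIncl R δ h).comp (iota R δ m) := by
  refine MonoidAlgebra.algHom_ext (fun σ => ?_) (AlgHom.ext fun r =>
    (AlgHom.commutes _ r).trans (AlgHom.commutes _ r).symm)
  change iota R δ n (symIncl R h (MonoidAlgebra.of R _ σ)) =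
    brIncl R δ h (iota R δ m (MonoidAlgebra.of R _ σ))
  rw [symIncl_of, iota_of, iota_of, brIncl_basis, Diagram.extend_ofPerm]

theorem proj_comp_brIncl :
    (proj R δ n).comp (brIncl R δ h) = (symIncl R h).comp (proj R δ m) := by
  refine algHom_ext fun d => ?_
  rw [AlgHom.comp_apply, AlgHom.comp_apply, brIncl_basis, proj_basis, proj_basis]
  by_cases hd : ∃ σ, d = Diagram.ofPerm σ
  · obtain ⟨σ, rfl⟩ := hd
    rw [Diagram.extend_ofPerm, piDiagram_ofPerm, piDiagram_ofPerm, symIncl_of]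
  · rw [piDiagram_of_not R m d hd, piDiagram_of_not R n _ fun hd' =>
      hd (Diagram.ofPerm_of_extend h d hd'), map_zero]

end Maps

end Algebras

noncomputable section Homology

open CategoryTheory TensorProduct MulOpposite

universe u

section Modules

/-- The trivial bimodule over an algebra with augmentation `ε`: a copy of the ground ring `R` on
which `a` acts, from either side, as multiplication by `ε a`. -/
def Triv {R A : Type u} [CommRing R] [Ring A] [Algebra R A] (_ε : A →ₐ[R] R) : Type u := R

namespace Triv

variable {R A : Type u} [CommRing R] [Ring A] [Algebra R A] (ε : A →ₐ[R] R)

instance : AddCommGroup (Triv ε) := inferInstanceAs (AddCommGroup R)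

instance : Module A (Triv ε) := Module.compHom R ε.toRingHom

instance : Module Aᵐᵒᵖ (Triv ε) :=
  Module.compHom R (ε.toRingHom.fromOpposite fun _ _ => Commute.all _ _)

theorem smul_def (a : A) (r : Triv ε) : a • r = (show R from ε a * (show R from r)) := rfl

theorem op_smul_def (a : A) (r : Triv ε) : op a • r = (show R from ε a * (show R from r)) := rfl

end Triv

/-- The ring `B`, as a left `B`-module and a right `A`-module through `φ : A → B`. -/
def Via {R A B : Type u} [CommRing R] [Ring A] [Ring B] [Algebra R A] [Algebra R B]
    (_φ : A →ₐ[R] B) : Type u := B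

namespace Via

variable {R A B : Type u} [CommRing R] [Ring A] [Ring B] [Algebra R A] [Algebra R B]
  (φ : A →ₐ[R] B)

instance : AddCommGroup (Via φ) := inferInstanceAs (AddCommGroup B)

instance : Module B (Via φ) := inferInstanceAs (Module B B)

instance : Module Aᵐᵒᵖ (Via φ) := Module.compHom B (RingHom.op φ.toRingHom)

theorem smul_def (b : B) (x : Via φ) : b • x = (show B from b * (show B from x)) := rfl

theorem op_smul_def (a : A) (x : Via φ) : op a • x = (show B from (show B from x) * φ a) := rfl

instance : SMulCommClass B Aᵐᵒᵖ (Via φ) where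
  smul_comm b a x := by
    induction a using MulOpposite.rec' with
    | h a => exact (mul_assoc b (show B from x) (φ a)).symm

end Via

section Tensor

/-- The relations `m a ⊗ n = m ⊗ a n`. -/
def balancedRelations (S A M N : Type*) [Ring S] [Ring A] [AddCommGroup M] [AddCommGroup N]
    [Module S M] [Module Aᵐᵒᵖ M] [SMulCommClass S Aᵐᵒᵖ M] [Module A N] :
    Submodule S (M ⊗[ℤ] N) :=
  Submodule.span S {z | ∃ (m : M) (a : A) (n : N), z = (op a • m) ⊗ₜ[ℤ] n - m ⊗ₜ[ℤ] (a • n)}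

/-- The tensor product `M ⊗_A N` of an `(S, A)`-bimodule `M` and a left `A`-module `N`, which is a
left `S`-module. -/
abbrev BalancedTensor (S A M N : Type*) [Ring S] [Ring A] [AddCommGroup M] [AddCommGroup N]
    [Module S M] [Module Aᵐᵒᵖ M] [SMulCommClass S Aᵐᵒᵖ M] [Module A N] :
    Type _ := (M ⊗[ℤ] N) ⧸ balancedRelations S A M N

end Tensor

namespace BalancedTensor

section Map

variable {S S' A A' M M' N N' : Type*} [Ring S] [Ring A] [AddCommGroup M] [AddCommGroup N]
  [Module S M] [Module Aᵐᵒᵖ M] [SMulCommClass S Aᵐᵒᵖ M] [Module A N]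
  [Ring S'] [Ring A'] [AddCommGroup M'] [AddCommGroup N']
  [Module S' M'] [Module A'ᵐᵒᵖ M'] [SMulCommClass S' A'ᵐᵒᵖ M'] [Module A' N']

/-- The pure tensor `m ⊗ n`. -/
def tmul (m : M) (n : N) : BalancedTensor S A M N := Submodule.Quotient.mk (m ⊗ₜ[ℤ] n)

theorem smul_tmul' (s : S) (m : M) (n : N) :
    s • (tmul m n : BalancedTensor S A M N) = tmul (s • m) n := rfl

theorem op_smul_tmul (a : A) (m : M) (n : N) :
    (tmul (op a • m) n : BalancedTensor S A M N) = tmul m (a • n) :=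
  (Submodule.Quotient.eq _).2 (Submodule.subset_span ⟨m, a, n, rfl⟩)

theorem induction_on {P : BalancedTensor S A M N → Prop} (z : BalancedTensor S A M N)
    (zero : P 0) (tmul : ∀ m n, P (tmul m n)) (add : ∀ x y, P x → P y → P (x + y)) : P z := by
  obtain ⟨z, rfl⟩ := Submodule.Quotient.mk_surjective _ z
  induction z using TensorProduct.induction_on with
  | zero => exact zero
  | tmul m n => exact tmul m n
  | add x y hx hy => exact add _ _ hx hy

theorem hom_ext {P : Type*} [AddCommGroup P] [Module S' P] {θ : S →+* S'}
    {f g : BalancedTensor S A M N →ₛₗ[θ] P} (h : ∀ m n, f (tmul m n) = g (tmul m n)) : f = g := by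
  refine LinearMap.ext fun z => ?_
  induction z using BalancedTensor.induction_on with
  | zero => simp only [map_zero]
  | tmul m n => exact h m n
  | add x y hx hy => simp only [map_add, hx, hy]

/-- The map `m ⊗ n ↦ f m ⊗ g n` of tensor products, semilinear along `θ : S → S'`, where `f` and `g`
are compatible with a ring homomorphism `φ : A → A'`. -/
def map (θ : S →+* S') (φ : A →+* A') (f : M →+ M') (g : N →+ N')
    (hθ : ∀ s m, f (s • m) = θ s • f m) (hf : ∀ a m, f (op a • m) = op (φ a) • f m)
    (hg : ∀ a n, g (a • n) = φ a • g n) :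
    BalancedTensor S A M N →ₛₗ[θ] BalancedTensor S' A' M' N' :=
  Submodule.mapQ _ _
    { toFun := TensorProduct.map f.toIntLinearMap g.toIntLinearMap
      map_add' := map_add _
      map_smul' := fun s z => by
        induction z using TensorProduct.induction_on with
        | zero => simp
        | tmul m n => simp [TensorProduct.smul_tmul', hθ]
        | add x y hx hy => simp only [smul_add, map_add, hx, hy] }
    (by
      refine Submodule.span_le.2 ?_
      rintro z ⟨m, a, n, rfl⟩
      refine Submodule.subset_span ⟨f m, φ a, g n, ?_⟩
      simp [hf, hg])

theorem map_tmul (θ : S →+* S') (φ : A →+* A') (f : M →+ M') (g : N →+ N')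
    (hθ : ∀ s m, f (s • m) = θ s • f m) (hf : ∀ a m, f (op a • m) = op (φ a) • f m)
    (hg : ∀ a n, g (a • n) = φ a • g n) (m : M) (n : N) :
    map θ φ f g hθ hf hg (tmul m n) = tmul (f m) (g n) := rfl

end Map

end BalancedTensor

end Modules

section Tor

variable {R A B : Type u} [CommRing R] [Ring A] [Algebra R A] [Ring B] [Algebra R B]

/-- The `R`-module underlying a right module over an `R`-algebra `A`. -/
@[reducible]
def rightModule (M : ModuleCat.{u} Aᵐᵒᵖ) : Module R M := Module.restrictScalars R Aᵐᵒᵖ M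

attribute [local instance] rightModule

instance (M : ModuleCat.{u} Aᵐᵒᵖ) : IsScalarTower R Aᵐᵒᵖ M := IsScalarTower.restrictScalars R Aᵐᵒᵖ M

instance (M : ModuleCat.{u} Aᵐᵒᵖ) : SMulCommClass R Aᵐᵒᵖ M := IsScalarTower.to_smulCommClass

variable (R A) in
/-- The functor `- ⊗_A N` from right `A`-modules to `R`-modules. -/
def tensorFunctor (N : Type u) [AddCommGroup N] [Module A N] :
    ModuleCat.{u} Aᵐᵒᵖ ⥤ ModuleCat.{u} R where
  obj M := ModuleCat.of R (BalancedTensor R A M N)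
  map {M M'} f := ModuleCat.ofHom (BalancedTensor.map (RingHom.id R) (RingHom.id A)
    f.hom.toAddMonoidHom (AddMonoidHom.id N)
    (fun r m => map_smul (f.hom.restrictScalars R) r m)
    (fun a m => map_smul f.hom (op a) m) (fun _ _ => rfl))
  map_id M := by
    exact ModuleCat.hom_ext (BalancedTensor.hom_ext fun m n => rfl)
  map_comp f g := by
    exact ModuleCat.hom_ext (BalancedTensor.hom_ext fun m n => rfl)

instance (N : Type u) [AddCommGroup N] [Module A N] : (tensorFunctor R A N).Additive where
  map_add {M M' f g} := by
    refine ModuleCat.hom_ext (BalancedTensor.hom_ext fun m n => ?_)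
    change Submodule.Quotient.mk ((f.hom m + g.hom m) ⊗ₜ[ℤ] n) = _
    rw [TensorProduct.add_tmul]
    rfl

variable (R A) in
/-- The groups `Tor_i^A(M, N)`, for a right `A`-module `M` and a left `A`-module `N`: the left
derived functors of `- ⊗_A N`. -/
def Tor (i : ℕ) (M : ModuleCat.{u} Aᵐᵒᵖ) (N : Type u) [AddCommGroup N] [Module A N] :
    ModuleCat.{u} R :=
  ((tensorFunctor R A N).leftDerived i).obj M

/-- Restriction of right modules along `φ : A → B`. -/
abbrev restrictRight (φ : A →ₐ[R] B) : ModuleCat.{u} Bᵐᵒᵖ ⥤ ModuleCat.{u} Aᵐᵒᵖ :=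
  ModuleCat.restrictScalars (RingHom.op φ.toRingHom)

/-- A map from a projective resolution to the image of a projective resolution under an exact
functor exists over every given map. -/
theorem exists_lift {C D : Type*} [Category* C] [Category* D] [Abelian C] [Abelian D] (G : D ⥤ C)
    [G.Additive] [G.PreservesEpimorphisms]
    (hG : ∀ S : ShortComplex D, S.Exact → (S.map G).Exact) {Y : C} {Z : D} (f : Y ⟶ G.obj Z)
    (Q : ProjectiveResolution Y) (P : ProjectiveResolution Z) :
    ∃ g : Q.complex ⟶ (G.mapHomologicalComplex _).obj P.complex,
      g.f 0 ≫ G.map (P.π.f 0) = Q.π.f 0 ≫ f := by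
  have hex0 := hG _ P.exact₀
  have hex := fun n => hG _ (P.exact_succ n)
  let K := (G.mapHomologicalComplex (ComplexShape.down ℕ)).obj P.complex
  let p : K.X 0 ⟶ G.obj Z := G.map (P.π.f 0)
  have hp : Epi p := inferInstanceAs (Epi (G.map (P.π.f 0)))
  let q : Q.complex.X 0 ⟶ Y := Q.π.f 0
  have hq : Q.complex.d 1 0 ≫ q = 0 := Q.complex_d_comp_π_f_zero
  let g0 : Q.complex.X 0 ⟶ K.X 0 := Projective.factorThru (q ≫ f) p
  have hg0 : g0 ≫ p = q ≫ f := Projective.factorThru_comp _ _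
  have h1 : (Q.complex.d 1 0 ≫ g0) ≫ p = 0 := by
    rw [Category.assoc, hg0, reassoc_of% hq, Limits.zero_comp]
  let g1 : Q.complex.X 1 ⟶ K.X 1 := hex0.liftFromProjective (Q.complex.d 1 0 ≫ g0) h1
  have hg1 : g1 ≫ K.d 1 0 = Q.complex.d 1 0 ≫ g0 := hex0.liftFromProjective_comp _ h1
  refine ⟨ChainComplex.mkHom Q.complex K g0 g1 hg1 fun n g => ?_, hg0⟩
  have h2 : (Q.complex.d (n + 2) (n + 1) ≫ g.2.1) ≫ K.d (n + 1) n = 0 := by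
    rw [Category.assoc, g.2.2, Q.complex.d_comp_d_assoc, Limits.zero_comp]
  exact ⟨(hex n).liftFromProjective _ h2, (hex n).liftFromProjective_comp _ h2⟩

theorem restrictRight_exact (φ : A →ₐ[R] B) (S : ShortComplex (ModuleCat.{u} Bᵐᵒᵖ))
    (hS : S.Exact) : (S.map (restrictRight φ)).Exact := by
  rw [ShortComplex.moduleCat_exact_iff] at hS ⊢
  exact hS

instance (φ : A →ₐ[R] B) : (restrictRight φ).PreservesEpimorphisms where
  preserves f hf := by
    rw [ModuleCat.epi_iff_surjective] at hf ⊢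
    exact hf

section Map

variable (φ : A →ₐ[R] B)

/-- The natural map `M ⊗_A N → M ⊗_B N'` for right `B`-modules `M`, induced by an additive map
`ν : N → N'` that is semilinear along `φ`. -/
def tensorChange {N N' : Type u} [AddCommGroup N] [Module A N] [AddCommGroup N'] [Module B N']
    (ν : N →ₛₗ[φ.toRingHom] N') :
    restrictRight φ ⋙ tensorFunctor R A N ⟶ tensorFunctor R B N' where
  app M := ModuleCat.ofHom (X := BalancedTensor R A ((restrictRight φ).obj M) N)
    (Y := BalancedTensor R B M N') (BalancedTensor.map (RingHom.id R) φ.toRingHom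
    (AddMonoidHom.id M) ν.toAddMonoidHom
    (fun r m => by
      have h1 : (RingHom.op φ.toRingHom) (algebraMap R Aᵐᵒᵖ r) = algebraMap R Bᵐᵒᵖ r :=
        congrArg op (φ.commutes r)
      exact congrArg (fun b : Bᵐᵒᵖ => b • (show M from m)) h1)
    (fun _ _ => rfl) (fun a n => ν.map_smulₛₗ a n))
  naturality M M' f := by
    exact ModuleCat.hom_ext (BalancedTensor.hom_ext fun m n => rfl)

variable {M : ModuleCat.{u} Aᵐᵒᵖ} {M' : ModuleCat.{u} Bᵐᵒᵖ} (μ : M ⟶ (restrictRight φ).obj M')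

/-- A chain map between projective resolutions of `M` over `A` and of `M'` over `B`, respecting `φ`
and lying over `μ : M → M'`. -/
def resolutionMap : (projectiveResolution M).complex ⟶
    ((restrictRight φ).mapHomologicalComplex _).obj (projectiveResolution M').complex :=
  (exists_lift (restrictRight φ) (restrictRight_exact φ) μ (projectiveResolution M)
    (projectiveResolution M')).choose

theorem resolutionMap_comm : (resolutionMap φ μ).f 0 ≫
    (restrictRight φ).map ((projectiveResolution M').π.f 0) = (projectiveResolution M).π.f 0 ≫ μ :=
  (exists_lift (restrictRight φ) (restrictRight_exact φ) μ (projectiveResolution M)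
    (projectiveResolution M')).choose_spec

/-- The map `Tor_i^A(M, N) → Tor_i^B(M', N')` induced by a homomorphism `φ : A → B` and maps
`μ : M → M'` and `ν : N → N'` that respect `φ`. -/
def Tor.map {N N' : Type u} [AddCommGroup N] [Module A N] [AddCommGroup N'] [Module B N']
    (ν : N →ₛₗ[φ.toRingHom] N') (i : ℕ) : Tor R A i M N ⟶ Tor R B i M' N' :=
  ((projectiveResolution M).isoLeftDerivedObj (tensorFunctor R A N) i).hom ≫
    (HomologicalComplex.homologyFunctor _ _ i).map
      (((tensorFunctor R A N).mapHomologicalComplex _).map (resolutionMap φ μ) ≫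
        (NatTrans.mapHomologicalComplex (tensorChange φ ν) _).app
          (projectiveResolution M').complex) ≫
    ((projectiveResolution M').isoLeftDerivedObj (tensorFunctor R B N') i).inv

end Map

end Tor

section Induced

variable {R A A₀ B B₀ : Type u} [CommRing R] [Ring A] [Ring A₀] [Ring B] [Ring B₀] [Algebra R A]
  [Algebra R A₀] [Algebra R B] [Algebra R B₀]

/-- The induced left `A`-module `A ⊗_{A₀} 𝟙`, for `j : A₀ → A` and the trivial module `𝟙` given by the
augmentation `ε` of `A₀`. -/
abbrev Induced (j : A₀ →ₐ[R] A) (ε : A₀ →ₐ[R] R) : Type u :=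
  BalancedTensor A A₀ (Via j) (Triv ε)

/-- The map `A ⊗_{A₀} 𝟙 → B ⊗_{B₀} 𝟙`, `a ⊗ r ↦ φ a ⊗ r`, induced by compatible homomorphisms
`φ : A → B` and `φ₀ : A₀ → B₀` that respect augmentations. -/
def Induced.map {j : A₀ →ₐ[R] A} {k : B₀ →ₐ[R] B} {ε : A₀ →ₐ[R] R} {η : B₀ →ₐ[R] R}
    (φ : A →ₐ[R] B) (φ₀ : A₀ →ₐ[R] B₀) (hφ : φ.comp j = k.comp φ₀) (hε : η.comp φ₀ = ε) :
    Induced j ε →ₛₗ[φ.toRingHom] Induced k η :=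
  BalancedTensor.map φ.toRingHom φ₀.toRingHom (M := Via j) (M' := Via k) (N := Triv ε)
    (N' := Triv η) φ.toRingHom.toAddMonoidHom (AddMonoidHom.id R)
    (fun s m => map_mul φ s m)
    (fun a m => (map_mul φ (show A from m) (j a)).trans
      (congrArg (φ (show A from m) * ·) (DFunLike.congr_fun hφ a)))
    (fun a r => congrArg (· * (show R from r)) (DFunLike.congr_fun hε a).symm)

/-- The identity map between the trivial right modules, for a homomorphism that respects
augmentations. -/
def trivMap {ε : A →ₐ[R] R} {η : B →ₐ[R] R} (φ : A →ₐ[R] B) (hε : η.comp φ = ε) :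
    ModuleCat.of Aᵐᵒᵖ (Triv ε) ⟶ (restrictRight φ).obj (ModuleCat.of Bᵐᵒᵖ (Triv η)) :=
  ModuleCat.ofHom (Y := (restrictRight φ).obj (ModuleCat.of Bᵐᵒᵖ (Triv η)))
    { toFun := fun r => r
      map_add' := fun _ _ => rfl
      map_smul' := fun a r =>
        congrArg (· * (show R from r)) (DFunLike.congr_fun hε a.unop).symm }

end Induced

section Main

variable (R : Type u) [CommRing R] (δ : R) {m n : ℕ} (h : m ≤ n) (i : ℕ)

/-- The group `Tor_i^{R S_n}(𝟙, R S_n ⊗_{R S_m} 𝟙)`. -/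
abbrev symTor : ModuleCat.{u} R :=
  Tor R (SymAlgebra R n) i (ModuleCat.of _ (Triv (symAug R n))) (Induced (symIncl R h) (symAug R m))

/-- The group `Tor_i^{Br_n}(𝟙, Br_n ⊗_{Br_m} 𝟙)`. -/
abbrev brTor : ModuleCat.{u} R :=
  Tor R (BrauerAlgebra R δ n) i (ModuleCat.of _ (Triv (brAug R δ n)))
    (Induced (brIncl R δ h) (brAug R δ m))

/-- The map of `Tor`-groups induced by the inclusions `ι`. -/
def iotaStar : symTor R h i ⟶ brTor R δ h i :=
  Tor.map (iota R δ n) (trivMap (iota R δ n) (brAug_comp_iota R δ n))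
    (Induced.map (iota R δ n) (iota R δ m) (iota_comp_symIncl R δ h) (brAug_comp_iota R δ m)) i

/-- The map of `Tor`-groups induced by the projections `π`. -/
def projStar : brTor R δ h i ⟶ symTor R h i :=
  Tor.map (proj R δ n) (trivMap (proj R δ n) rfl)
    (Induced.map (proj R δ n) (proj R δ m) (proj_comp_brIncl R δ h) rfl) i

end Main

end Homology

end Brauer

/-! Write `A = Br_n`, `A₀ = Br_m`, `S = R S_m`, and let `J` be the span in `A` of the diagrams with
an arc joining two of the first `m` nodes on the right. Pasting on the left keeps right arcs, so `J`
is a left ideal; it is also stable under right multiplication by `S`. Both Tor groups are identified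
with `Tor^S(𝟙, 𝟙)`, compatibly with `ι`.

The module `A ⊗_{A₀} 𝟙` is `(A / J) ⊗_S 𝟙`. Indeed `J` dies in it, because every diagram in `J` can
be written as `a V u` with `u` a non-permutation diagram of `A₀` (`exists_arc_element`,
`mk_eq_zero_of_mem`), and modulo `J` every element of `A₀` agrees with its image under `π` in `S`
(`brIncl_sub_mem`). Hence, for a projective resolution `P` of the right module `𝟙` over `A`, the
complex `P ⊗_A (A ⊗_{A₀} 𝟙)` is `(P / PJ) ⊗_S 𝟙` (`quotTensorMap_bijective`).

It remains to see that `P / PJ` is a projective resolution of `𝟙` over `S`. Its terms are projective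
since `S_m` acts freely on the diagrams outside `J`, so `A / J` is free over `S`
(`projective_quot_of_free_action`). It resolves `𝟙` because `PJ` is acyclic. To prove that, let `J_M
⊆ J` be spanned by the diagrams containing a given nonempty set `M` of arcs. Either `J_M = 0` or
`J_M` has a right identity `e`; then `P J_M = P e` is a direct summand of `P`, with homology `𝟙 e =
0`. Existence of `e` is where the hypothesis enters: a cup-cap diagram has to be normalised by
`δ⁻¹`, or straightened using a node beyond the first `m` (`exists_idempotent`). As `J` is the sum of
the `J_M` for single arcs, and intersections of the `J_M` are again of this form, Mayer–Vietoris
gives acyclicity of `PJ` (`mulAcyclic_sup`, `mulAcyclic_arcUnion`).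

For `R S_n` over `R S_m` the same holds with `J = 0`, which is Shapiro's lemma. The homomorphism `ι`
induces a chain map between the two resolutions of `𝟙` over `S`, which is a homotopy equivalence, so
`ι_*` is an isomorphism (`isIso_torMap`). Since `π ι = id`, also `π_* ι_* = id`, and `π_*` is the
inverse of `ι_*`. -/

namespace Brauer

/-! ### The subgroups `P J` and the functor `M ↦ M / M J`. -/

noncomputable section QuotientFunctor

open CategoryTheory TensorProduct MulOpposite

universe u

section MulSubgroup

variable {A P P' : Type*} [Ring A] [AddCommGroup P] [Module Aᵐᵒᵖ P] [AddCommGroup P']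
  [Module Aᵐᵒᵖ P']

variable (P) in
/-- The subgroup `P J` of a right `A`-module `P`, generated by the products `p a` with `a ∈ J`. -/
def mulSubgroup (J : AddSubgroup A) : AddSubgroup P :=
  AddSubgroup.closure {x | ∃ (p : P) (a : A), a ∈ J ∧ x = op a • p}

theorem op_smul_mem_mulSubgroup {J : AddSubgroup A} {a : A} (ha : a ∈ J) (p : P) :
    op a • p ∈ mulSubgroup P J :=
  AddSubgroup.subset_closure ⟨p, a, ha, rfl⟩

theorem mulSubgroup_le {J : AddSubgroup A} {H : AddSubgroup P}
    (h : ∀ (p : P), ∀ a ∈ J, op a • p ∈ H) : mulSubgroup P J ≤ H := by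
  rw [mulSubgroup, AddSubgroup.closure_le]
  rintro _ ⟨p, a, ha, rfl⟩
  exact h p a ha

theorem mulSubgroup_mono {J J' : AddSubgroup A} (h : J ≤ J') : mulSubgroup P J ≤ mulSubgroup P J' :=
  mulSubgroup_le fun p _ ha => op_smul_mem_mulSubgroup (h ha) p

theorem mulSubgroup_bot : mulSubgroup P (⊥ : AddSubgroup A) = ⊥ :=
  eq_bot_iff.2 (mulSubgroup_le fun p a ha => by
    rw [AddSubgroup.mem_bot] at ha ⊢
    rw [ha, MulOpposite.op_zero, zero_smul])

theorem mulSubgroup_sup (J J' : AddSubgroup A) :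
    mulSubgroup P (J ⊔ J') = mulSubgroup P J ⊔ mulSubgroup P J' := by
  refine le_antisymm (mulSubgroup_le fun p a ha => ?_)
    (sup_le (mulSubgroup_mono le_sup_left) (mulSubgroup_mono le_sup_right))
  obtain ⟨b, hb, c, hc, rfl⟩ := AddSubgroup.mem_sup.1 ha
  rw [MulOpposite.op_add, add_smul]
  exact add_mem (AddSubgroup.mem_sup_left (op_smul_mem_mulSubgroup hb p))
    (AddSubgroup.mem_sup_right (op_smul_mem_mulSubgroup hc p))

theorem map_mem_mulSubgroup {J : AddSubgroup A} (f : P →ₗ[Aᵐᵒᵖ] P') {x : P}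
    (hx : x ∈ mulSubgroup P J) : f x ∈ mulSubgroup P' J := by
  have h : mulSubgroup P J ≤ (mulSubgroup P' J).comap f.toAddMonoidHom :=
    mulSubgroup_le fun p a ha => by
      simpa using op_smul_mem_mulSubgroup ha (f p)
  exact h hx

variable (P) in
/-- The coordinate functions of a projective right module. -/
theorem exists_coordinates [Module.Projective Aᵐᵒᵖ P] :
    ∃ s : P →ₗ[Aᵐᵒᵖ] P →₀ Aᵐᵒᵖ, ∃ f : P → P →ₗ[Aᵐᵒᵖ] A, (∀ p x, f p x = unop (s x p)) ∧
      ∀ x, (s x).sum (fun p a => a • p) = x := by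
  obtain ⟨s, hs⟩ := Module.Projective.out (R := Aᵐᵒᵖ) (P := P)
  exact ⟨s, fun p =>
    { toFun := fun x => unop (s x p)
      map_add' := fun x y => by simp
      map_smul' := fun a x => by simp }, fun p x => rfl, hs⟩

/-- A linear form sends `p a` to `f(p) a`, which lies in the left ideal `J`. Conversely, `x` is
recovered from its coordinates in a dual basis, and each summand lies in `P J` once the coordinates
lie in `J`. -/
theorem mem_mulSubgroup_iff [Module.Projective Aᵐᵒᵖ P] {J : AddSubgroup A}
    (hJ : ∀ b, ∀ a ∈ J, b * a ∈ J) {x : P} :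
    x ∈ mulSubgroup P J ↔ ∀ f : P →ₗ[Aᵐᵒᵖ] A, f x ∈ J := by
  constructor
  · intro hx f
    have h : mulSubgroup P J ≤ J.comap f.toAddMonoidHom := mulSubgroup_le fun p a ha => by
      simpa using hJ (f p) a ha
    exact h hx
  · intro h
    obtain ⟨s, f, hf, hs⟩ := exists_coordinates (A := A) P
    rw [← hs x]
    refine AddSubgroup.sum_mem _ fun p _ => ?_
    have h1 : unop (s x p) ∈ J := hf p x ▸ h (f p)
    exact op_smul_mem_mulSubgroup h1 p

/-- Membership can be tested by linear forms, and such tests commute with intersections.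
Projectivity is what makes the Mayer–Vietoris argument for sums of left ideals possible. -/
theorem mulSubgroup_inf [Module.Projective Aᵐᵒᵖ P] {J J' : AddSubgroup A}
    (hJ : ∀ b, ∀ a ∈ J, b * a ∈ J) (hJ' : ∀ b, ∀ a ∈ J', b * a ∈ J') :
    mulSubgroup P (J ⊓ J') = mulSubgroup P J ⊓ mulSubgroup P J' := by
  ext x
  rw [AddSubgroup.mem_inf, mem_mulSubgroup_iff hJ, mem_mulSubgroup_iff hJ',
    mem_mulSubgroup_iff (J := J ⊓ J') fun b a ha => ⟨hJ b a ha.1, hJ' b a ha.2⟩, ← forall_and]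
  rfl

end MulSubgroup

variable {R A S : Type u} [CommRing R] [Ring A] [Algebra R A] [Ring S] [Algebra R S]

/-- The submodule `M J` of a right `A`-module, over an algebra `S` whose image in `A` preserves
`J`. -/
def mulSubmodule (j : S →ₐ[R] A) {J : AddSubgroup A} (hJ : ∀ s, ∀ a ∈ J, a * j s ∈ J)
    (M : ModuleCat.{u} Aᵐᵒᵖ) : Submodule Sᵐᵒᵖ ((restrictRight j).obj M) :=
  { (mulSubgroup M J : AddSubgroup M) with
    smul_mem' := fun s x hx => by
      have h : mulSubgroup M J ≤
          (mulSubgroup M J).comap (DistribSMul.toAddMonoidHom M (op (j s.unop))) :=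
        mulSubgroup_le fun p a ha => by
          change op (j s.unop) • op a • p ∈ mulSubgroup M J
          rw [smul_smul, ← op_mul]
          exact op_smul_mem_mulSubgroup (hJ _ _ ha) p
      exact h hx }

/-- The functor `M ↦ M / M J` from right `A`-modules to right `S`-modules. -/
def quotFunctor (j : S →ₐ[R] A) {J : AddSubgroup A} (hJ : ∀ s, ∀ a ∈ J, a * j s ∈ J) :
    ModuleCat.{u} Aᵐᵒᵖ ⥤ ModuleCat.{u} Sᵐᵒᵖ where
  obj M := ModuleCat.of Sᵐᵒᵖ ((restrictRight j).obj M ⧸ mulSubmodule j hJ M)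
  map {M N} f := ModuleCat.ofHom (Submodule.mapQ (mulSubmodule j hJ M) (mulSubmodule j hJ N)
    ((restrictRight j).map f).hom fun _ hx => map_mem_mulSubgroup f.hom hx)
  map_id M := by
    refine ModuleCat.hom_ext (LinearMap.ext fun x => ?_)
    obtain ⟨x, rfl⟩ := Submodule.Quotient.mk_surjective _ x
    rfl
  map_comp f g := by
    refine ModuleCat.hom_ext (LinearMap.ext fun x => ?_)
    obtain ⟨x, rfl⟩ := Submodule.Quotient.mk_surjective _ x
    rfl

variable (j : S →ₐ[R] A) {J : AddSubgroup A} (hJ : ∀ s, ∀ a ∈ J, a * j s ∈ J)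

/-- The quotient map `M → M / M J`. -/
def quotMk (M : ModuleCat.{u} Aᵐᵒᵖ) : M →+ (quotFunctor j hJ).obj M :=
  (mulSubmodule j hJ M).mkQ.toAddMonoidHom

theorem quotMk_surjective (M : ModuleCat.{u} Aᵐᵒᵖ) : Function.Surjective (quotMk j hJ M) :=
  (mulSubmodule j hJ M).mkQ_surjective

theorem quotMk_eq_zero {M : ModuleCat.{u} Aᵐᵒᵖ} (x : M) :
    quotMk j hJ M x = 0 ↔ x ∈ mulSubgroup M J :=
  Submodule.Quotient.mk_eq_zero (mulSubmodule j hJ M)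

theorem quotMk_smul {M : ModuleCat.{u} Aᵐᵒᵖ} (s : S) (x : M) :
    quotMk j hJ M (op (j s) • x) = op s • quotMk j hJ M x := rfl

theorem quotMk_naturality {M N : ModuleCat.{u} Aᵐᵒᵖ} (f : M ⟶ N) (x : M) :
    ((quotFunctor j hJ).map f).hom (quotMk j hJ M x) = quotMk j hJ N (f.hom x) := rfl

instance : (quotFunctor j hJ).Additive where
  map_add {M N f g} := by
    refine ModuleCat.hom_ext (LinearMap.ext fun x => ?_)
    obtain ⟨x, rfl⟩ := quotMk_surjective j hJ M x
    rfl

variable {j hJ} in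
/-- A map out of `M / M J`. -/
def quotLift {M : ModuleCat.{u} Aᵐᵒᵖ} {N : Type*} [AddCommGroup N] [Module Sᵐᵒᵖ N] (f : M →+ N)
    (hf : ∀ (s : S) x, f (op (j s) • x) = op s • f x) (h0 : ∀ x ∈ mulSubgroup M J, f x = 0) :
    (quotFunctor j hJ).obj M →ₗ[Sᵐᵒᵖ] N :=
  (mulSubmodule j hJ M).liftQ
    { toFun := f
      map_add' := f.map_add
      map_smul' := fun s x => hf s.unop x } h0

theorem projective_finsupp {B Q ι : Type*} [Ring B] [AddCommGroup Q] [Module B Q]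
    [Module.Projective B Q] : Module.Projective B (ι →₀ Q) := by
  classical
  exact Module.Projective.of_equiv (finsuppLequivDFinsupp B).symm

/-- The functor `M ↦ M / M J` preserves projective modules if `A / J` is projective. -/
theorem quotFunctor_projective
    (hproj : Projective ((quotFunctor j hJ).obj (ModuleCat.of Aᵐᵒᵖ A)))
    (M : ModuleCat.{u} Aᵐᵒᵖ) [hM : Projective M] : Projective ((quotFunctor j hJ).obj M) := by
  have hM' : Module.Projective Aᵐᵒᵖ M := (IsProjective.iff_projective M).2 hM
  let Q := (quotFunctor j hJ).obj (ModuleCat.of Aᵐᵒᵖ A)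
  let q : A →+ Q := quotMk j hJ (ModuleCat.of Aᵐᵒᵖ A)
  have hQ : Module.Projective Sᵐᵒᵖ Q := (IsProjective.iff_projective Q).2 hproj
  -- The dual basis exhibits `M` as a retract of a direct sum of copies of `A`. The quotient functor
  -- turns this into a retraction of `⨁ A / A J` onto `M / M J`, with section `i` and projection
  -- `r`.
  obtain ⟨s, f, hf, hs⟩ := exists_coordinates (A := A) M
  let φ (p : M) : Q →ₗ[Sᵐᵒᵖ] (quotFunctor j hJ).obj M :=
    ((quotFunctor j hJ).map (ModuleCat.ofHom (X := A) (Y := M)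
      { toFun := fun a => op a • p
        map_add' := fun a b => by rw [MulOpposite.op_add, add_smul]
        map_smul' := fun a b => by
          change op (b * a.unop) • p = a • op b • p
          rw [smul_smul, op_mul, op_unop] })).hom
  let r : (M →₀ Q) →ₗ[Sᵐᵒᵖ] (quotFunctor j hJ).obj M := Finsupp.lsum ℕ φ
  let q' : Aᵐᵒᵖ →+ Q := q.comp (opAddEquiv (α := A)).symm.toAddMonoidHom
  let i0 : M →+ (M →₀ Q) := (Finsupp.mapRange.addMonoidHom q').comp s.toAddMonoidHom
  have hi0 : ∀ x p, i0 x p = q (f p x) := fun x p => by rw [hf]; rfl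
  let i : (quotFunctor j hJ).obj M →ₗ[Sᵐᵒᵖ] (M →₀ Q) := quotLift i0
    (fun t x => by
      ext p
      rw [Finsupp.smul_apply, hi0, hi0, map_smul]
      rfl)
    (fun x hx => by
      ext p
      rw [hi0]
      exact (quotMk_eq_zero j hJ (M := ModuleCat.of Aᵐᵒᵖ A) _).2 (map_mem_mulSubgroup (f p) hx))
  have := projective_finsupp (B := Sᵐᵒᵖ) (Q := Q) (ι := M)
  refine (IsProjective.iff_projective _).1 (Module.Projective.of_split i r ?_)
  refine LinearMap.ext fun x => ?_
  obtain ⟨x, rfl⟩ := quotMk_surjective j hJ M x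
  change (i0 x).sum (fun p q => φ p q) = _
  refine (Finsupp.sum_mapRange_index (hf := map_zero q') fun p => map_zero (φ p)).trans ?_
  change _ = quotMk j hJ M x
  conv_rhs => rw [← hs x, Finsupp.sum, map_sum]
  rfl

end QuotientFunctor

end Brauer

namespace Brauer

/-! ### Acyclicity of `P J`, and `P / P J` as a resolution over `S`. -/

noncomputable section Resolutions

open CategoryTheory TensorProduct MulOpposite

universe u

/-- A projective resolution from an exact augmented complex of projective objects. -/
def resolutionOfExact {C : Type*} [Category* C] [Abelian C] (K : ChainComplex C ℕ)
    (hK : ∀ n, Projective (K.X n)) {Z : C} (p : K.X 0 ⟶ Z) (w : K.d 1 0 ≫ p = 0) (hp : Epi p)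
    (h0 : (ShortComplex.mk _ _ w).Exact)
    (h : ∀ n, (ShortComplex.mk _ _ (K.d_comp_d (n + 2) (n + 1) n)).Exact) :
    ProjectiveResolution Z where
  complex := K
  projective := hK
  π := (ChainComplex.toSingle₀Equiv K Z).symm ⟨p, w⟩
  quasiIso := ⟨fun n => by
    cases n
    -- In degree `0`, being a quasi-isomorphism means that `K₁ → K₀ → Z → 0` is exact; in positive
    -- degrees the target vanishes and exactness of `K` is what is asked.
    · rw [ChainComplex.quasiIsoAt₀_iff, ShortComplex.quasiIso_iff_of_zeros']
      · refine (ShortComplex.exact_and_epi_g_iff_of_iso ?_).2 ⟨h0, hp⟩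
        exact ShortComplex.isoMk (Iso.refl _) (Iso.refl _) (Iso.refl _)
          ((Category.id_comp _).trans (Category.comp_id _).symm)
          ((Category.id_comp _).trans
            ((ChainComplex.toSingle₀Equiv_symm_apply_f_zero p w).symm.trans
              (Category.comp_id _).symm))
      · exact K.shape 0 0 (by simp)
      all_goals rfl
    · rw [quasiIsoAt_iff_exactAt']
      · exact (HomologicalComplex.exactAt_iff' _ _ _ _ (by simp) (by simp)).2 (h _)
      · apply ChainComplex.exactAt_succ_single_obj⟩

variable {R A S : Type u} [CommRing R] [Ring A] [Algebra R A] [Ring S] [Algebra R S]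

/-- The subcomplex `P J` of a complex `P` of right `A`-modules is exact, also in degree `0`. -/
def MulAcyclic (P : ChainComplex (ModuleCat.{u} Aᵐᵒᵖ) ℕ) (J : AddSubgroup A) : Prop :=
  ∀ i, ∀ x ∈ mulSubgroup (P.X i) J, (∀ k, (P.d i k).hom x = 0) →
    ∃ y ∈ mulSubgroup (P.X (i + 1)) J, (P.d (i + 1) i).hom y = x

theorem mulAcyclic_bot (P : ChainComplex (ModuleCat.{u} Aᵐᵒᵖ) ℕ) : MulAcyclic P ⊥ := by
  intro i x hx _
  rw [mulSubgroup_bot, AddSubgroup.mem_bot] at hx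
  exact ⟨0, zero_mem _, by rw [hx, map_zero]⟩

theorem d_d_apply (P : ChainComplex (ModuleCat.{u} Aᵐᵒᵖ) ℕ) (i j k : ℕ) (x : P.X i) :
    (P.d j k).hom ((P.d i j).hom x) = 0 :=
  congrArg (fun f => f.hom x) (P.d_comp_d i j k)

/-- This is the Mayer–Vietoris argument for `P J` and `P J'`, whose sum is `P (J + J')` and whose
intersection is `P (J ∩ J')` since the terms of `P` are projective. -/
theorem mulAcyclic_sup (P : ChainComplex (ModuleCat.{u} Aᵐᵒᵖ) ℕ) (hP : ∀ i, Projective (P.X i))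
    {J J' : AddSubgroup A} (hJ : ∀ b, ∀ a ∈ J, b * a ∈ J) (hJ' : ∀ b, ∀ a ∈ J', b * a ∈ J')
    (h : MulAcyclic P J) (h' : MulAcyclic P J') (hinf : MulAcyclic P (J ⊓ J')) :
    MulAcyclic P (J ⊔ J') := by
  have hP' : ∀ i, Module.Projective Aᵐᵒᵖ (P.X i) := fun i =>
    (IsProjective.iff_projective (P.X i)).2 (hP i)
  intro i x hx hdx
  rw [mulSubgroup_sup] at hx
  obtain ⟨u, hu, v, hv, rfl⟩ := AddSubgroup.mem_sup.1 hx
  -- As `du = -dv` is a cycle in `P (J ∩ J')`, it bounds some `y` there. Then `u - y` and `v + y`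
  -- are cycles in `P J` and `P J'` with the same sum `u + v`. In degree `0` all outgoing
  -- differentials vanish and `y = 0` serves.
  obtain ⟨y, hy, hyd⟩ : ∃ y ∈ mulSubgroup (P.X i) (J ⊓ J'),
      ∀ k, (P.d i k).hom y = (P.d i k).hom u := by
    cases i with
    | zero =>
      refine ⟨0, zero_mem _, fun k => ?_⟩
      rw [P.shape 0 k (by simp)]
      simp
    | succ i =>
      have h1 : (P.d (i + 1) i).hom u = -(P.d (i + 1) i).hom v := by
        rw [eq_neg_iff_add_eq_zero, ← map_add]
        exact hdx i
      have h2 : (P.d (i + 1) i).hom u ∈ mulSubgroup (P.X i) (J ⊓ J') := by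
        rw [mulSubgroup_inf hJ hJ']
        refine ⟨map_mem_mulSubgroup _ hu, ?_⟩
        rw [h1]
        exact AddSubgroup.neg_mem _ (map_mem_mulSubgroup _ hv)
      obtain ⟨y, hy, hyd⟩ := hinf i _ h2 fun k => d_d_apply P _ _ _ _
      refine ⟨y, hy, fun k => ?_⟩
      by_cases hk : k = i
      · subst hk; exact hyd
      · rw [P.shape (i + 1) k (by simp; omega)]
        simp
  rw [mulSubgroup_inf hJ hJ'] at hy
  obtain ⟨a, ha, hda⟩ := h i (u - y) (sub_mem hu hy.1) fun k => by rw [map_sub, hyd, sub_self]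
  obtain ⟨b, hb, hdb⟩ := h' i (v + y) (add_mem hv hy.2) fun k => by
    rw [map_add, hyd, add_comm, ← map_add]; exact hdx k
  refine ⟨a + b, ?_, ?_⟩
  · rw [mulSubgroup_sup]
    exact add_mem (AddSubgroup.mem_sup_left ha) (AddSubgroup.mem_sup_right hb)
  · rw [map_add, hda, hdb]; abel

section Triv

variable {ε : A →ₐ[R] R} (P : ProjectiveResolution (ModuleCat.of Aᵐᵒᵖ (Triv ε)))

/-- The augmentation of a resolution of the trivial module. -/
def augment : P.complex.X 0 →ₗ[Aᵐᵒᵖ] Triv ε :=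
  (show P.complex.X 0 ⟶ ModuleCat.of Aᵐᵒᵖ (Triv ε) from P.π.f 0).hom

theorem augment_surjective : Function.Surjective (augment P) :=
  (ModuleCat.epi_iff_surjective _).1 (show Epi (P.π.f 0) from inferInstance)

theorem augment_d (x : P.complex.X 1) : augment P ((P.complex.d 1 0).hom x) = 0 :=
  congrArg (fun f => f.hom x) P.complex_d_comp_π_f_zero

theorem exists_boundary_zero (x : P.complex.X 0) (hx : augment P x = 0) :
    ∃ y, (P.complex.d 1 0).hom y = x :=
  (ShortComplex.moduleCat_exact_iff _).1 P.exact₀ x hx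

theorem exists_boundary_succ (i : ℕ) (x : P.complex.X (i + 1))
    (hx : (P.complex.d (i + 1) i).hom x = 0) : ∃ y, (P.complex.d (i + 2) (i + 1)).hom y = x :=
  (ShortComplex.moduleCat_exact_iff _).1 (P.exact_succ i) x hx

/-- Every `x` in `P J` satisfies `x e = x`. If such a cycle is `dy`, it is also `d(y e)`, with `y e`
in `P J`. The only homology of `P` is `𝟙` in degree `0`, where `e` acts as `0`, so each cycle is
indeed a boundary in `P`. -/
theorem mulAcyclic_of_idempotent {J : AddSubgroup A} {e : A} (he : e ∈ J) (hJe : ∀ a ∈ J, a * e = a)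
    (hε : ε e = 0) : MulAcyclic P.complex J := by
  intro i x hx hdx
  have hxe : op e • x = x := by
    have h : mulSubgroup (P.complex.X i) J ≤
        (DistribSMul.toAddMonoidHom (P.complex.X i) (op e)).eqLocus (AddMonoidHom.id _) :=
      mulSubgroup_le fun p a ha => by
        change op e • op a • p = op a • p
        rw [smul_smul, ← op_mul, hJe a ha]
    exact h hx
  obtain ⟨y, hy⟩ : ∃ y, (P.complex.d (i + 1) i).hom y = x := by
    cases i with
    | zero =>
      refine exists_boundary_zero P x ?_
      -- The augmentation of `x = x e` is a multiple of `ε e = 0`.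
      rw [← hxe, map_smul, Triv.op_smul_def, hε]
      exact zero_mul (M₀ := R) _
    | succ i => exact exists_boundary_succ P i x (hdx i)
  exact ⟨op e • y, op_smul_mem_mulSubgroup he y, by rw [map_smul, hy, hxe]⟩

variable {j : S →ₐ[R] A} {J : AddSubgroup A} (hJ : ∀ s, ∀ a ∈ J, a * j s ∈ J)
  {εS : S →ₐ[R] R}

/-- The augmentation of `P / P J`. -/
def quotAugment (hε : ∀ a ∈ J, ε a = 0) (hj : ε.comp j = εS) :
    (quotFunctor j hJ).obj (P.complex.X 0) →ₗ[Sᵐᵒᵖ] Triv εS :=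
  quotLift (N := Triv εS) (augment P).toAddMonoidHom
    (fun s x => by
      refine (map_smul (augment P) _ _).trans ?_
      rw [← hj]
      rfl)
    (fun x hx => by
      have h : mulSubgroup (P.complex.X 0) J ≤ (augment P).toAddMonoidHom.ker :=
        mulSubgroup_le fun p a ha => by
          rw [AddMonoidHom.mem_ker]
          refine (map_smul (augment P) _ _).trans ?_
          rw [Triv.op_smul_def, hε a ha]
          exact zero_mul (M₀ := R) _
      exact h hx)

/-- The complex `P / P J`. -/
abbrev quotComplex (P : ChainComplex (ModuleCat.{u} Aᵐᵒᵖ) ℕ) :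
    ChainComplex (ModuleCat.{u} Sᵐᵒᵖ) ℕ :=
  ((quotFunctor j hJ).mapHomologicalComplex _).obj P

/-- If `P J` is acyclic, then `P / P J` is a resolution of the trivial module over `S`. -/
def quotResolution (hproj : Projective ((quotFunctor j hJ).obj (ModuleCat.of Aᵐᵒᵖ A)))
    (hP : MulAcyclic P.complex J) (hε : ∀ a ∈ J, ε a = 0) (hj : ε.comp j = εS) :
    ProjectiveResolution (ModuleCat.of Sᵐᵒᵖ (Triv εS)) :=
  resolutionOfExact (quotComplex hJ P.complex)
    (fun n => quotFunctor_projective j hJ hproj (P.complex.X n))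
    (ModuleCat.ofHom (quotAugment P hJ hε hj))
    (by
      refine ModuleCat.hom_ext (LinearMap.ext fun x => ?_)
      obtain ⟨x, rfl⟩ := quotMk_surjective j hJ _ x
      exact augment_d P x)
    ((ModuleCat.epi_iff_surjective _).2 fun z => by
      obtain ⟨x, rfl⟩ := augment_surjective P z
      exact ⟨quotMk j hJ _ x, rfl⟩)
    ((ShortComplex.moduleCat_exact_iff _).2 fun x hx => by
      obtain ⟨x, rfl⟩ := quotMk_surjective j hJ _ x
      obtain ⟨y, rfl⟩ := exists_boundary_zero P x hx
      exact ⟨quotMk j hJ _ y, rfl⟩)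
    (fun n => (ShortComplex.moduleCat_exact_iff _).2 fun x hx => by
      obtain ⟨x, rfl⟩ := quotMk_surjective j hJ _ x
      -- A cycle of `P / P J` lifts to `x` with `dx` in `P J`. Acyclicity of `P J` in degree `n`
      -- corrects `x` by `y` in `P J` to a true cycle of `P`, which bounds.
      have hx' : (P.complex.d (n + 1) n).hom x ∈ mulSubgroup (P.complex.X n) J :=
        (quotMk_eq_zero j hJ _).1 hx
      obtain ⟨y, hy, hyx⟩ := hP n _ hx' fun k => d_d_apply _ _ _ _ _
      obtain ⟨z, hz⟩ := exists_boundary_succ P n (x - y) (by rw [map_sub, hyx, sub_self])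
      refine ⟨quotMk j hJ _ z, ?_⟩
      refine (quotMk_naturality j hJ (P.complex.d (n + 2) (n + 1)) z).trans ?_
      rw [hz, map_sub, (quotMk_eq_zero j hJ y).2 hy, sub_zero])

end Triv

end Resolutions

end Brauer

namespace Brauer

/-! ### The isomorphism `(M / M J) ⊗_S 𝟙 ≅ M ⊗_A (A ⊗_{A₀} 𝟙)`. -/

noncomputable section Comparison

open CategoryTheory TensorProduct MulOpposite

universe u

namespace BalancedTensor

variable {S A M N P : Type*} [Ring S] [Ring A] [AddCommGroup M] [AddCommGroup N] [AddCommGroup P]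
  [Module S M] [Module Aᵐᵒᵖ M] [SMulCommClass S Aᵐᵒᵖ M] [Module A N]

theorem tmul_add (m : M) (n n' : N) :
    (tmul m (n + n') : BalancedTensor S A M N) = tmul m n + tmul m n' := by
  rw [tmul, TensorProduct.tmul_add]
  rfl

theorem add_tmul (m m' : M) (n : N) :
    (tmul (m + m') n : BalancedTensor S A M N) = tmul m n + tmul m' n := by
  rw [tmul, TensorProduct.add_tmul]
  rfl

theorem tmul_zero (m : M) : (tmul m 0 : BalancedTensor S A M N) = 0 := by
  rw [tmul, TensorProduct.tmul_zero]
  rfl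

/-- The additive map out of a balanced tensor product given by a balanced biadditive map. -/
def lift (f : M →+ N →+ P) (hf : ∀ (a : A) m n, f (op a • m) n = f m (a • n)) :
    BalancedTensor S A M N →+ P :=
  QuotientAddGroup.lift (balancedRelations S A M N).toAddSubgroup
    (TensorProduct.liftAddHom f fun r m n => by simp) (by
      intro z hz
      -- The relations form an `S`-span, while the map is only additive, so the induction has to
      -- carry all multiples `s • z` along; `s = 1` is used at the end.
      have h : ∀ s : S, (TensorProduct.liftAddHom f fun r m n => by simp : M ⊗[ℤ] N →+ P)
          (s • z) = 0 := by
        refine Submodule.span_induction ?_ ?_ ?_ ?_ (show z ∈ balancedRelations S A M N from hz)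
        · rintro _ ⟨m, a, n, rfl⟩ s
          rw [smul_sub, TensorProduct.smul_tmul', TensorProduct.smul_tmul', smul_comm, map_sub,
            TensorProduct.liftAddHom_tmul, TensorProduct.liftAddHom_tmul, hf, sub_self]
        · intro s
          rw [smul_zero, map_zero]
        · intro x y _ _ hx hy s
          rw [smul_add, map_add, hx, hy, add_zero]
        · intro t x _ hx s
          rw [smul_smul, hx]
      simpa using h 1)

variable (S A) in
/-- The pure tensors as a biadditive map. -/
def mkHom (M N : Type*) [AddCommGroup M] [AddCommGroup N] [Module S M] [Module Aᵐᵒᵖ M]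
    [SMulCommClass S Aᵐᵒᵖ M] [Module A N] : M →+ N →+ BalancedTensor S A M N :=
  AddMonoidHom.mk' (fun m => AddMonoidHom.mk' (fun n => tmul m n) (tmul_add m))
    fun m m' => AddMonoidHom.ext fun n => add_tmul m m' n

end BalancedTensor

attribute [local instance] rightModule

section Induced

variable {R A A₀ : Type u} [CommRing R] [Ring A] [Algebra R A] [Ring A₀] [Algebra R A₀]
  (k : A₀ →ₐ[R] A) (η : A₀ →ₐ[R] R)

/-- The element `a ⊗ r` of `A ⊗_{A₀} 𝟙`. -/
def Induced.mk (a : A) (r : R) : Induced k η :=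
  BalancedTensor.tmul (M := Via k) (N := Triv η) a r

theorem Induced.mk_add (a : A) (r r' : R) :
    Induced.mk k η a (r + r') = Induced.mk k η a r + Induced.mk k η a r' :=
  BalancedTensor.tmul_add (M := Via k) (N := Triv η) a r r'

theorem Induced.add_mk (a a' : A) (r : R) :
    Induced.mk k η (a + a') r = Induced.mk k η a r + Induced.mk k η a' r :=
  BalancedTensor.add_tmul (M := Via k) (N := Triv η) a a' r

theorem Induced.smul_mk (b a : A) (r : R) : b • Induced.mk k η a r = Induced.mk k η (b * a) r := rfl

theorem Induced.mk_mul (a : A) (u : A₀) (r : R) :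
    Induced.mk k η (a * k u) r = Induced.mk k η a (η u * r) :=
  BalancedTensor.op_smul_tmul (S := A) (M := Via k) (N := Triv η) u a r

variable {k η} in
theorem Induced.induction_on {P : Induced k η → Prop} (z : Induced k η) (zero : P 0)
    (mk : ∀ a r, P (Induced.mk k η a r)) (add : ∀ x y, P x → P y → P (x + y)) : P z :=
  BalancedTensor.induction_on z zero mk add

/-- The additive map out of `A ⊗_{A₀} 𝟙` given by a balanced biadditive map. -/
def Induced.lift {P : Type*} [AddCommGroup P] (f : A →+ R →+ P)
    (hf : ∀ a u r, f (a * k u) r = f a (η u * r)) : Induced k η →+ P :=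
  BalancedTensor.lift (show Via k →+ Triv η →+ P from f) fun u a r => hf a u r

end Induced

section QuotTensor

variable {R A A₀ S : Type u} [CommRing R] [Ring A] [Algebra R A] [Ring A₀] [Algebra R A₀] [Ring S]
  [Algebra R S] {j : S →ₐ[R] A} {J : AddSubgroup A} (hJ : ∀ s, ∀ a ∈ J, a * j s ∈ J)

variable {hJ} in
/-- An additive map out of `M / M J`. -/
def quotLiftAdd {M : ModuleCat.{u} Aᵐᵒᵖ} {N : Type*} [AddCommGroup N] (f : M →+ N)
    (h0 : ∀ x ∈ mulSubgroup M J, f x = 0) : (quotFunctor j hJ).obj M →+ N :=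
  QuotientAddGroup.lift (mulSubmodule j hJ M).toAddSubgroup f h0

variable {k : A₀ →ₐ[R] A} {η : A₀ →ₐ[R] R} {i : S →ₐ[R] A₀} {εS : S →ₐ[R] R}

section

variable (εS) (M : ModuleCat.{u} Aᵐᵒᵖ)

/-- The element `[m] ⊗ r` of `(M / M J) ⊗_S 𝟙`. -/
def quotTmul (m : M) (r : R) : BalancedTensor R S ((quotFunctor j hJ).obj M) (Triv εS) :=
  BalancedTensor.tmul (N := Triv εS) (quotMk j hJ M m) r

theorem quotTmul_add (m : M) (r r' : R) :
    quotTmul hJ εS M m (r + r') = quotTmul hJ εS M m r + quotTmul hJ εS M m r' :=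
  BalancedTensor.tmul_add (N := Triv εS) _ r r'

theorem add_quotTmul (m m' : M) (r : R) :
    quotTmul hJ εS M (m + m') r = quotTmul hJ εS M m r + quotTmul hJ εS M m' r := by
  rw [quotTmul, map_add]
  exact BalancedTensor.add_tmul (N := Triv εS) _ _ r

theorem quotTmul_smul (s : S) (m : M) (r : R) :
    quotTmul hJ εS M (op (j s) • m) r = quotTmul hJ εS M m (εS s * r) :=
  BalancedTensor.op_smul_tmul (S := R) (N := Triv εS) s (quotMk j hJ M m) r

theorem quotTmul_congr {m m' : M} (h : m - m' ∈ mulSubgroup M J) (r : R) :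
    quotTmul hJ εS M m r = quotTmul hJ εS M m' r := by
  rw [← quotMk_eq_zero j hJ, map_sub, sub_eq_zero] at h
  rw [quotTmul, h]
  rfl

theorem smul_quotTmul (c : R) (m : M) (r : R) :
    c • quotTmul hJ εS M m r = quotTmul hJ εS M (c • m) r := by
  have h1 : c • quotMk j hJ M m = quotMk j hJ M (c • m) := by
    refine (quotMk_smul j hJ (algebraMap R S c) m).symm.trans (congrArg (quotMk j hJ M) ?_)
    rw [j.commutes]
    rfl
  exact (BalancedTensor.smul_tmul' (N := Triv εS) c (quotMk j hJ M m) r).trans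
    (congrArg (fun z => BalancedTensor.tmul (N := Triv εS) z r) h1)

variable {εS M hJ} in
theorem quotTmul_induction_on
    {P : BalancedTensor R S ((quotFunctor j hJ).obj M) (Triv εS) → Prop}
    (z : BalancedTensor R S ((quotFunctor j hJ).obj M) (Triv εS)) (zero : P 0)
    (tmul : ∀ m r, P (quotTmul hJ εS M m r)) (add : ∀ x y, P x → P y → P (x + y)) : P z := by
  refine BalancedTensor.induction_on z zero (fun m r => ?_) add
  obtain ⟨m, rfl⟩ := quotMk_surjective j hJ M m
  exact tmul m r

end

variable (k η) in
/-- The element `m ⊗ (a ⊗ r)` of `M ⊗_A (A ⊗_{A₀} 𝟙)`. -/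
def indTmul (M : ModuleCat.{u} Aᵐᵒᵖ) (m : M) (a : A) (r : R) :
    BalancedTensor R A M (Induced k η) := BalancedTensor.tmul m (Induced.mk k η a r)

theorem indTmul_eq (M : ModuleCat.{u} Aᵐᵒᵖ) (m : M) (a : A) (r : R) :
    indTmul k η M m a r = indTmul k η M (op a • m) 1 r := by
  rw [indTmul, indTmul, BalancedTensor.op_smul_tmul, Induced.smul_mk, mul_one]

theorem indTmul_add (M : ModuleCat.{u} Aᵐᵒᵖ) (m : M) (a : A) (r r' : R) :
    indTmul k η M m a (r + r') = indTmul k η M m a r + indTmul k η M m a r' := by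
  rw [indTmul, Induced.mk_add, BalancedTensor.tmul_add]
  rfl

theorem add_indTmul (M : ModuleCat.{u} Aᵐᵒᵖ) (m m' : M) (a : A) (r : R) :
    indTmul k η M (m + m') a r = indTmul k η M m a r + indTmul k η M m' a r :=
  BalancedTensor.add_tmul _ _ _

theorem indTmul_induction_on {M : ModuleCat.{u} Aᵐᵒᵖ}
    {P : BalancedTensor R A M (Induced k η) → Prop}
    (z : BalancedTensor R A M (Induced k η)) (zero : P 0)
    (tmul : ∀ m a r, P (indTmul k η M m a r)) (add : ∀ x y, P x → P y → P (x + y)) : P z := by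
  refine BalancedTensor.induction_on z zero (fun m z => ?_) add
  refine Induced.induction_on (P := fun z => P (BalancedTensor.tmul m z)) z ?_ (tmul m) fun x y hx hy => ?_
  · rw [BalancedTensor.tmul_zero]
    exact zero
  · rw [BalancedTensor.tmul_add]
    exact add _ _ hx hy

variable (k η) in
/-- The biadditive map `(m, r) ↦ m ⊗ (1 ⊗ r)`. -/
def tensorUnit (M : ModuleCat.{u} Aᵐᵒᵖ) : M →+ R →+ BalancedTensor R A M (Induced k η) :=
  AddMonoidHom.mk' (fun m => AddMonoidHom.mk' (indTmul k η M m 1) (indTmul_add M m 1))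
    fun m m' => AddMonoidHom.ext fun r => add_indTmul M m m' 1 r

/-- For `a` in `J`, `p a ⊗ (1 ⊗ r) = p ⊗ (a ⊗ r)`, and `a ⊗ r` vanishes already in `A ⊗_{A₀} 𝟙`. -/
theorem tensorUnit_eq_zero (hJ0 : ∀ a ∈ J, ∀ r, Induced.mk k η a r = 0)
    (M : ModuleCat.{u} Aᵐᵒᵖ) (x : M) (hx : x ∈ mulSubgroup M J) : tensorUnit k η M x = 0 := by
  have h : mulSubgroup M J ≤ (tensorUnit k η M).ker := mulSubgroup_le fun p a ha => by
    refine AddMonoidHom.ext fun r => ?_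
    change indTmul k η M (op a • p) 1 r = 0
    rw [← indTmul_eq, indTmul, hJ0 a ha, BalancedTensor.tmul_zero]
  exact h hx

/-- The additive map `(M / M J) ⊗_S 𝟙 → M ⊗_A (A ⊗_{A₀} 𝟙)`, `[m] ⊗ r ↦ m ⊗ (1 ⊗ r)`. -/
def quotTensorAddHom (hj : k.comp i = j) (hη : η.comp i = εS)
    (hJ0 : ∀ a ∈ J, ∀ r, Induced.mk k η a r = 0) (M : ModuleCat.{u} Aᵐᵒᵖ) :
    BalancedTensor R S ((quotFunctor j hJ).obj M) (Triv εS) →+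
      BalancedTensor R A M (Induced k η) :=
  BalancedTensor.lift (N := Triv εS)
    (quotLiftAdd (hJ := hJ) (N := R →+ BalancedTensor R A M (Induced k η)) (tensorUnit k η M)
      (tensorUnit_eq_zero hJ0 M))
    (fun s m (r : R) => by
      obtain ⟨m, rfl⟩ := quotMk_surjective j hJ M m
      change indTmul k η M (op (j s) • m) 1 r = indTmul k η M m 1 (εS s * r)
      rw [← indTmul_eq, indTmul, ← hj, ← hη, ← one_mul ((k.comp i) s)]
      exact congrArg _ (Induced.mk_mul k η 1 (i s) r))

/-- The `R`-linear map `(M / M J) ⊗_S 𝟙 → M ⊗_A (A ⊗_{A₀} 𝟙)`, `[m] ⊗ r ↦ m ⊗ (1 ⊗ r)`. -/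
def quotTensorMap (hj : k.comp i = j) (hη : η.comp i = εS)
    (hJ0 : ∀ a ∈ J, ∀ r, Induced.mk k η a r = 0) (M : ModuleCat.{u} Aᵐᵒᵖ) :
    BalancedTensor R S ((quotFunctor j hJ).obj M) (Triv εS) →ₗ[R]
      BalancedTensor R A M (Induced k η) :=
  { quotTensorAddHom hJ hj hη hJ0 M with
    map_smul' := fun c z => by
      change quotTensorAddHom hJ hj hη hJ0 M (c • z) = c • quotTensorAddHom hJ hj hη hJ0 M z
      induction z using quotTmul_induction_on with
      | zero => rw [smul_zero, map_zero, smul_zero]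
      | tmul m r =>
        rw [smul_quotTmul]
        rfl
      | add x y hx hy => rw [smul_add, map_add, map_add, smul_add, hx, hy] }

theorem quotTensorMap_quotTmul (hj : k.comp i = j) (hη : η.comp i = εS)
    (hJ0 : ∀ a ∈ J, ∀ r, Induced.mk k η a r = 0) (M : ModuleCat.{u} Aᵐᵒᵖ) (m : M) (r : R) :
    quotTensorMap hJ hj hη hJ0 M (quotTmul hJ εS M m r) = indTmul k η M m 1 r := rfl

/-- The biadditive map `(a, r) ↦ [m a] ⊗ r`. -/
def quotTensorInvAux (M : ModuleCat.{u} Aᵐᵒᵖ) (m : M) :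
    A →+ R →+ BalancedTensor R S ((quotFunctor j hJ).obj M) (Triv εS) :=
  AddMonoidHom.mk' (fun a => AddMonoidHom.mk' (quotTmul hJ εS M (op a • m))
      (quotTmul_add hJ εS M (op a • m)))
    fun a a' => AddMonoidHom.ext fun r => by
      change quotTmul hJ εS M (op (a + a') • m) r =
        quotTmul hJ εS M (op a • m) r + quotTmul hJ εS M (op a' • m) r
      rw [MulOpposite.op_add, add_smul, add_quotTmul]

/-- The map `a ⊗ r ↦ [m a] ⊗ r`. -/
def quotTensorInvHom (hk : ∀ u, ∃ s, k u - j s ∈ J ∧ η u = εS s) (M : ModuleCat.{u} Aᵐᵒᵖ) (m : M) :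
    Induced k η →+ BalancedTensor R S ((quotFunctor j hJ).obj M) (Triv εS) :=
  Induced.lift k η (quotTensorInvAux hJ M m) fun a u r => by
    obtain ⟨s, hs, hη⟩ := hk u
    change quotTmul hJ εS M (op (a * k u) • m) r = quotTmul hJ εS M (op a • m) (η u * r)
    rw [hη, ← quotTmul_smul]
    -- Balancedness over `A₀` is reduced to balancedness over `S`: `u` may be replaced by `s`, since
    -- `m a (k u - j s)` lies in `M J`.
    refine quotTmul_congr hJ εS M ?_ r
    rw [op_mul, mul_smul, ← sub_smul, ← MulOpposite.op_sub]
    exact op_smul_mem_mulSubgroup hs _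

theorem quotTensorInvHom_mk (hk : ∀ u, ∃ s, k u - j s ∈ J ∧ η u = εS s) (M : ModuleCat.{u} Aᵐᵒᵖ)
    (m : M) (a : A) (r : R) :
    quotTensorInvHom hJ hk M m (Induced.mk k η a r) = quotTmul hJ εS M (op a • m) r := rfl

theorem quotTensorInvHom_add (hk : ∀ u, ∃ s, k u - j s ∈ J ∧ η u = εS s) (M : ModuleCat.{u} Aᵐᵒᵖ)
    (m m' : M) : quotTensorInvHom hJ hk M (m + m') =
      quotTensorInvHom hJ hk M m + quotTensorInvHom hJ hk M m' := by
  refine AddMonoidHom.ext fun z => ?_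
  rw [AddMonoidHom.add_apply]
  induction z using Induced.induction_on with
  | zero => rw [map_zero, map_zero, map_zero, add_zero]
  | mk a r =>
    rw [quotTensorInvHom_mk, quotTensorInvHom_mk, quotTensorInvHom_mk, smul_add, add_quotTmul]
  | add x y hx hy => rw [map_add, map_add, map_add, hx, hy, add_add_add_comm]

theorem quotTensorInvHom_smul (hk : ∀ u, ∃ s, k u - j s ∈ J ∧ η u = εS s) (M : ModuleCat.{u} Aᵐᵒᵖ)
    (b : A) (m : M) (z : Induced k η) : quotTensorInvHom hJ hk M (op b • m) z =
      quotTensorInvHom hJ hk M m (b • z) := by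
  induction z using Induced.induction_on with
  | zero => rw [smul_zero, map_zero, map_zero]
  | mk a r => rw [Induced.smul_mk, quotTensorInvHom_mk, quotTensorInvHom_mk, op_mul, mul_smul]
  | add x y hx hy => rw [smul_add, map_add, map_add, hx, hy]

/-- The map `M ⊗_A (A ⊗_{A₀} 𝟙) → (M / M J) ⊗_S 𝟙`, `m ⊗ (a ⊗ r) ↦ [m a] ⊗ r`. -/
def quotTensorInv (hk : ∀ u, ∃ s, k u - j s ∈ J ∧ η u = εS s) (M : ModuleCat.{u} Aᵐᵒᵖ) :
    BalancedTensor R A M (Induced k η) →+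
      BalancedTensor R S ((quotFunctor j hJ).obj M) (Triv εS) :=
  BalancedTensor.lift (AddMonoidHom.mk' (quotTensorInvHom hJ hk M) (quotTensorInvHom_add hJ hk M))
    (quotTensorInvHom_smul hJ hk M)

theorem quotTensorInv_indTmul (hk : ∀ u, ∃ s, k u - j s ∈ J ∧ η u = εS s)
    (M : ModuleCat.{u} Aᵐᵒᵖ) (m : M) (a : A) (r : R) :
    quotTensorInv hJ hk M (indTmul k η M m a r) = quotTmul hJ εS M (op a • m) r := rfl

/-- The two maps are inverse on pure tensors because `m ⊗ (a ⊗ r) = m a ⊗ (1 ⊗ r)`. That `J` dies in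
`A ⊗_{A₀} 𝟙` makes one of them well defined; that `A₀` reduces to `S` modulo `J` makes the other so.
-/
theorem quotTensorMap_bijective (hj : k.comp i = j) (hη : η.comp i = εS)
    (hJ0 : ∀ a ∈ J, ∀ r, Induced.mk k η a r = 0)
    (hk : ∀ u, ∃ s, k u - j s ∈ J ∧ η u = εS s) (M : ModuleCat.{u} Aᵐᵒᵖ) :
    Function.Bijective (quotTensorMap hJ hj hη hJ0 M) := by
  refine Function.bijective_iff_has_inverse.2 ⟨quotTensorInv hJ hk M, fun z => ?_, fun z => ?_⟩
  · induction z using quotTmul_induction_on with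
    | zero => rw [map_zero, map_zero]
    | tmul m r =>
      rw [quotTensorMap_quotTmul, quotTensorInv_indTmul, op_one, one_smul]
    | add x y hx hy => rw [map_add, map_add, hx, hy]
  · induction z using indTmul_induction_on with
    | zero => rw [map_zero, map_zero]
    | tmul m a r =>
      rw [quotTensorInv_indTmul, quotTensorMap_quotTmul, ← indTmul_eq]
    | add x y hx hy => rw [map_add, map_add, hx, hy]

/-- The maps `(M / M J) ⊗_S 𝟙 → M ⊗_A (A ⊗_{A₀} 𝟙)` are natural in `M`. -/
def quotTensorNat (hj : k.comp i = j) (hη : η.comp i = εS)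
    (hJ0 : ∀ a ∈ J, ∀ r, Induced.mk k η a r = 0) :
    quotFunctor j hJ ⋙ tensorFunctor R S (Triv εS) ⟶ tensorFunctor R A (Induced k η) where
  app M := ModuleCat.ofHom (quotTensorMap hJ hj hη hJ0 M)
  naturality M N f := by
    refine ModuleCat.hom_ext (BalancedTensor.hom_ext fun m r => ?_)
    obtain ⟨m, rfl⟩ := quotMk_surjective j hJ M m
    rfl

theorem quotTensorNat_isIso (hj : k.comp i = j) (hη : η.comp i = εS)
    (hJ0 : ∀ a ∈ J, ∀ r, Induced.mk k η a r = 0)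
    (hk : ∀ u, ∃ s, k u - j s ∈ J ∧ η u = εS s) (M : ModuleCat.{u} Aᵐᵒᵖ) :
    IsIso ((quotTensorNat hJ hj hη hJ0).app M) :=
  (ConcreteCategory.isIso_iff_bijective _).2 (quotTensorMap_bijective hJ hj hη hJ0 hk M)

end QuotTensor

section Change

variable {R A B S : Type u} [CommRing R] [Ring A] [Algebra R A] [Ring B] [Algebra R B] [Ring S]
  [Algebra R S] {j : S →ₐ[R] A} {J : AddSubgroup A} (hJ : ∀ s, ∀ a ∈ J, a * j s ∈ J)
  {j' : S →ₐ[R] B} {J' : AddSubgroup B} (hJ' : ∀ s, ∀ b ∈ J', b * j' s ∈ J') {φ : A →ₐ[R] B}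

/-- The natural map `M / M J → M / M J'` for right `B`-modules `M` and `φ : A → B` with
`φ J ⊆ J'`. -/
def quotChange (hφ : φ.comp j = j') (hJJ : ∀ a ∈ J, φ a ∈ J') :
    restrictRight φ ⋙ quotFunctor j hJ ⟶ quotFunctor j' hJ' where
  app M := ModuleCat.ofHom (quotLift (hJ := hJ) (M := (restrictRight φ).obj M)
    (quotMk j' hJ' M)
    (fun s x => by
      exact (congrArg (fun t => quotMk j' hJ' M (op t • (show M from x)))
        (DFunLike.congr_fun hφ s)).trans (quotMk_smul j' hJ' (M := M) s x))
    (fun x hx => (quotMk_eq_zero j' hJ' _).2 (by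
      have h : mulSubgroup ((restrictRight φ).obj M) J ≤ mulSubgroup M J' :=
        mulSubgroup_le fun p a ha => op_smul_mem_mulSubgroup (P := M) (hJJ a ha) p
      exact h hx)))
  naturality M N f := by
    refine ModuleCat.hom_ext (LinearMap.ext fun x => ?_)
    obtain ⟨x, rfl⟩ := quotMk_surjective j hJ ((restrictRight φ).obj M) x
    rfl

end Change
end Comparison
end Brauer

namespace Brauer

/-! ### Isomorphisms and retractions on Tor. -/

noncomputable section TorIso

open CategoryTheory TensorProduct MulOpposite

universe u

/-- A chain map between two projective resolutions over the identity is a homotopy equivalence, and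
additive functors preserve these. -/
theorem isIso_homology_map {C D : Type*} [Category* C] [Category* D] [Abelian C] [Abelian D]
    (F : C ⥤ D) [F.Additive] {Z : C} (P Q : ProjectiveResolution Z) (f : P.complex ⟶ Q.complex)
    (hf : f.f 0 ≫ Q.π.f 0 = P.π.f 0) (n : ℕ) :
    IsIso ((HomologicalComplex.homologyFunctor D _ n).map
      ((F.mapHomologicalComplex (ComplexShape.down ℕ)).map f)) := by
  have hfπ : f ≫ Q.π = P.π := by
    refine HomologicalComplex.to_single_hom_ext ?_
    exact hf
  let g := ProjectiveResolution.lift (𝟙 Z) Q P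
  have hg : g ≫ P.π = Q.π := (ProjectiveResolution.lift_commutes (𝟙 Z) Q P).trans (by simp)
  let e : HomotopyEquiv P.complex Q.complex :=
    { hom := f
      inv := g
      homotopyHomInvId := ProjectiveResolution.liftHomotopy (𝟙 Z) _ _
        (by rw [Category.assoc, hg, hfπ]; simp) (by simp)
      homotopyInvHomId := ProjectiveResolution.liftHomotopy (𝟙 Z) _ _
        (by rw [Category.assoc, hfπ, hg]; simp) (by simp) }
  exact ((F.mapHomotopyEquiv e).toHomologyIso n).isIso_hom

theorem isIso_conj {C : Type*} [Category* C] {X X' Y Y' : C} (e : X ≅ Y) (f : Y ⟶ Y')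
    (e' : X' ≅ Y') [IsIso f] : IsIso (e.hom ≫ f ≫ e'.inv) := inferInstance

theorem conj_comp_conj {C : Type*} [Category* C] {X X' Y Y' : C} (e : X ≅ Y) (f : Y ⟶ Y')
    (e' : X' ≅ Y') (g : Y' ⟶ Y) (h : f ≫ g = 𝟙 Y) :
    (e.hom ≫ f ≫ e'.inv) ≫ e'.hom ≫ g ≫ e.inv = 𝟙 X := by
  simp [reassoc_of% h]

attribute [local instance] rightModule

variable {R A A₀ B B₀ S : Type u} [CommRing R] [Ring A] [Ring A₀] [Ring B] [Ring B₀] [Ring S]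
  [Algebra R A] [Algebra R A₀] [Algebra R B] [Algebra R B₀] [Algebra R S]

/-- Conditions on a subgroup `J` of an augmented algebra `A`, under which the groups
`Tor^A(𝟙, A ⊗_{A₀} 𝟙)` are computed by the complex `(P / P J) ⊗_S 𝟙`, for a projective resolution
`P` of `𝟙` over `A`, and `P / P J` is a projective resolution of `𝟙` over `S`. -/
structure IsExcisive (k : A₀ →ₐ[R] A) (η : A₀ →ₐ[R] R) (ε : A →ₐ[R] R) (i : S →ₐ[R] A₀)
    (εS : S →ₐ[R] R) (J : AddSubgroup A) : Prop where
  mul_mem : ∀ s, ∀ a ∈ J, a * (k.comp i) s ∈ J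
  coeff_aug : η.comp i = εS
  aug : ε.comp (k.comp i) = εS
  mk_eq_zero : ∀ a ∈ J, ∀ r, Induced.mk k η a r = 0
  exists_sub_mem : ∀ u, ∃ s, k u - (k.comp i) s ∈ J ∧ η u = εS s
  aug_eq_zero : ∀ a ∈ J, ε a = 0
  projective : Projective ((quotFunctor (k.comp i) mul_mem).obj (ModuleCat.of Aᵐᵒᵖ A))
  acyclic : ∀ P : ProjectiveResolution (ModuleCat.of Aᵐᵒᵖ (Triv ε)), MulAcyclic P.complex J

namespace IsExcisive

variable {k : A₀ →ₐ[R] A} {η : A₀ →ₐ[R] R} {ε : A →ₐ[R] R} {i : S →ₐ[R] A₀} {εS : S →ₐ[R] R}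
  {J : AddSubgroup A} (h : IsExcisive k η ε i εS J)

/-- The resolution `P / P J` over `S`. -/
def resolution (P : ProjectiveResolution (ModuleCat.of Aᵐᵒᵖ (Triv ε))) :
    ProjectiveResolution (ModuleCat.of Sᵐᵒᵖ (Triv εS)) :=
  quotResolution P h.mul_mem h.projective (h.acyclic P) h.aug_eq_zero h.aug

theorem resolution_π (P : ProjectiveResolution (ModuleCat.of Aᵐᵒᵖ (Triv ε))) :
    (h.resolution P).π.f 0 =
      ModuleCat.ofHom (quotAugment P h.mul_mem h.aug_eq_zero h.aug) :=
  ChainComplex.toSingle₀Equiv_symm_apply_f_zero _ _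

/-- The isomorphism of complexes `(P / P J) ⊗_S 𝟙 → P ⊗_A (A ⊗_{A₀} 𝟙)`. -/
def tensorHom (P : ChainComplex (ModuleCat.{u} Aᵐᵒᵖ) ℕ) :
    ((tensorFunctor R S (Triv εS)).mapHomologicalComplex _).obj (quotComplex h.mul_mem P) ⟶
      ((tensorFunctor R A (Induced k η)).mapHomologicalComplex _).obj P :=
  (NatTrans.mapHomologicalComplex (quotTensorNat h.mul_mem rfl h.coeff_aug h.mk_eq_zero) _).app P

theorem tensorHom_isIso (P : ChainComplex (ModuleCat.{u} Aᵐᵒᵖ) ℕ) : IsIso (h.tensorHom P) := by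
  have : ∀ n, IsIso ((h.tensorHom P).f n) := fun n =>
    quotTensorNat_isIso h.mul_mem rfl h.coeff_aug h.mk_eq_zero h.exists_sub_mem (P.X n)
  exact HomologicalComplex.Hom.isIso_of_components _

end IsExcisive

section

variable {k : A₀ →ₐ[R] A} {η : A₀ →ₐ[R] R} {ε : A →ₐ[R] R} {i : S →ₐ[R] A₀} {εS : S →ₐ[R] R}
  {J : AddSubgroup A} (h : IsExcisive k η ε i εS J)
  {k' : B₀ →ₐ[R] B} {η' : B₀ →ₐ[R] R} {ε' : B →ₐ[R] R} {i' : S →ₐ[R] B₀}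
  {J' : AddSubgroup B} (h' : IsExcisive k' η' ε' i' εS J')
  {φ : A →ₐ[R] B} {φ₀ : A₀ →ₐ[R] B₀} (hφ : φ.comp k = k'.comp φ₀) (hη : η'.comp φ₀ = η)
  (hε : ε'.comp φ = ε) (hi : φ₀.comp i = i') (hJ : ∀ a ∈ J, φ a ∈ J')

/-- The map of resolutions over `S` induced by `φ : A → B`. -/
def excisiveMap (hj : φ.comp (k.comp i) = k'.comp i') :
    quotComplex h.mul_mem (projectiveResolution (ModuleCat.of Aᵐᵒᵖ (Triv ε))).complex ⟶
      quotComplex h'.mul_mem (projectiveResolution (ModuleCat.of Bᵐᵒᵖ (Triv ε'))).complex :=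
  ((quotFunctor (k.comp i) h.mul_mem).mapHomologicalComplex _).map
      (resolutionMap φ (trivMap φ hε)) ≫
    (NatTrans.mapHomologicalComplex (quotChange h.mul_mem h'.mul_mem hj hJ) _).app
      (projectiveResolution (ModuleCat.of Bᵐᵒᵖ (Triv ε'))).complex

/-- The chain map lies over the identity of `𝟙`, inherited from the map of resolutions over `A` and
`B`. This is the input for comparing the two resolutions over `S`. -/
theorem excisiveMap_π (hj : φ.comp (k.comp i) = k'.comp i') :
    (excisiveMap h h' hε hJ hj).f 0 ≫ (h'.resolution (projectiveResolution _)).π.f 0 =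
      (h.resolution (projectiveResolution _)).π.f 0 := by
  rw [h.resolution_π, h'.resolution_π]
  refine ModuleCat.hom_ext (LinearMap.ext fun x => ?_)
  obtain ⟨x, rfl⟩ := quotMk_surjective _ _ _ x
  exact congrArg (fun f => f.hom x) (resolutionMap_comm φ (trivMap φ hε))

/-- Naturality of the comparison of complexes in the algebra: both ways, `[m] ⊗ r` goes to the image
of `m` tensored with `1 ⊗ r`, since `φ 1 = 1`. It transports the statement about resolutions over
`S` to the map defining Tor. -/
theorem excisiveMap_tensor (hj : φ.comp (k.comp i) = k'.comp i') :
    ((tensorFunctor R S (Triv εS)).mapHomologicalComplex _).map (excisiveMap h h' hε hJ hj) ≫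
        h'.tensorHom (projectiveResolution _).complex =
      h.tensorHom (projectiveResolution _).complex ≫
      ((tensorFunctor R A (Induced k η)).mapHomologicalComplex _).map
        (resolutionMap φ (trivMap φ hε)) ≫
      (NatTrans.mapHomologicalComplex (tensorChange φ (Induced.map φ φ₀ hφ hη)) _).app
        (projectiveResolution (ModuleCat.of Bᵐᵒᵖ (Triv ε'))).complex := by
  refine HomologicalComplex.hom_ext _ _ fun n => ?_
  refine ModuleCat.hom_ext (BalancedTensor.hom_ext fun m r => ?_)
  obtain ⟨m, rfl⟩ := quotMk_surjective _ _ _ m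
  change indTmul k' η' _ ((resolutionMap φ (trivMap φ hε)).f n m) 1 r =
    indTmul k' η' _ ((resolutionMap φ (trivMap φ hε)).f n m) (φ 1) r
  rw [map_one]

/-- The map on `Tor` is an isomorphism. -/
theorem isIso_torMap (h : IsExcisive k η ε i εS J) (h' : IsExcisive k' η' ε' i' εS J')
    (hi : φ₀.comp i = i') (hJ : ∀ a ∈ J, φ a ∈ J') (n : ℕ) :
    IsIso (Tor.map φ (trivMap φ hε) (Induced.map φ φ₀ hφ hη) n) := by
  have hj : φ.comp (k.comp i) = k'.comp i' := by
    rw [← hi, ← AlgHom.comp_assoc, hφ, AlgHom.comp_assoc]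
  -- Three sides of the commutative square are isomorphisms on homology: the map of resolutions over
  -- `S` tensored with `𝟙`, and the two comparisons of complexes. Hence so is the fourth, which up
  -- to conjugation is the map on Tor.
  have h1 := isIso_homology_map (tensorFunctor R S (Triv εS))
    (h.resolution (projectiveResolution _)) (h'.resolution (projectiveResolution _))
    (excisiveMap h h' hε hJ hj) (excisiveMap_π h h' hε hJ hj) n
  have h2 := congrArg (HomologicalComplex.homologyFunctor (ModuleCat.{u} R) _ n).map
    (excisiveMap_tensor h h' hφ hη hε hJ hj)
  have h3 := h.tensorHom_isIso (projectiveResolution (ModuleCat.of Aᵐᵒᵖ (Triv ε))).complex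
  have h4 := h'.tensorHom_isIso (projectiveResolution (ModuleCat.of Bᵐᵒᵖ (Triv ε'))).complex
  rw [Functor.map_comp, Functor.map_comp] at h2
  have h5 : IsIso ((HomologicalComplex.homologyFunctor (ModuleCat.{u} R) _ n).map
      (((tensorFunctor R A (Induced k η)).mapHomologicalComplex _).map
        (resolutionMap φ (trivMap φ hε)) ≫
      (NatTrans.mapHomologicalComplex (tensorChange φ (Induced.map φ φ₀ hφ hη)) _).app
        (projectiveResolution (ModuleCat.of Bᵐᵒᵖ (Triv ε'))).complex)) := by
    have h6 := @IsIso.comp_isIso _ _ _ _ _ _ _ h1 (Functor.map_isIso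
      (HomologicalComplex.homologyFunctor (ModuleCat.{u} R) (ComplexShape.down ℕ) n)
      (h'.tensorHom (projectiveResolution (ModuleCat.of Bᵐᵒᵖ (Triv ε'))).complex))
    have h7 := h2 ▸ h6
    exact @IsIso.of_isIso_comp_left _ _ _ _ _ _ _ (Functor.map_isIso _ _) h7
  exact isIso_conj ((projectiveResolution (ModuleCat.of Aᵐᵒᵖ (Triv ε))).isoLeftDerivedObj _ n) _
    ((projectiveResolution (ModuleCat.of Bᵐᵒᵖ (Triv ε'))).isoLeftDerivedObj _ n)

end

section Retract

variable {ε : A →ₐ[R] R} {ε' : B →ₐ[R] R} {φ : A →ₐ[R] B} {ψ : B →ₐ[R] A}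
  (hε : ε'.comp φ = ε) (hε' : ε.comp ψ = ε')

/-- The restriction of a module along a homomorphism to `B` and back is the module itself. -/
def restrictRetract (h : ψ.comp φ = AlgHom.id R A) :
    restrictRight ψ ⋙ restrictRight φ ⟶ 𝟭 (ModuleCat.{u} Aᵐᵒᵖ) where
  app M := ModuleCat.ofHom (X := (restrictRight φ).obj ((restrictRight ψ).obj M)) (Y := M)
    { toFun := fun x => x
      map_add' := fun _ _ => rfl
      map_smul' := fun a x => congrArg (fun t => op t • (show M from x))
        (DFunLike.congr_fun h a.unop) }
  naturality _ _ _ := rfl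

/-- The composite of the maps of resolutions induced by `φ : A → B` and a retraction `B → A`. -/
def retractMap (h : ψ.comp φ = AlgHom.id R A) :
    (projectiveResolution (ModuleCat.of Aᵐᵒᵖ (Triv ε))).complex ⟶
    (projectiveResolution (ModuleCat.of Aᵐᵒᵖ (Triv ε))).complex :=
  resolutionMap φ (trivMap φ hε) ≫
    ((restrictRight φ).mapHomologicalComplex _).map (resolutionMap ψ (trivMap ψ hε')) ≫
    (NatTrans.mapHomologicalComplex (restrictRetract h) _).app _

theorem retractMap_π (h : ψ.comp φ = AlgHom.id R A) :
    retractMap hε hε' h ≫ (projectiveResolution _).π =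
    (projectiveResolution (ModuleCat.of Aᵐᵒᵖ (Triv ε))).π := by
  refine HomologicalComplex.to_single_hom_ext ?_
  refine ModuleCat.hom_ext (LinearMap.ext fun x => ?_)
  refine (congrArg (fun f => f.hom ((resolutionMap φ (trivMap φ hε)).f 0 x))
    (resolutionMap_comm ψ (trivMap ψ hε'))).trans ?_
  exact congrArg (fun f => f.hom x) (resolutionMap_comm φ (trivMap φ hε))

/-- Functoriality of Tor for a retraction `A → B → A`: the chain-level composite is induced by a
self-map of the resolution over `A` lying over the identity, which is homotopic to the identity. -/
theorem torMap_comp_torMap (h : ψ.comp φ = AlgHom.id R A) {N N' : Type u} [AddCommGroup N]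
    [Module A N] [AddCommGroup N'] [Module B N'] (ν : N →ₛₗ[φ.toRingHom] N') (ν' : N' →ₛₗ[ψ.toRingHom] N)
    (hν : ∀ x, ν' (ν x) = x) (n : ℕ) :
    Tor.map φ (trivMap φ hε) ν n ≫ Tor.map ψ (trivMap ψ hε') ν' n = 𝟙 _ := by
  have h1 : (((tensorFunctor R A N).mapHomologicalComplex _).map
        (resolutionMap φ (trivMap φ hε)) ≫
      (NatTrans.mapHomologicalComplex (tensorChange φ ν) _).app
        (projectiveResolution (ModuleCat.of Bᵐᵒᵖ (Triv ε'))).complex) ≫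
      (((tensorFunctor R B N').mapHomologicalComplex _).map
        (resolutionMap ψ (trivMap ψ hε')) ≫
      (NatTrans.mapHomologicalComplex (tensorChange ψ ν') _).app
        (projectiveResolution (ModuleCat.of Aᵐᵒᵖ (Triv ε))).complex) =
      ((tensorFunctor R A N).mapHomologicalComplex _).map (retractMap hε hε' h) := by
    refine HomologicalComplex.hom_ext _ _ fun n => ?_
    refine ModuleCat.hom_ext (BalancedTensor.hom_ext fun m x => ?_)
    refine Eq.trans ?_ (congrArg (fun y => BalancedTensor.tmul _ y) (hν x))
    rfl
  let e : Homotopy (retractMap hε hε' h) (𝟙 _) := ProjectiveResolution.liftHomotopy (𝟙 _) _ _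
    ((retractMap_π hε hε' h).trans (by simp)) (by simp)
  have h2 := ((tensorFunctor R A N).mapHomotopy e).homologyMap_eq n
  refine conj_comp_conj ((projectiveResolution (ModuleCat.of Aᵐᵒᵖ (Triv ε))).isoLeftDerivedObj _ n)
    _ ((projectiveResolution (ModuleCat.of Bᵐᵒᵖ (Triv ε'))).isoLeftDerivedObj _ n) _ ?_
  rw [← Functor.map_comp, h1]
  exact h2.trans (by rw [CategoryTheory.Functor.map_id, HomologicalComplex.homologyMap_id]; rfl)

end Retract

end TorIso
end Brauer

namespace Brauer

/-! ### Projectivity from a free action on a basis. -/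

noncomputable section PermutationModules

open CategoryTheory TensorProduct MulOpposite

universe u

theorem projective_op_self (S : Type*) [Ring S] : Module.Projective Sᵐᵒᵖ S :=
  Module.Projective.of_equiv
    { opAddEquiv.symm with
      map_smul' := fun _ _ => rfl : Sᵐᵒᵖ ≃ₗ[Sᵐᵒᵖ] S }

/-- Representatives of the orbits of a right action of a group. -/
theorem exists_orbit_representatives {G X : Type*} [Group G] (act : X → G → X)
    (act_one : ∀ x, act x 1 = x) (act_mul : ∀ x g h, act x (g * h) = act (act x g) h) :
    ∃ (rep : X → X) (γ : X → G), (∀ x, act (rep x) (γ x) = x) ∧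
      ∀ x g, rep (act x g) = rep x := by
  let s : Setoid X :=
    { r := fun x y => ∃ g, act x g = y
      iseqv :=
        { refl := fun x => ⟨1, act_one x⟩
          symm := by
            rintro x _ ⟨g, rfl⟩
            exact ⟨g⁻¹, by rw [← act_mul, mul_inv_cancel, act_one]⟩
          trans := by
            rintro x _ _ ⟨g, rfl⟩ ⟨h, rfl⟩
            exact ⟨g * h, act_mul x g h⟩ } }
  have h : ∀ x, ∃ g, act (Quotient.mk s x).out g = x := fun x => Quotient.mk_out (s := s) x
  choose γ hγ using h
  exact ⟨fun x => (Quotient.mk s x).out, γ, hγ, fun x g =>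
    congrArg Quotient.out (Quotient.sound (s := s) ⟨g⁻¹, by
      rw [← act_mul, mul_inv_cancel, act_one]⟩)⟩

variable {R A : Type u} {G X : Type} [CommRing R] [Ring A] [Algebra R A] [Group G]

theorem basis_induction {R A X : Type*} [Ring R] [AddCommGroup A] [Module R A]
    (b : Module.Basis X R A) {P : A → Prop} (a : A) (zero : P 0) (basis : ∀ x, P (b x))
    (add : ∀ x y, P x → P y → P (x + y)) (smul : ∀ (r : R) x, P x → P (r • x)) : P a := by
  refine Submodule.span_induction (p := fun a _ => P a) ?_ zero (fun x y _ _ => add x y)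
    (fun r x _ => smul r x) (b.mem_span a)
  rintro _ ⟨x, rfl⟩
  exact basis x

/-- If `G` acts on a basis of `A` by right multiplication, and freely on a part `Y` of that basis,
then the quotient of `A` by the span `J` of the other basis elements is projective over the group
ring. -/
theorem projective_quot_of_free_action (b : Module.Basis X R A) (j : MonoidAlgebra R G →ₐ[R] A)
    (act : X → G → X) (act_one : ∀ x, act x 1 = x)
    (act_mul : ∀ x g h, act x (g * h) = act (act x g) h)
    (hact : ∀ x g, b x * j (MonoidAlgebra.of R G g) = b (act x g)) (Y : Set X)
    (hY : ∀ x g, act x g ∈ Y ↔ x ∈ Y) (hfree : ∀ x ∈ Y, ∀ g, act x g = x → g = 1)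
    {J : AddSubgroup A} (hJ : ∀ s, ∀ a ∈ J, a * j s ∈ J) (hJ' : ∀ p, ∀ a ∈ J, p * a ∈ J)
    (hJY : ∀ a ∈ J, ∀ x ∈ Y, b.repr a x = 0) (hYJ : ∀ x, x ∉ Y → b x ∈ J) :
    Projective ((quotFunctor j hJ).obj (ModuleCat.of Aᵐᵒᵖ A)) := by
  classical
  obtain ⟨rep, γ, hγ, hrep⟩ := exists_orbit_representatives act act_one act_mul
  let S := MonoidAlgebra R G
  let M := ModuleCat.of Aᵐᵒᵖ A
  let of : G → S := MonoidAlgebra.of R G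
  -- Each free orbit in `Y` contributes one copy of `S`, generated by its representative: `x = rep x
  -- · γ x` is sent to `γ x` in the copy indexed by `rep x`. Basis elements outside `Y` go to `0`.
  let f : X → (X →₀ S) := fun x => if x ∈ Y then Finsupp.single (rep x) (of (γ x)) else 0
  let i0 : A →ₗ[R] (X →₀ S) := b.constr R f
  have hf : ∀ x g, f (act x g) = op (of g) • f x := by
    intro x g
    by_cases hx : x ∈ Y
    · have h1 : γ (act x g) = γ x * g := by
        refine (inv_mul_eq_one.1 (hfree (act x g) ((hY x g).2 hx) _ ?_)).symm
        have h2 : act (rep x) (γ (act x g)) = act x g := by rw [← hrep x g, hγ]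
        have h3 : act x g = act (rep x) (γ x * g) := by rw [act_mul, hγ]
        calc _ = act (act (rep x) (γ x * g)) ((γ x * g)⁻¹ * γ (act x g)) := by rw [← h3]
          _ = act x g := by rw [← act_mul, mul_inv_cancel_left, h2]
      simp only [f]
      rw [if_pos hx, if_pos ((hY x g).2 hx), hrep, h1, Finsupp.smul_single]
      congr 1
      exact map_mul (MonoidAlgebra.of R G) _ _
    · simp only [f]
      rw [if_neg hx, if_neg fun h => hx ((hY x g).1 h), smul_zero]
  have hi : ∀ (s : S) a, i0 (a * j s) = op s • i0 a := by
    intro s a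
    induction s using MonoidAlgebra.induction_on with
    | of g =>
      induction a using basis_induction b with
      | zero => rw [zero_mul, map_zero, smul_zero]
      | basis x =>
        rw [hact, Module.Basis.constr_basis, Module.Basis.constr_basis]
        exact hf x g
      | add a a' ha ha' => rw [add_mul, map_add, map_add, smul_add, ha, ha']
      | smul r a ha => rw [smul_mul_assoc, map_smul, map_smul, ha, smul_comm]
    | add s t hs ht => rw [map_add, mul_add, map_add, hs, ht, MulOpposite.op_add, add_smul]
    | smul r s hs =>
      rw [map_smul, mul_smul_comm, map_smul, hs, MulOpposite.op_smul, smul_assoc]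
  have hproj := projective_op_self S
  have := projective_finsupp (B := Sᵐᵒᵖ) (Q := S) (ι := X)
  let i : (quotFunctor j hJ).obj M →ₗ[Sᵐᵒᵖ] (X →₀ S) := quotLift (M := M) i0.toAddMonoidHom hi
    (fun x hx => by
      -- Since `J` is a left ideal, `p a` lies in `J` and has no coordinates on `Y`, while `f`
      -- vanishes outside `Y`.
      have h1 : mulSubgroup A J ≤ i0.toAddMonoidHom.ker := mulSubgroup_le fun p a ha => by
        have h2 : i0 (p * a) = 0 := by
          rw [Module.Basis.constr_apply]
          refine Finset.sum_eq_zero fun x _ => ?_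
          by_cases hx : x ∈ Y
          · exact (congrArg (· • f x) (hJY _ (hJ' p a ha) x hx)).trans (zero_smul R (f x))
          · exact (congrArg (b.repr (p * a) x • ·) (if_neg hx)).trans (smul_zero _)
        exact h2
      exact h1 hx)
  let r : (X →₀ S) →ₗ[Sᵐᵒᵖ] (quotFunctor j hJ).obj M := Finsupp.lsum ℕ fun x =>
    { toFun := fun s => quotMk j hJ M (b x * j s : A)
      map_add' := fun s t => by
        rw [map_add, mul_add]
        exact map_add (quotMk j hJ M) _ _
      map_smul' := fun t s => by
        have h1 : b x * j (t • s) = op (j t.unop) • (b x * j s) := by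
          rw [op_smul_eq_mul, mul_assoc, ← map_mul]
          rfl
        rw [h1]
        exact quotMk_smul j hJ (M := M) t.unop _ }
  refine (IsProjective.iff_projective _).1 (Module.Projective.of_split i r ?_)
  refine LinearMap.ext fun x => ?_
  obtain ⟨x, rfl⟩ := quotMk_surjective j hJ M x
  have hx : ∀ a : A, r (i0 a) = quotMk j hJ M a := by
    intro a
    induction a using basis_induction b with
    | zero => rw [map_zero, map_zero]; exact (map_zero (quotMk j hJ M)).symm
    | basis x =>
      rw [Module.Basis.constr_basis]
      by_cases hx : x ∈ Y
      · refine (congrArg r (if_pos hx)).trans ?_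
        refine (Finsupp.lsum_single ℕ _ (rep x) (of (γ x))).trans ?_
        refine congrArg (quotMk j hJ M) ?_
        exact (hact (rep x) (γ x)).trans (congrArg b (hγ x))
      · refine (congrArg r (if_neg hx)).trans ?_
        rw [map_zero]
        refine ((quotMk_eq_zero j hJ (M := M) (b x)).2 ?_).symm
        have h1 := op_smul_mem_mulSubgroup (P := A) (hYJ x hx) 1
        rwa [op_smul_eq_mul, one_mul] at h1
    | add a a' ha ha' => rw [map_add, map_add, ha, ha']; exact (map_add (quotMk j hJ M) _ _).symm
    | smul c a ha =>
      -- Scalars are rewritten as right multiplication by elements of `S`, so that `S`-linearity of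
      -- `i0` and `r` covers them.
      have h1 : c • a = a * j (algebraMap R S c) := by
        rw [j.commutes, ← Algebra.commutes, Algebra.smul_def]
      rw [h1, hi, map_smul, ha]
      exact (quotMk_smul j hJ (M := M) _ a).symm
  exact hx x

end PermutationModules
end Brauer

/-! ### Pasting with cup-cap diagrams and with permutations. -/

namespace Brauer

/-- The two ends of an arc form a set closed under passing to partners. This is used to isolate a
closed loop from the rest of a pasted diagram. -/
theorem eq_or_eq_iff_of_involutive {X : Type*} (f : X → X) (hf : ∀ x, f (f x) = x) {u v : X}
    (h : f u = v) (x : X) : (x = u ∨ x = v) ↔ (f x = u ∨ f x = v) := by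
  subst h
  constructor
  · rintro (rfl | rfl)
    · exact Or.inr rfl
    · exact Or.inl (hf u)
  · rintro (h | h)
    · right; rw [← h, hf]
    · left; rw [← hf x, h, hf]

namespace Diagram

variable {α β γ : Type*}

theorem partner_eq_symm (d : Diagram α β) {x y : α ⊕ β} (h : d.partner x = y) : d.partner y = x := by
  rw [← h, d.partner_partner]

theorem component_of_left (d : Diagram α β) (e : Diagram β γ) {x y : α ⊕ β} (h : d.partner x = y) :
    component d e (Sum.map id Sum.inl x) = component d e (Sum.map id Sum.inl y) :=
  h ▸ component_left d e x

theorem component_of_right (d : Diagram α β) (e : Diagram β γ) {x y : β ⊕ γ} (h : e.partner x = y) :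
    component d e (Sum.inr x) = component d e (Sum.inr y) :=
  h ▸ component_right d e x

section

variable [Finite α] [Finite β] [Finite γ]

theorem comp_partner_eq (d : Diagram α β) (e : Diagram β γ) {x y : α ⊕ γ} (hxy : y ≠ x)
    (h : component d e (outer x) = component d e (outer y)) : (d.comp e).partner x = y :=
  (((component_outer_eq d e x y).1 h).resolve_left hxy).symm

/-- An arc between right nodes of `e` is untouched by pasting on the left. Hence diagrams with
prescribed right arcs span left ideals. -/
theorem comp_partner_inr (d : Diagram α β) (e : Diagram β γ) {i j : γ}
    (h : e.partner (Sum.inr i) = Sum.inr j) : (d.comp e).partner (Sum.inr i) = Sum.inr j := by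
  refine comp_partner_eq d e (fun hij => e.partner_ne (Sum.inr i) (h.trans ?_)) ?_
  · rw [Sum.inr_injective hij]
  · have := component_right d e (Sum.inr i)
    rwa [h] at this

theorem comp_partner_inl (d : Diagram α β) (e : Diagram β γ) {i j : α}
    (h : d.partner (Sum.inl i) = Sum.inl j) : (d.comp e).partner (Sum.inl i) = Sum.inl j := by
  refine comp_partner_eq d e (fun hij => d.partner_ne (Sum.inl i) (h.trans ?_)) ?_
  · rw [Sum.inl_injective hij]
  · have := component_left d e (Sum.inl i)
    rwa [h] at this

/-- Pasting a diagram with a right arc `i, j` and a diagram that contains this arc, too, and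
continues all other right nodes. -/
theorem comp_eq_left (d : Diagram α β) (e : Diagram β β) {i j : β}
    (hd : d.partner (Sum.inr i) = Sum.inr j) (he : e.partner (Sum.inr i) = Sum.inr j)
    (h : ∀ y, y ≠ i → y ≠ j →
      component d e (outer (Sum.inr y)) = component d e (Sum.inr (Sum.inl y))) : d.comp e = d := by
  -- Away from `i` and `j`, an outer node of the pasting is connected to the corresponding node of
  -- `d`, so its partner can be read off in `d`.
  have key : ∀ x : α ⊕ β, x ≠ Sum.inr i → x ≠ Sum.inr j →
      component d e (outer x) = component d e (Sum.map id Sum.inl x) := by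
    rintro (a | y) h1 h2
    · rfl
    · exact h y (fun hy => h1 (hy ▸ rfl)) fun hy => h2 (hy ▸ rfl)
  have hd' := d.partner_eq_symm hd
  refine comp_eq d e d fun x => ?_
  by_cases h1 : x = Sum.inr i
  · rw [h1, hd]
    exact component_of_right d e he
  by_cases h2 : x = Sum.inr j
  · rw [h2, hd']
    exact (component_of_right d e he).symm
  rw [key x h1 h2, key _ ?_ ?_, component_left]
  · intro h3
    rw [d.partner_eq_symm h3] at hd
    exact h2 (hd ▸ (d.partner_eq_symm h3).symm ▸ rfl)
  · intro h3
    exact h1 ((d.partner_eq_symm h3).symm.trans hd')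

/-- A right arc of `d` whose ends are continued by `e` is a right arc of the product. -/
theorem comp_partner_of_through (d : Diagram α β) (e : Diagram β γ) {x y : γ} {x' y' : β}
    (hx : e.partner (Sum.inr x) = Sum.inl x') (hy : e.partner (Sum.inr y) = Sum.inl y')
    (hd : d.partner (Sum.inr x') = Sum.inr y') : (d.comp e).partner (Sum.inr x) = Sum.inr y := by
  refine comp_partner_eq d e (fun hxy => d.partner_ne (Sum.inr x') ?_) ?_
  · have h1 := Sum.inr_injective hxy
    rw [h1, hx] at hy
    rw [hd, Sum.inl_injective hy]
  · exact (component_of_right d e hx).trans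
      ((component_of_left d e hd).trans (component_of_right d e hy).symm)

end

/-- The diagram joins `i` and `j` on both sides, and every other node to the opposite node. -/
structure IsCupCap (w : Diagram β β) (i j : β) : Prop where
  left : w.partner (Sum.inl i) = Sum.inl j
  right : w.partner (Sum.inr i) = Sum.inr j
  through : ∀ y, y ≠ i → y ≠ j → w.partner (Sum.inl y) = Sum.inr y

theorem exists_isCupCap {i j : β} (hij : i ≠ j) : ∃ w : Diagram β β, w.IsCupCap i j := by
  classical
  have h1 : ∀ x, Equiv.swap i j x = i ∨ Equiv.swap i j x = j ↔ x = i ∨ x = j := by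
    intro x
    rw [Equiv.swap_apply_eq_iff, Equiv.swap_apply_eq_iff, Equiv.swap_apply_left,
      Equiv.swap_apply_right, or_comm]
  have h2 : ∀ x, x = i ∨ x = j → Equiv.swap i j x ≠ x := by
    rintro x (rfl | rfl)
    · rw [Equiv.swap_apply_left]; exact hij.symm
    · rw [Equiv.swap_apply_right]; exact hij
  -- On both sides `i` and `j` are exchanged by the transposition, and every other node crosses to
  -- the other side.
  refine ⟨⟨Sum.elim
    (fun x => if x = i ∨ x = j then Sum.inl (Equiv.swap i j x) else Sum.inr x)
    (fun x => if x = i ∨ x = j then Sum.inr (Equiv.swap i j x) else Sum.inl x), ?_, ?_⟩, ?_, ?_, ?_⟩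
  · rintro (x | x)
    all_goals
      by_cases hx : x = i ∨ x = j
      · simp [hx, h1]
      · simp [hx]
  · rintro (x | x)
    all_goals
      by_cases hx : x = i ∨ x = j
      · simp [hx, h2]
      · simp [hx]
  · simp
  · simp
  · intro y hi hj
    simp [hi, hj]

namespace IsCupCap

variable {w : Diagram β β} {i j : β}

theorem through_right (hw : w.IsCupCap i j) (y : β) (hi : y ≠ i) (hj : y ≠ j) :
    w.partner (Sum.inr y) = Sum.inl y := w.partner_eq_symm (hw.through y hi hj)

theorem not_ofPerm (hw : w.IsCupCap i j) : ¬ ∃ σ, w = ofPerm σ := by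
  rintro ⟨σ, rfl⟩
  have := hw.right
  simp at this

theorem extend {m n : ℕ} {w : Diagram (Fin m) (Fin m)} {i j : Fin m} (hw : w.IsCupCap i j)
    (h : m ≤ n) : (w.extend h).IsCupCap (Fin.castLE h i) (Fin.castLE h j) where
  left := (extend_castLE h w (Sum.inl i)).trans (by rw [hw.left]; rfl)
  right := (extend_castLE h w (Sum.inr i)).trans (by rw [hw.right]; rfl)
  through y hi hj := by
    by_cases hy : y.1 < m
    · obtain ⟨z, rfl⟩ : ∃ z : Fin m, y = Fin.castLE h z := ⟨⟨y, hy⟩, rfl⟩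
      exact (extend_castLE h w (Sum.inl z)).trans (by
        rw [hw.through z (fun h => hi (h ▸ rfl)) fun h => hj (h ▸ rfl)]; rfl)
    · exact extend_inl h w y hy

variable {d : Diagram α β}

/-- The arc `i, j` of `d` closes up with the left arc of `w`, and the right arc of `w` takes its
place; all other right nodes pass straight through `w`. -/
theorem comp_eq [Finite α] [Finite β] (hw : w.IsCupCap i j) (hd : d.partner (Sum.inr i) = Sum.inr j) : d.comp w = d :=
  comp_eq_left d w hd hw.right fun y hi hj => component_of_right d w (hw.through_right y hi hj)

/-- The loop consists of the right arc of `d` and the left arc of `w`. Every other middle node is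
connected to the right by `w`. This is the factor `δ` that has to be invertible if no spare node is
available. -/
theorem loops_eq_one (hw : w.IsCupCap i j) (hd : d.partner (Sum.inr i) = Sum.inr j) :
    loops d w = 1 := by
  have hij : component d w (Sum.inr (Sum.inl i)) = component d w (Sum.inr (Sum.inl j)) :=
    component_of_left d w hd
  let p : α ⊕ (β ⊕ β) → Prop := fun v => v = Sum.inr (Sum.inl i) ∨ v = Sum.inr (Sum.inl j)
  have hinl : Function.Injective (Sum.map id Sum.inl : α ⊕ β → α ⊕ (β ⊕ β)) :=
    Function.injective_id.sumMap Sum.inl_injective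
  have hp1 : ∀ x : α ⊕ β, p (Sum.map id Sum.inl x) ↔ x = Sum.inr i ∨ x = Sum.inr j := fun x =>
    or_congr (hinl.eq_iff (b := Sum.inr i)) (hinl.eq_iff (b := Sum.inr j))
  have hp2 : ∀ y : β ⊕ β, p (Sum.inr y) ↔ y = Sum.inl i ∨ y = Sum.inl j := fun y =>
    or_congr Sum.inr_injective.eq_iff Sum.inr_injective.eq_iff
  -- Being one of the middle nodes `i`, `j` is invariant along all arcs, so their component contains
  -- no outer node.
  let P : Component d w → Prop := Quot.lift p (by
    rintro u v (⟨x, rfl, rfl⟩ | ⟨y, rfl, rfl⟩)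
    · rw [hp1, hp1]
      exact propext (eq_or_eq_iff_of_involutive d.partner d.partner_partner hd x)
    · rw [hp2, hp2]
      exact propext (eq_or_eq_iff_of_involutive w.partner w.partner_partner hw.left y))
  rw [loops, Nat.card_eq_one_iff_unique]
  refine ⟨⟨?_⟩, ⟨component d w (Sum.inr (Sum.inl i)), fun x hx => ?_⟩⟩
  · have key : ∀ c : {c : Component d w // ∀ x, component d w (outer x) ≠ c},
        c.1 = component d w (Sum.inr (Sum.inl i)) := by
      rintro ⟨c, hc⟩
      induction c using Quot.ind with
      | mk v =>
        rcases v with a | y | y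
        · exact absurd rfl (hc (Sum.inl a))
        · by_cases hi : y = i
          · exact congrArg (fun y => component d w (Sum.inr (Sum.inl y))) hi
          by_cases hj : y = j
          · exact (congrArg (fun y => component d w (Sum.inr (Sum.inl y))) hj).trans hij.symm
          exact absurd (component_of_right d w (hw.through_right y hi hj)) (hc (Sum.inr y))
        · exact absurd rfl (hc (Sum.inr y))
    exact fun a b => Subtype.ext ((key a).trans (key b).symm)
  · have h1 : p (outer x) = p (Sum.inr (Sum.inl i)) := congrArg P hx
    have h2 : p (outer x) := h1 ▸ Or.inl rfl
    rcases x with a | y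
    · rcases h2 with h2 | h2 <;> simp at h2
    · rcases h2 with h2 | h2 <;> simp at h2

variable {v : Diagram β β} {k : β}

/-- The path runs from `k` on the right through `w` to the middle node `k`, along `v` to `j`, along
`w` to `i`, and through `v` to `i` on the left. So `v w` has left arc `j, k`, right arc `i, j`, a
strand from `i` to `k`, and is horizontal elsewhere. -/
theorem comp_through [Finite β] (hv : v.IsCupCap j k) (hw : w.IsCupCap i j) (hki : k ≠ i) (hkj : k ≠ j)
    (hij : i ≠ j) : (v.comp w).partner (Sum.inr k) = Sum.inl i := by
  refine comp_partner_eq v w (by simp) ?_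
  refine (component_of_right v w (hw.through_right k hki hkj)).trans ?_
  refine (component_of_left v w hv.right).symm.trans ?_
  refine (component_of_right v w hw.left).symm.trans ?_
  exact (component_of_left v w (hv.through i hij hki.symm)).symm

theorem comp_through' [Finite β] (hv : v.IsCupCap j k) (hw : w.IsCupCap i j) {y : β} (hi : y ≠ i)
    (hj : y ≠ j) (hk : y ≠ k) : (v.comp w).partner (Sum.inr y) = Sum.inl y := by
  refine comp_partner_eq v w (by simp) ?_
  refine (component_of_right v w (hw.through_right y hi hj)).trans ?_
  exact (component_of_left v w (hv.through y hj hk)).symm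

/-- The middle nodes `j` and `k` are joined by `v` and escape through `k` on the right; every other
middle node escapes to the left. -/
theorem loops_comp (hv : v.IsCupCap j k) (hw : w.IsCupCap i j) (hki : k ≠ i) (hkj : k ≠ j)
    (hij : i ≠ j) : loops v w = 0 := by
  have hk : component v w (outer (Sum.inr k)) = component v w (Sum.inr (Sum.inl k)) :=
    component_of_right v w (hw.through_right k hki hkj)
  refine loops_eq_zero v w fun y => ?_
  by_cases hyj : y = j
  · subst hyj
    exact ⟨Sum.inr k, hk.trans (component_of_left v w hv.right).symm⟩
  by_cases hyk : y = k
  · subst hyk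
    exact ⟨Sum.inr y, hk⟩
  exact ⟨Sum.inl y, component_of_left v w (hv.through y hyj hyk)⟩

/-- The only strand of `v w` that is not horizontal is the one at `k`. It leads to the middle node
`i`, then along the arc of `d` to `j`, and back along the left arc of `v w` to the middle node `k`:
the detour is straightened. -/
theorem component_comp [Finite β] (hv : v.IsCupCap j k) (hw : w.IsCupCap i j) (hki : k ≠ i) (hkj : k ≠ j)
    (hij : i ≠ j) (hd : d.partner (Sum.inr i) = Sum.inr j) (y : β) (hi : y ≠ i) (hj : y ≠ j) :
    component d (v.comp w) (outer (Sum.inr y)) =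
      component d (v.comp w) (Sum.inr (Sum.inl y)) := by
  by_cases hk : y = k
  · subst hk
    refine (component_of_right d _ (hv.comp_through hw hki hkj hij)).trans ?_
    refine (component_of_left d (v.comp w) hd).trans ?_
    exact component_of_right d (v.comp w) (comp_partner_inl v w hv.left)
  · exact component_of_right d _ (hv.comp_through' hw hi hj hk)

theorem comp_comp_eq [Finite α] [Finite β] (hv : v.IsCupCap j k) (hw : w.IsCupCap i j) (hki : k ≠ i) (hkj : k ≠ j)
    (hij : i ≠ j) (hd : d.partner (Sum.inr i) = Sum.inr j) : d.comp (v.comp w) = d :=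
  comp_eq_left d _ hd (comp_partner_inr v w hw.right)
    (hv.component_comp hw hki hkj hij hd)

/-- The arc of `d` is part of the strand ending at `k` on the right, so, in contrast to pasting with
a single cup-cap, no loop closes and no factor `δ` appears. -/
theorem loops_comp_comp [Finite β] (hv : v.IsCupCap j k) (hw : w.IsCupCap i j) (hki : k ≠ i) (hkj : k ≠ j)
    (hij : i ≠ j) (hd : d.partner (Sum.inr i) = Sum.inr j) : loops d (v.comp w) = 0 := by
  have hk := hv.component_comp hw hki hkj hij hd
  have hj : component d (v.comp w) (Sum.inr (Sum.inl j)) =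
      component d (v.comp w) (Sum.inr (Sum.inl k)) :=
    component_of_right d (v.comp w) (comp_partner_inl v w hv.left)
  refine loops_eq_zero _ _ fun y => ?_
  by_cases hyj : y = j
  · subst hyj
    exact ⟨Sum.inr k, (hk k hki hkj).trans hj.symm⟩
  by_cases hyi : y = i
  · subst hyi
    refine ⟨Sum.inr k, (hk k hki hkj).trans (hj.symm.trans ?_)⟩
    exact (component_of_left d (v.comp w) hd).symm
  exact ⟨Sum.inr y, hk y hyi hyj⟩

end IsCupCap

section Perm

variable [Finite α] [Finite β]

theorem comp_ofPerm_partner (d : Diagram α β) (τ : Equiv.Perm β) (x : α ⊕ β) :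
    (d.comp (ofPerm τ)).partner x = Sum.map id ⇑τ⁻¹ (d.partner (Sum.map id τ x)) := by
  have key : ∀ x : α ⊕ β, component d (ofPerm τ) (outer x) =
      component d (ofPerm τ) (Sum.map id Sum.inl (Sum.map id τ x)) := by
    rintro (a | y)
    · rfl
    · exact component_ofPerm_right d τ y
  have hτ : ∀ z : α ⊕ β, Sum.map id τ (Sum.map id ⇑τ⁻¹ z) = z := by
    rintro (a | y) <;> simp
  refine comp_partner_eq d _ (fun h => d.partner_ne (Sum.map id τ x) ?_) ?_
  · conv_rhs => rw [← h, hτ]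
  · rw [key, key, hτ]
    exact component_left d _ _

end Perm

end Diagram
end Brauer

namespace Brauer

/-! ### Left ideals spanned by diagrams with prescribed right arcs, and their right identities. -/

noncomputable section DiagramIdeals

open CategoryTheory MulOpposite Diagram BrauerAlgebra

universe u

variable {R : Type u} [CommRing R] {δ : R} {m n : ℕ}

variable (R δ) in
/-- The span of a set of diagrams. -/
def diagramSpan (S : Set (Diagram (Fin n) (Fin n))) : AddSubgroup (BrauerAlgebra R δ n) :=
  (Submodule.span R (basis R δ n '' S)).toAddSubgroup

section Span

variable {S T : Set (Diagram (Fin n) (Fin n))} {x : BrauerAlgebra R δ n}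

theorem mem_diagramSpan_iff :
    x ∈ diagramSpan R δ S ↔ ∀ d, d ∉ S → (basis R δ n).repr x d = 0 := by
  refine ((basis R δ n).mem_span_image).trans ?_
  constructor
  · intro h d hd
    by_contra h1
    exact hd (h (Finsupp.mem_support_iff.2 h1))
  · intro h d hd
    by_contra h1
    exact (Finsupp.mem_support_iff.1 hd) (h d h1)

theorem basis_mem_diagramSpan {d : Diagram (Fin n) (Fin n)} (hd : d ∈ S) :
    basis R δ n d ∈ diagramSpan R δ S :=
  Submodule.subset_span ⟨d, hd, rfl⟩

theorem smul_mem_diagramSpan (r : R) (hx : x ∈ diagramSpan R δ S) : r • x ∈ diagramSpan R δ S :=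
  Submodule.smul_mem (Submodule.span R (basis R δ n '' S)) r hx

theorem diagramSpan_induction {P : ∀ x, x ∈ diagramSpan R δ S → Prop}
    (basis : ∀ d (hd : d ∈ S), P (basis R δ n d) (basis_mem_diagramSpan hd))
    (zero : P 0 (zero_mem _)) (add : ∀ x y hx hy, P x hx → P y hy → P (x + y) (add_mem hx hy))
    (smul : ∀ (r : R) x hx, P x hx → P (r • x) (smul_mem_diagramSpan r hx))
    (hx : x ∈ diagramSpan R δ S) : P x hx := by
  refine Submodule.span_induction (p := P) ?_ zero add smul hx
  rintro _ ⟨d, hd, rfl⟩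
  exact basis d hd

theorem diagramSpan_empty : diagramSpan R δ (∅ : Set (Diagram (Fin n) (Fin n))) = ⊥ := by
  rw [diagramSpan, Set.image_empty, Submodule.span_empty, Submodule.bot_toAddSubgroup]

theorem diagramSpan_mono (h : S ⊆ T) : diagramSpan R δ S ≤ diagramSpan R δ T :=
  Submodule.span_mono (Set.image_mono h)

theorem diagramSpan_union :
    diagramSpan R δ (S ∪ T) = diagramSpan R δ S ⊔ diagramSpan R δ T := by
  rw [diagramSpan, Set.image_union, Submodule.span_union, Submodule.sup_toAddSubgroup]
  rfl

/-- Spans of parts of a basis are cut out by vanishing coordinates. This identifies the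
intersections occurring in Mayer–Vietoris. -/
theorem diagramSpan_inter :
    diagramSpan R δ (S ∩ T) = diagramSpan R δ S ⊓ diagramSpan R δ T := by
  ext x
  rw [AddSubgroup.mem_inf, mem_diagramSpan_iff, mem_diagramSpan_iff, mem_diagramSpan_iff]
  refine ⟨fun h => ⟨fun d hd => h d fun h1 => hd h1.1, fun d hd => h d fun h1 => hd h1.2⟩,
    fun h d hd => ?_⟩
  by_cases h1 : d ∈ S
  · exact h.2 d fun h2 => hd ⟨h1, h2⟩
  · exact h.1 d h1

theorem mul_mem_of_basis_mul_mem (y : BrauerAlgebra R δ n)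
    (h : ∀ d ∈ S, basis R δ n d * y ∈ diagramSpan R δ T) (hx : x ∈ diagramSpan R δ S) :
    x * y ∈ diagramSpan R δ T := by
  induction hx using diagramSpan_induction with
  | zero => rw [zero_mul]; exact zero_mem _
  | basis d hd => exact h d hd
  | add x x' _ _ hx hx' => rw [add_mul]; exact add_mem hx hx'
  | smul r x _ hx => rw [smul_mul_assoc]; exact smul_mem_diagramSpan r hx

theorem mul_mem_diagramSpan (hS : ∀ e, ∀ d ∈ S, Diagram.comp e d ∈ S) (y : BrauerAlgebra R δ n)
    (hx : x ∈ diagramSpan R δ S) : y * x ∈ diagramSpan R δ S := by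
  induction hx using diagramSpan_induction with
  | zero => rw [mul_zero]; exact zero_mem _
  | basis d hd =>
    induction y using induction_basis with
    | zero => rw [zero_mul]; exact zero_mem _
    | add y y' hy hy' => rw [add_mul]; exact add_mem hy hy'
    | smul r e =>
      rw [smul_mul_assoc, basis_mul_basis]
      exact smul_mem_diagramSpan r (smul_mem_diagramSpan _ (basis_mem_diagramSpan (hS e d hd)))
  | add x x' _ _ hx hx' => rw [mul_add]; exact add_mem hx hx'
  | smul r x _ hx => rw [mul_smul_comm]; exact smul_mem_diagramSpan r hx

theorem mul_eq_self_of_mem_diagramSpan (y : BrauerAlgebra R δ n)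
    (h : ∀ d ∈ S, basis R δ n d * y = basis R δ n d) (hx : x ∈ diagramSpan R δ S) : x * y = x := by
  induction hx using diagramSpan_induction with
  | zero => rw [zero_mul]
  | basis d hd => exact h d hd
  | add x x' _ _ hx hx' => rw [add_mul, hx, hx']
  | smul r x _ hx => rw [smul_mul_assoc, hx]

theorem brAug_eq_zero_of_mem_diagramSpan (hS : ∀ d ∈ S, ¬ ∃ σ, d = ofPerm σ)
    (hx : x ∈ diagramSpan R δ S) : brAug R δ n x = 0 := by
  induction hx using diagramSpan_induction with
  | zero => exact map_zero _
  | basis d hd => exact brAug_basis_of_not R δ n d (hS d hd)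
  | add x x' _ _ hx hx' => rw [map_add, hx, hx', add_zero]
  | smul r x _ hx => rw [map_smul, hx, smul_zero]

end Span

section Arcs

variable (h : m ≤ n)

/-- The diagrams that contain the given right arcs between the first `m` nodes. -/
def arcs (M : List (Fin m × Fin m)) : Set (Diagram (Fin n) (Fin n)) :=
  {d | ∀ p ∈ M, d.partner (Sum.inr (Fin.castLE h p.1)) = Sum.inr (Fin.castLE h p.2)}

/-- The diagrams that contain all arcs in `M` and some arc in `L`. -/
def arcUnion (L M : List (Fin m × Fin m)) : Set (Diagram (Fin n) (Fin n)) :=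
  {d | d ∈ arcs h M ∧ ∃ a ∈ L, d ∈ arcs h [a]}

/-- The diagrams with a right arc between two of the first `m` nodes. -/
def innerArcs : Set (Diagram (Fin n) (Fin n)) :=
  {d | ∃ i j : Fin m, d.partner (Sum.inr (Fin.castLE h i)) = Sum.inr (Fin.castLE h j)}

variable {h} {L M : List (Fin m × Fin m)} {a : Fin m × Fin m} {d : Diagram (Fin n) (Fin n)}

theorem mem_arcs_singleton : d ∈ arcs h [a] ↔
    d.partner (Sum.inr (Fin.castLE h a.1)) = Sum.inr (Fin.castLE h a.2) :=
  List.forall_mem_singleton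

theorem arcs_cons : arcs h (a :: M) = arcs h [a] ∩ arcs h M :=
  Set.ext fun _ => List.forall_mem_cons.trans (and_congr_left' mem_arcs_singleton.symm)

theorem comp_mem_arcs (e : Diagram (Fin n) (Fin n)) (hd : d ∈ arcs h M) : e.comp d ∈ arcs h M :=
  fun p hp => comp_partner_inr e d (hd p hp)

theorem comp_mem_arcUnion (e : Diagram (Fin n) (Fin n)) (hd : d ∈ arcUnion h L M) :
    e.comp d ∈ arcUnion h L M :=
  ⟨comp_mem_arcs e hd.1, hd.2.imp fun _ ha => ⟨ha.1, comp_mem_arcs e ha.2⟩⟩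

theorem not_ofPerm_of_mem_innerArcs (hd : d ∈ innerArcs h) : ¬ ∃ σ, d = ofPerm σ := by
  rintro ⟨σ, rfl⟩
  obtain ⟨i, j, hij⟩ := hd
  simp at hij

theorem arcs_subset_innerArcs (ha : a ∈ M) : arcs h M ⊆ innerArcs h :=
  fun _ hd => ⟨a.1, a.2, hd a ha⟩

theorem arcUnion_nil : arcUnion h [] M = ∅ :=
  Set.eq_empty_of_forall_notMem fun d hd => by
    obtain ⟨a, ha, -⟩ := hd.2
    exact List.not_mem_nil ha

theorem arcUnion_cons : arcUnion h (a :: L) M = arcs h (a :: M) ∪ arcUnion h L M := by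
  ext d
  rw [Set.mem_union, arcs_cons]
  constructor
  · rintro ⟨hd, b, hb, hdb⟩
    rcases List.mem_cons.1 hb with rfl | hb
    · exact Or.inl ⟨hdb, hd⟩
    · exact Or.inr ⟨hd, b, hb, hdb⟩
  · rintro (hd | ⟨hd, b, hb, hdb⟩)
    · exact ⟨hd.2, a, List.mem_cons_self, hd.1⟩
    · exact ⟨hd, b, List.mem_cons_of_mem a hb, hdb⟩

/-- The overlap of the two pieces of `arcUnion h (a :: L) M` is again of the same kind, with shorter
`L` and longer `M`; this drives the induction on `L`. -/
theorem arcs_inter_arcUnion : arcs h (a :: M) ∩ arcUnion h L M = arcUnion h L (a :: M) := by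
  ext d
  rw [arcs_cons]
  constructor
  · rintro ⟨hd, -, hL⟩
    exact ⟨by rwa [arcs_cons], hL⟩
  · rintro ⟨hd, hL⟩
    rw [arcs_cons] at hd
    exact ⟨hd, hd.2, hL⟩

theorem innerArcs_eq : innerArcs h = arcUnion h Finset.univ.toList [] := by
  ext d
  constructor
  · rintro ⟨i, j, hij⟩
    exact ⟨fun _ hp => absurd hp List.not_mem_nil, (i, j), Finset.mem_toList.2 (Finset.mem_univ _),
      mem_arcs_singleton.2 hij⟩
  · rintro ⟨-, a, -, ha⟩
    exact ⟨a.1, a.2, mem_arcs_singleton.1 ha⟩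

/-- For an arc between two of the first `m` nodes, there is an element of the left ideal
generated by diagrams on `m` nodes with this arc that acts as the identity on all diagrams with this
arc, and preserves all other arcs. -/
theorem exists_arc_element (hδ : IsUnit δ ∨ m < n) {i j : Fin m} (hij : i ≠ j) :
    ∃ (V : BrauerAlgebra R δ n) (u : Diagram (Fin m) (Fin m)), (¬ ∃ σ, u = ofPerm σ) ∧
      V * brIncl R δ h (basis R δ m u) ∈ diagramSpan R δ (arcs h [(i, j)]) ∧
      (∀ x ∈ diagramSpan R δ (arcs h [(i, j)]), x * (V * brIncl R δ h (basis R δ m u)) = x) ∧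
      ∀ M : List (Fin m × Fin m), (∀ p ∈ M, (p.1 ≠ i ∧ p.1 ≠ j) ∧ p.2 ≠ i ∧ p.2 ≠ j) →
        ∀ x ∈ diagramSpan R δ (arcs h M),
          x * (V * brIncl R δ h (basis R δ m u)) ∈ diagramSpan R δ (arcs h M) := by
  obtain ⟨u, hu⟩ := exists_isCupCap hij
  have hw := hu.extend h
  have hc : ∀ {x y : Fin m}, x ≠ y → Fin.castLE h x ≠ Fin.castLE h y :=
    fun hxy h1 => hxy (Fin.castLE_injective h h1)
  -- It is enough that `V u` is a multiple `r e` of one diagram with right arc `i, j` and horizontal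
  -- strands at the other first `m` nodes, such that `d e = d` and `r` cancels the loop factor for
  -- all `d` with the arc.
  suffices H : ∃ (V : BrauerAlgebra R δ n) (r : R) (e : Diagram (Fin n) (Fin n)),
      V * basis R δ n (u.extend h) = r • basis R δ n e ∧
      e.partner (Sum.inr (Fin.castLE h i)) = Sum.inr (Fin.castLE h j) ∧
      (∀ y, y ≠ i → y ≠ j → e.partner (Sum.inr (Fin.castLE h y)) = Sum.inl (Fin.castLE h y)) ∧
      ∀ d : Diagram (Fin n) (Fin n),
        d.partner (Sum.inr (Fin.castLE h i)) = Sum.inr (Fin.castLE h j) →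
        d.comp e = d ∧ r * δ ^ loops d e = 1 by
    obtain ⟨V, r, e, hV, he, hthrough, hd⟩ := H
    refine ⟨V, u, hu.not_ofPerm, ?_, fun x hx => ?_, fun M hM x hx => ?_⟩
    all_goals rw [brIncl_basis, hV]
    · exact smul_mem_diagramSpan r (basis_mem_diagramSpan (mem_arcs_singleton.2 he))
    · refine mul_eq_self_of_mem_diagramSpan _ (fun d hd' => ?_) hx
      obtain ⟨h1, h2⟩ := hd d (mem_arcs_singleton.1 hd')
      rw [mul_smul_comm, basis_mul_basis, h1, smul_smul, h2, one_smul]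
    · refine mul_mem_of_basis_mul_mem _ (fun d hd' => ?_) hx
      rw [mul_smul_comm, basis_mul_basis]
      refine smul_mem_diagramSpan r (smul_mem_diagramSpan _ (basis_mem_diagramSpan fun p hp => ?_))
      have h1 := hM p hp
      exact comp_partner_of_through d e (hthrough _ h1.1.1 h1.1.2) (hthrough _ h1.2.1 h1.2.2)
        (hd' p hp)
  rcases hδ with hδ | hmn
  · obtain ⟨r, hr⟩ := hδ.exists_left_inv
    -- For invertible `δ`, take `e` to be the cup-cap `u` itself; each product creates one loop,
    -- cancelled by `V = δ⁻¹`.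
    refine ⟨r • 1, r, u.extend h, by rw [smul_mul_assoc, one_mul], hw.right, fun y hi hj =>
      hw.through_right _ (hc hi) (hc hj), fun d hd => ⟨hw.comp_eq hd, ?_⟩⟩
    rw [hw.loops_eq_one hd, pow_one, hr]
  -- Counting nodes from `0`, `k` is the first node beyond the first `m`. Taking for `V` the cup-cap
  -- at `j, k` straightens the strand, so that no loop arises and `r = 1`.
  · let k : Fin n := ⟨m, hmn⟩
    have hk : ∀ y : Fin m, k ≠ Fin.castLE h y := fun y hy => y.2.ne' (congrArg Fin.val hy)
    obtain ⟨v, hv⟩ := exists_isCupCap (hk j).symm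
    refine ⟨basis R δ n v, 1, v.comp (u.extend h), ?_, comp_partner_inr _ _ hw.right,
      fun y hi hj => hv.comp_through' hw (hc hi) (hc hj) (hk y).symm, fun d hd =>
      ⟨hv.comp_comp_eq hw (hk i) (hk j) (hc hij) hd, ?_⟩⟩
    · rw [basis_mul_basis, hv.loops_comp hw (hk i) (hk j) (hc hij), pow_zero]
    · rw [hv.loops_comp_comp hw (hk i) (hk j) (hc hij) hd, pow_zero, one_mul]

/-- Compatible arcs are disjoint, and the right identity for `M` is the product of those for its
arcs: a later factor fixes diagrams with its own arc and does not destroy the other arcs.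
Incompatible arcs leave no diagram at all. -/
theorem exists_idempotent (hδ : IsUnit δ ∨ m < n) (M : List (Fin m × Fin m)) :
    diagramSpan R δ (arcs h M) = ⊥ ∨
      ∃ e ∈ diagramSpan R δ (arcs h M), ∀ x ∈ diagramSpan R δ (arcs h M), x * e = x := by
  induction M with
  | nil =>
    refine Or.inr ⟨1, ?_, fun x _ => mul_one x⟩
    exact basis_mem_diagramSpan fun _ hp => absurd hp List.not_mem_nil
  | cons a M ih =>
    obtain ⟨i, j⟩ := a
    rcases (arcs h ((i, j) :: M)).eq_empty_or_nonempty with hM | ⟨d, hd⟩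
    · exact Or.inl (by rw [hM, diagramSpan_empty])
    rw [arcs_cons] at hd ⊢
    have hdi := mem_arcs_singleton.1 hd.1
    have hdj := d.partner_eq_symm hdi
    have hij : i ≠ j := by
      rintro rfl
      exact d.partner_ne _ hdi
    have hc : ∀ {x y : Fin m}, (Sum.inr (Fin.castLE h x) : Fin n ⊕ Fin n) = Sum.inr (Fin.castLE h y) →
        x = y := fun hxy => Fin.castLE_injective h (Sum.inr_injective hxy)
    -- If the arc occurs in `M`, in either orientation, it imposes nothing new. Otherwise the
    -- existing diagram `d` shows that the arcs of `M` avoid `i` and `j`, since a node has only one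
    -- partner.
    by_cases hmem : (i, j) ∈ M ∨ (j, i) ∈ M
    · have h1 : arcs h [(i, j)] ∩ arcs h M = arcs h M := by
        refine Set.inter_eq_right.2 fun d' hd' => mem_arcs_singleton.2 ?_
        rcases hmem with hmem | hmem
        · exact hd' _ hmem
        · exact d'.partner_eq_symm (hd' _ hmem)
      rwa [h1]
    rcases ih with ih | ⟨e, he, hxe⟩
    · exact Or.inl (eq_bot_iff.2 (ih ▸ diagramSpan_mono Set.inter_subset_right))
    obtain ⟨V, u, -, h1, h2, h3⟩ := exists_arc_element (h := h) hδ hij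
    refine Or.inr ⟨e * (V * brIncl R δ h (basis R δ m u)), ?_, fun x hx => ?_⟩
    · rw [diagramSpan_inter]
      refine ⟨mul_mem_diagramSpan (fun e d hd => comp_mem_arcs e hd) _ h1, h3 M ?_ e he⟩
      rintro ⟨x, y⟩ hp
      have hxy := hd.2 _ hp
      have hyx := d.partner_eq_symm hxy
      refine ⟨⟨?_, ?_⟩, ?_, ?_⟩
      · rintro (rfl : x = i)
        obtain rfl : y = j := hc (hxy.symm.trans hdi)
        exact hmem (Or.inl hp)
      · rintro (rfl : x = j)
        obtain rfl : y = i := hc (hxy.symm.trans hdj)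
        exact hmem (Or.inr hp)
      · rintro (rfl : y = i)
        obtain rfl : x = j := hc (hyx.symm.trans hdi)
        exact hmem (Or.inr hp)
      · rintro (rfl : y = j)
        obtain rfl : x = i := hc (hyx.symm.trans hdj)
        exact hmem (Or.inl hp)
    · rw [diagramSpan_inter] at hx
      rw [← mul_assoc, hxe x hx.2, h2 x hx.1]

/-- The list has to be nonempty: only then do all diagrams concerned, and with them the right
identity, have augmentation `0`. For the empty list the span is the whole algebra. -/
theorem mulAcyclic_arcs (hδ : IsUnit δ ∨ m < n)
    (P : ProjectiveResolution (ModuleCat.of (BrauerAlgebra R δ n)ᵐᵒᵖ (Triv (brAug R δ n))))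
    (ha : a ∈ M) : MulAcyclic P.complex (diagramSpan R δ (arcs h M)) := by
  rcases exists_idempotent (h := h) hδ M with h1 | ⟨e, he, h1⟩
  · rw [h1]
    exact mulAcyclic_bot _
  · exact mulAcyclic_of_idempotent P he h1 (brAug_eq_zero_of_mem_diagramSpan
      (fun d hd => not_ofPerm_of_mem_innerArcs (arcs_subset_innerArcs ha hd)) he)

/-- Splitting off one arc from `L` leaves a Mayer–Vietoris situation whose pieces are the span for
`a :: M` and the unions for the shorter `L` with `M` and with `a :: M`. Hence `M` must vary in the
induction. -/
theorem mulAcyclic_arcUnion (hδ : IsUnit δ ∨ m < n)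
    (P : ProjectiveResolution (ModuleCat.of (BrauerAlgebra R δ n)ᵐᵒᵖ (Triv (brAug R δ n))))
    (L M : List (Fin m × Fin m)) : MulAcyclic P.complex (diagramSpan R δ (arcUnion h L M)) := by
  induction L generalizing M with
  | nil =>
    rw [arcUnion_nil, diagramSpan_empty]
    exact mulAcyclic_bot _
  | cons a L ih =>
    rw [arcUnion_cons, diagramSpan_union]
    refine mulAcyclic_sup P.complex P.projective
      (fun b x hx => mul_mem_diagramSpan (fun e d hd => comp_mem_arcs e hd) b hx)
      (fun b x hx => mul_mem_diagramSpan (fun e d hd => comp_mem_arcUnion e hd) b hx)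
      (mulAcyclic_arcs hδ P List.mem_cons_self) (ih M) ?_
    rw [← diagramSpan_inter, arcs_inter_arcUnion]
    exact ih (a :: M)

theorem mulAcyclic_innerArcs (hδ : IsUnit δ ∨ m < n)
    (P : ProjectiveResolution (ModuleCat.of (BrauerAlgebra R δ n)ᵐᵒᵖ (Triv (brAug R δ n)))) :
    MulAcyclic P.complex (diagramSpan R δ (innerArcs h)) := by
  rw [innerArcs_eq]
  exact mulAcyclic_arcUnion hδ P _ _

end Arcs

end DiagramIdeals
end Brauer

namespace Brauer

/-! ### Verification for the two algebras, and the maps on Tor. -/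

noncomputable section Excision

open CategoryTheory TensorProduct MulOpposite Diagram BrauerAlgebra

universe u

section Induced

variable {R A A₀ B B₀ : Type u} [CommRing R] [Ring A] [Ring A₀] [Ring B] [Ring B₀] [Algebra R A]
  [Algebra R A₀] [Algebra R B] [Algebra R B₀]

theorem Induced.zero_mk (k : A₀ →ₐ[R] A) (η : A₀ →ₐ[R] R) (r : R) : Induced.mk k η 0 r = 0 :=
  DFunLike.congr_fun (map_zero (BalancedTensor.mkHom (S := A) (A := A₀) (Via k) (Triv η))) r

theorem Induced.mk_zero (k : A₀ →ₐ[R] A) (η : A₀ →ₐ[R] R) (a : A) : Induced.mk k η a 0 = 0 :=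
  map_zero (BalancedTensor.mkHom (S := A) (A := A₀) (Via k) (Triv η) a)

theorem Induced.map_map_eq_self {j : A₀ →ₐ[R] A} {k : B₀ →ₐ[R] B} {ε : A₀ →ₐ[R] R}
    {η : B₀ →ₐ[R] R} {φ : A →ₐ[R] B} {φ₀ : A₀ →ₐ[R] B₀} {ψ : B →ₐ[R] A} {ψ₀ : B₀ →ₐ[R] A₀}
    (hφ : φ.comp j = k.comp φ₀) (hε : η.comp φ₀ = ε) (hψ : ψ.comp k = j.comp ψ₀)
    (hη : ε.comp ψ₀ = η) (h : ψ.comp φ = AlgHom.id R A) (x : Induced j ε) :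
    Induced.map ψ ψ₀ hψ hη (Induced.map φ φ₀ hφ hε x) = x := by
  induction x using Induced.induction_on with
  | zero => rw [map_zero, map_zero]
  | mk a r => exact congrArg (fun b => Induced.mk j ε b r) (DFunLike.congr_fun h a)
  | add x y hx hy => rw [map_add, map_add, hx, hy]

end Induced

section Symmetric

variable (R : Type u) [CommRing R] {m n : ℕ} (h : m ≤ n)

theorem symAug_comp_symIncl : (symAug R n).comp (symIncl R h) = symAug R m := by
  refine MonoidAlgebra.algHom_ext (fun σ => ?_) (AlgHom.ext fun r =>
    (AlgHom.commutes _ r).trans (AlgHom.commutes _ r).symm)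
  change symAug R n (symIncl R h (MonoidAlgebra.of R _ σ)) = symAug R m (MonoidAlgebra.of R _ σ)
  rw [symIncl_of]
  rw [symAug, symAug, MonoidAlgebra.lift_of, MonoidAlgebra.lift_of]
  rfl

/-- With `J = 0` this is Shapiro's lemma: `R S_n` is free over `R S_m`, so a resolution over `R S_n`
restricts to one over `R S_m`. -/
theorem isExcisive_symAlgebra :
    IsExcisive (symIncl R h) (symAug R m) (symAug R n) (AlgHom.id R (SymAlgebra R m)) (symAug R m)
      (⊥ : AddSubgroup (SymAlgebra R n)) := by
  have hmul : ∀ s, ∀ a ∈ (⊥ : AddSubgroup (SymAlgebra R n)),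
      a * ((symIncl R h).comp (AlgHom.id R (SymAlgebra R m))) s ∈
        (⊥ : AddSubgroup (SymAlgebra R n)) := by
    rintro s a rfl
    exact zero_mul _
  refine ⟨hmul, AlgHom.comp_id _, ?_, ?_, fun u => ⟨u, ?_, rfl⟩, ?_, ?_,
    fun P => mulAcyclic_bot P.complex⟩
  · rw [AlgHom.comp_id, symAug_comp_symIncl]
  · rintro a rfl r
    exact Induced.zero_mk _ _ r
  · exact sub_self _
  · rintro a rfl
    exact map_zero _
  -- The group `S_m` acts freely on all of `S_n` by right translation, so `Y` is the whole basis.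
  · refine projective_quot_of_free_action (MonoidAlgebra.basis (Equiv.Perm (Fin n)) R) _
      (fun τ σ => τ * Equiv.Perm.viaEmbeddingHom (Fin.castLEEmb h) σ)
      (fun τ => by rw [map_one, mul_one]) (fun τ σ σ' => by rw [map_mul, mul_assoc])
      (fun τ σ => ?_) Set.univ (fun _ _ => Iff.rfl) (fun τ _ σ hσ => ?_) hmul ?_ ?_
      fun τ hτ => absurd (Set.mem_univ τ) hτ
    · refine (congrArg (_ * ·) (symIncl_of R h σ)).trans ?_
      rw [MonoidAlgebra.basis_apply, MonoidAlgebra.basis_apply, MonoidAlgebra.of_apply,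
        MonoidAlgebra.single_mul_single, mul_one]
      rfl
    · refine Equiv.Perm.viaEmbeddingHom_injective (Fin.castLEEmb h) ?_
      rw [map_one]
      exact mul_eq_left.1 hσ
    · rintro p a rfl
      exact mul_zero p
    · rintro a rfl τ -
      rw [map_zero]
      rfl

end Symmetric

section Brauer

variable {R : Type u} [CommRing R] {δ : R} {m n : ℕ} (h : m ≤ n)

theorem comp_extend_ofPerm_partner (d : Diagram (Fin n) (Fin n)) (σ : Equiv.Perm (Fin m))
    (x : Fin n ⊕ Fin n) :
    (d.comp (ofPerm (Equiv.Perm.viaEmbeddingHom (Fin.castLEEmb h) σ))).partner x =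
      Sum.map id (Equiv.Perm.viaEmbeddingHom (Fin.castLEEmb h) σ⁻¹) (d.partner
        (Sum.map id (Equiv.Perm.viaEmbeddingHom (Fin.castLEEmb h) σ) x)) := by
  rw [comp_ofPerm_partner, map_inv]

theorem viaEmbeddingHom_castLE (σ : Equiv.Perm (Fin m)) (i : Fin m) :
    Equiv.Perm.viaEmbeddingHom (Fin.castLEEmb h) σ (Fin.castLE h i) = Fin.castLE h (σ i) :=
  Equiv.Perm.viaEmbedding_apply σ (Fin.castLEEmb h) i

theorem comp_ofPerm_mem_innerArcs {d : Diagram (Fin n) (Fin n)} (hd : d ∈ innerArcs h)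
    (σ : Equiv.Perm (Fin m)) :
    d.comp (ofPerm (Equiv.Perm.viaEmbeddingHom (Fin.castLEEmb h) σ)) ∈ innerArcs h := by
  obtain ⟨i, j, hij⟩ := hd
  refine ⟨σ⁻¹ i, σ⁻¹ j, ?_⟩
  rw [comp_extend_ofPerm_partner, Sum.map_inr, viaEmbeddingHom_castLE,
    ← Equiv.Perm.mul_apply, mul_inv_cancel, Equiv.Perm.one_apply, hij, Sum.map_inr, viaEmbeddingHom_castLE]

theorem comp_ofPerm_comp_ofPerm (d : Diagram (Fin n) (Fin n)) (σ τ : Equiv.Perm (Fin m)) :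
    (d.comp (ofPerm (Equiv.Perm.viaEmbeddingHom (Fin.castLEEmb h) σ))).comp
        (ofPerm (Equiv.Perm.viaEmbeddingHom (Fin.castLEEmb h) τ)) =
      d.comp (ofPerm (Equiv.Perm.viaEmbeddingHom (Fin.castLEEmb h) (σ * τ))) := by
  rw [Diagram.comp_assoc, ofPerm_comp, map_mul]

theorem comp_ofPerm_mem_innerArcs_iff {d : Diagram (Fin n) (Fin n)} (σ : Equiv.Perm (Fin m)) :
    d.comp (ofPerm (Equiv.Perm.viaEmbeddingHom (Fin.castLEEmb h) σ)) ∈ innerArcs h ↔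
      d ∈ innerArcs h := by
  refine ⟨fun hd => ?_, fun hd => comp_ofPerm_mem_innerArcs h hd σ⟩
  have h1 := comp_ofPerm_mem_innerArcs h hd σ⁻¹
  rwa [comp_ofPerm_comp_ofPerm, mul_inv_cancel, map_one, comp_one] at h1

/-- Without inner arcs, the partner of each of the first `m` right nodes is a left node or a right
node beyond the first `m`, hence not moved by `σ`. If `d σ = d`, these partners determine `σ` to be
trivial. -/
theorem eq_one_of_comp_ofPerm_eq {d : Diagram (Fin n) (Fin n)} (hd : d ∉ innerArcs h)
    (σ : Equiv.Perm (Fin m))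
    (hσ : d.comp (ofPerm (Equiv.Perm.viaEmbeddingHom (Fin.castLEEmb h) σ)) = d) : σ = 1 := by
  refine inv_eq_one.1 (Equiv.ext fun i => ?_)
  let x := d.partner (Sum.inr (Fin.castLE h i))
  have hx : Sum.map id (Equiv.Perm.viaEmbeddingHom (Fin.castLEEmb h) σ) x = x := by
    rcases hx : x with a | y
    · rfl
    · refine congrArg Sum.inr (Equiv.Perm.viaEmbedding_apply_of_notMem σ (Fin.castLEEmb h) y ?_)
      rintro ⟨j, rfl⟩
      exact hd ⟨i, j, hx⟩
  have h1 := comp_extend_ofPerm_partner h d σ x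
  rw [hσ, hx, d.partner_partner, Sum.map_inr, viaEmbeddingHom_castLE] at h1
  exact (Fin.castLE_injective h (Sum.inr_injective h1)).symm

theorem brIncl_iota_of (σ : Equiv.Perm (Fin m)) :
    ((brIncl R δ h).comp (iota R δ m)) (MonoidAlgebra.of R _ σ) =
      basis R δ n (ofPerm (Equiv.Perm.viaEmbeddingHom (Fin.castLEEmb h) σ)) := by
  rw [← iota_comp_symIncl, AlgHom.comp_apply, symIncl_of, iota_of]
  rfl

theorem basis_mul_brIncl_iota_of (d : Diagram (Fin n) (Fin n)) (σ : Equiv.Perm (Fin m)) :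
    basis R δ n d * ((brIncl R δ h).comp (iota R δ m)) (MonoidAlgebra.of R _ σ) =
      basis R δ n (d.comp (ofPerm (Equiv.Perm.viaEmbeddingHom (Fin.castLEEmb h) σ))) := by
  rw [brIncl_iota_of, basis_mul_basis, loops_ofPerm_right, pow_zero, one_smul]

theorem mul_brIncl_iota_mem (s : SymAlgebra R m) (a : BrauerAlgebra R δ n)
    (ha : a ∈ diagramSpan R δ (innerArcs h)) :
    a * ((brIncl R δ h).comp (iota R δ m)) s ∈ diagramSpan R δ (innerArcs h) := by
  induction s using MonoidAlgebra.induction_on with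
  | of σ =>
    refine mul_mem_of_basis_mul_mem _ (fun d hd => ?_) ha
    rw [basis_mul_brIncl_iota_of]
    exact basis_mem_diagramSpan (comp_ofPerm_mem_innerArcs h hd σ)
  | add s t hs ht => rw [map_add, mul_add]; exact add_mem hs ht
  | smul r s hs => rw [map_smul, mul_smul_comm]; exact smul_mem_diagramSpan r hs

/-- A diagram `d` with an inner arc equals `d V u` with `u` a non-permutation diagram on `m` nodes,
and `u` can be moved across the tensor sign, where it acts on `𝟙` as `0`. -/
theorem mk_eq_zero_of_mem (hδ : IsUnit δ ∨ m < n) {a : BrauerAlgebra R δ n}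
    (ha : a ∈ diagramSpan R δ (innerArcs h)) (r : R) :
    Induced.mk (brIncl R δ h) (brAug R δ m) a r = 0 := by
  induction ha using diagramSpan_induction with
  | basis d hd =>
    obtain ⟨i, j, hij⟩ := hd
    obtain ⟨V, u, hu, -, h2, -⟩ := exists_arc_element (h := h) hδ (i := i) (j := j) (by
      rintro rfl
      exact d.partner_ne _ hij)
    rw [← h2 _ (basis_mem_diagramSpan (mem_arcs_singleton.2 hij)), ← mul_assoc, Induced.mk_mul,
      brAug_basis_of_not R δ m u hu, zero_mul]
    exact Induced.mk_zero _ _ _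
  | zero => exact Induced.zero_mk _ _ r
  | add x y _ _ hx hy => rw [Induced.add_mk, hx, hy, add_zero]
  | smul c x _ hx => rw [Algebra.smul_def, ← Induced.smul_mk, hx, smul_zero]

/-- On permutation diagrams the difference is zero. Any other diagram on `m` nodes is killed by `π`
and has an arc between two right nodes, by counting. -/
theorem brIncl_sub_mem (u : BrauerAlgebra R δ m) :
    brIncl R δ h u - ((brIncl R δ h).comp (iota R δ m)) (proj R δ m u) ∈
      diagramSpan R δ (innerArcs h) := by
  induction u using induction_basis with
  | zero => rw [map_zero, map_zero, map_zero, sub_zero]; exact zero_mem _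
  | add x y hx hy =>
    rw [map_add, map_add, map_add, add_sub_add_comm]
    exact add_mem hx hy
  | smul r d =>
    rw [map_smul, map_smul, map_smul, ← smul_sub]
    refine smul_mem_diagramSpan r ?_
    by_cases hd : ∃ σ, d = ofPerm σ
    · obtain ⟨σ, rfl⟩ := hd
      rw [proj_basis, piDiagram_ofPerm, AlgHom.comp_apply, iota_of, sub_self]
      exact zero_mem _
    · rw [proj_basis, piDiagram_of_not R m d hd, map_zero, sub_zero, brIncl_basis]
      refine basis_mem_diagramSpan ?_
      have h1 := mt (exists_ofPerm_of_right d) hd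
      push Not at h1
      obtain ⟨j, hj⟩ := h1
      rcases hx : d.partner (Sum.inr j) with i | i
      · exact absurd hx (hj i)
      · exact ⟨j, i, (extend_castLE h d (Sum.inr j)).trans (by rw [hx]; rfl)⟩

/-- Here `J` is spanned by the diagrams with an inner arc, and the complementary diagrams form the
part of the basis on which `S_m` acts freely. -/
theorem isExcisive_brauerAlgebra (hδ : IsUnit δ ∨ m < n) :
    IsExcisive (brIncl R δ h) (brAug R δ m) (brAug R δ n) (iota R δ m) (symAug R m)
      (diagramSpan R δ (innerArcs h)) := by
  refine ⟨mul_brIncl_iota_mem h, brAug_comp_iota R δ m, ?_, fun a ha r => mk_eq_zero_of_mem h hδ ha r,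
    fun u => ⟨proj R δ m u, brIncl_sub_mem h u, rfl⟩,
    fun a ha => brAug_eq_zero_of_mem_diagramSpan (fun d hd => not_ofPerm_of_mem_innerArcs hd) ha, ?_,
    mulAcyclic_innerArcs hδ⟩
  · rw [← iota_comp_symIncl, ← AlgHom.comp_assoc, brAug_comp_iota, symAug_comp_symIncl]
  · exact projective_quot_of_free_action (basis R δ n) _
      (fun d σ => d.comp (ofPerm (Equiv.Perm.viaEmbeddingHom (Fin.castLEEmb h) σ)))
      (fun d => by rw [map_one, comp_one]) (fun d σ τ => (comp_ofPerm_comp_ofPerm h d σ τ).symm)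
      (basis_mul_brIncl_iota_of h) (innerArcs h)ᶜ
      (fun d σ => not_congr (comp_ofPerm_mem_innerArcs_iff h σ))
      (fun d hd σ hσ => eq_one_of_comp_ofPerm_eq h hd σ hσ) (mul_brIncl_iota_mem h)
      (fun p a ha => mul_mem_diagramSpan (S := innerArcs h)
        (fun e d ⟨i, j, hij⟩ => ⟨i, j, comp_partner_inr e d hij⟩) p ha)
      (fun a ha d hd => mem_diagramSpan_iff.1 ha d hd)
      (fun d hd => basis_mem_diagramSpan (not_not.1 hd))

variable (R δ)

/-- Both sides are computed by resolutions of `𝟙` over the same ring `R S_m`, and `ι` trivially maps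
`J = 0` into the span of inner arcs. -/
theorem isIso_iotaStar (hδ : IsUnit δ ∨ m < n) (i : ℕ) : IsIso (iotaStar R δ h i) :=
  isIso_torMap _ _ _ (isExcisive_symAlgebra R h) (isExcisive_brauerAlgebra h hδ)
    (AlgHom.comp_id _) (by
      rintro a rfl
      rw [map_zero]
      exact zero_mem _) i

theorem iotaStar_comp_projStar (i : ℕ) : iotaStar R δ h i ≫ projStar R δ h i = 𝟙 _ := by
  exact torMap_comp_torMap _ _ (proj_comp_iota R δ n) _ _
    (Induced.map_map_eq_self (iota_comp_symIncl R δ h) (brAug_comp_iota R δ m)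
      (proj_comp_brIncl R δ h) rfl (proj_comp_iota R δ n)) i

end Brauer

end Excision
end Brauer

theorem mainTheorem4 {R : Type*} [CommRing R] (δ : R) (m n : ℕ) (hmn : m ≤ n)
    (hδ : IsUnit δ ∨ m < n) (i : ℕ) :
    CategoryTheory.CategoryStruct.comp (Brauer.iotaStar R δ hmn i) (Brauer.projStar R δ hmn i) =
        CategoryTheory.CategoryStruct.id (Brauer.symTor R hmn i) ∧
      CategoryTheory.CategoryStruct.comp (Brauer.projStar R δ hmn i) (Brauer.iotaStar R δ hmn i) =
        CategoryTheory.CategoryStruct.id (Brauer.brTor R δ hmn i) := by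
  have h1 := Brauer.iotaStar_comp_projStar R δ hmn i
  have h2 := Brauer.isIso_iotaStar R δ hmn hδ i
  refine ⟨h1, ?_⟩
  -- A one-sided inverse of the isomorphism `ι_*` is its inverse.
  rw [← CategoryTheory.IsIso.inv_eq_of_hom_inv_id h1, CategoryTheory.IsIso.inv_hom_id]
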